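/- Let $G$ be one of the groups $\mathrm{SO}(2n,\mathbb R)$ with $n\ge 3$, $\mathrm{SO}(2n+1,\mathbb R)$ with $n\ge 2$, $\mathrm{USp}(n,\mathbb H)=\{S\in \mathrm M_n(\mathbb H): SS^*=S^*S=I_n\}$ with $n\ge 2$, or $\mathrm{SU}(n,\mathbb C)$ with $n\ge 2$. Take as maximal torus, respectively, the matrices $\mathrm{diag}(R_{\theta_1},\dots,R_{\theta_n})$, the matrices $\mathrm{diag}(R_{\theta_1},\dots,R_{\theta_n},1)$, where $R_\theta=\begin{pmatrix}\cos\theta&-\sin\theta\\ \sin\theta&\cos\theta\end{pmatrix}$, the quaternionic matrices $\mathrm{diag}(e^{\mathrm i\theta_1},\dots,e^{\mathrm i\theta_n})$, and the complex matrices $\mathrm{diag}(e^{\mathrm i\theta_1},\dots,e^{\mathrm i\theta_n})$ of determinant $1$. An integer vector $\lambda=(\lambda_1,\dots,\lambda_n)$ gives the torus character $e^{\mathrm i(\lambda_1\theta_1+\cdots+\lambda_n\theta_n)}$; for $\mathrm{SU}(n)$, weights are labelled by vectors $(\lambda_1,\dots,\lambda_{n-1})$, with $\lambda_n=0$. Let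 $e^1,\dots,e^n$ be the coordinate vectors. The simple roots are $e^i-e^{i+1}$ $(1\le i\le n-1)$, together with $e^{n-1}+e^n$ for $\mathrm{SO}(2n)$, $e^n$ for $\mathrm{SO}(2n+1)$ and $2e^n$ for $\mathrm{USp}(n)$. A weight of a representation is its highest weight if it differs from every weight of the representation by a sum of simple roots. Let $\chi^\lambda$ denote the character of the irreducible continuous finite-dimensional complex representation of $G$ with highest weight $\lambda$. The characters $\chi^\lambda$ named below exist and are uniquely determined by $\lambda$, and $\chi^{(0,\dots,0)}=1$. If $G=\mathrm{SO}(2n,\mathbb R)$, $\mathrm{SO}(2n+1,\mathbb R)$ or $\mathrm{USp}(n,\mathbb H)$, then $\chi^{(1,0,\dots,0)_n}$ is real-valued and $$\bigl(\chi^{(1,0,\dots,0)_n}\bigr)^2=\chi^{(2,0,\dots,0)_n}+\chi^{(1,1,0,\dots,0)_n}+\chi^{(0,\dots,0)_n}.$$ If $G=\mathrm{SU}(n,\mathbb C)$, then $$\bigl|\chi^{(1,0,\dots,0)_{n-1}}\bigr|^2=\chi^{(1,\dots,1)_{n-1}}\,\chi^{(1,0,\dots,0)_{n-1}}=\chi^{(2,1,\dots,1)_{n-1}}+\chi^{(0,\dots,0)_{n-1}}.$$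 Here a subscript $m$ denotes the length of the sequence. -/

import Mathlib

section General

/-! Highest weights of representations of a group `G` with respect to a torus.  The torus is
given by a map `t : A → G` from a parameter set `A`, together with the coordinates
`z a = (z₁, …, zₙ)` in the unit circle of each parameter `a`. -/

variable {G A : Type} [Group G] [TopologicalSpace G] {n : ℕ}

/-- The character `e^μ = z₁ ^ μ₁ ⋯ zₙ ^ μₙ` attached to an integer vector `μ`. -/
noncomputable def torusChar (z : A → Fin n → Circle) (μ : Fin n → ℤ) (a : A) : ℂ :=
  ∏ i, (z a i : ℂ) ^ μ i

/-- The space of the vectors `v` such that `t a • v = ω a • v` for all torus elements `t a`;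
`ω` is a weight of the representation when this space is non-zero. -/
def weightSpace {d : ℕ} (t : A → G) (ρ : Representation ℂ G (Fin d → ℂ)) (ω : A → ℂ) :
    Submodule ℂ (Fin d → ℂ) where
  carrier := {v | ∀ a, ρ (t a) v = ω a • v}
  add_mem' {v w} hv hw a := by rw [map_add, hv a, hw a, smul_add]
  zero_mem' a := by simp
  smul_mem' c v hv a := by rw [map_smul, hv a, smul_comm]

/-- `lam` is the highest weight of `ρ`: it is a weight, and every weight `ω` is lower than or
equal to it, that is, `e^lam = ω * e^β` for a sum `β` of simple roots (elements of `P`). -/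
def IsHighestWeight {d : ℕ} (t : A → G) (z : A → Fin n → Circle) (P : Set (Fin n → ℤ))
    (ρ : Representation ℂ G (Fin d → ℂ)) (lam : Fin n → ℤ) : Prop :=
  weightSpace t ρ (torusChar z lam) ≠ ⊥ ∧
    ∀ ω : A → ℂ, weightSpace t ρ ω ≠ ⊥ →
      ∃ β ∈ AddSubmonoid.closure P, ∀ a, ω a * torusChar z β a = torusChar z lam a

/-- `χ` is the character of an irreducible continuous finite-dimensional complex representation
of `G` whose highest weight is `lam`. -/
def IsHighestWeightCharacter (t : A → G) (z : A → Fin n → Circle) (P : Set (Fin n → ℤ))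
    (lam : Fin n → ℤ) (χ : G → ℂ) : Prop :=
  ∃ (d : ℕ) (ρ : Representation ℂ G (Fin d → ℂ)),
    (∀ v, Continuous fun g => ρ g v) ∧ ρ.IsIrreducible ∧ IsHighestWeight t z P ρ lam ∧
      ∀ g, χ g = LinearMap.trace ℂ (Fin d → ℂ) (ρ g)

end General

section Roots

/-- The vectors `e_i - e_{i+1}` (simple roots of type `A`). -/
def simpleRootsA (n : ℕ) : Set (Fin n → ℤ) :=
  {α | ∃ i j : Fin n, (j : ℕ) = i + 1 ∧ α = Pi.single i 1 - Pi.single j 1}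

/-- The `e_i - e_{i+1}` together with `e_n`. -/
def simpleRootsB (n : ℕ) : Set (Fin n → ℤ) :=
  simpleRootsA n ∪ {α | ∃ i : Fin n, (i : ℕ) + 1 = n ∧ α = Pi.single i 1}

/-- The `e_i - e_{i+1}` together with `2 e_n`. -/
def simpleRootsC (n : ℕ) : Set (Fin n → ℤ) :=
  simpleRootsA n ∪ {α | ∃ i : Fin n, (i : ℕ) + 1 = n ∧ α = Pi.single i 2}

/-- The `e_i - e_{i+1}` together with `e_{n-1} + e_n`. -/
def simpleRootsD (n : ℕ) : Set (Fin n → ℤ) :=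
  simpleRootsA n ∪ {α | ∃ i j : Fin n, (i : ℕ) + 2 = n ∧ (j : ℕ) + 1 = n ∧
    α = Pi.single i 1 + Pi.single j 1}

end Roots

section Orthogonal

/-- The rotation of angle `θ`, for `z = e^{iθ}`. -/
noncomputable def rot (z : Circle) : Matrix (Fin 2) (Fin 2) ℝ :=
  !![(z : ℂ).re, -(z : ℂ).im; (z : ℂ).im, (z : ℂ).re]

theorem rot_mul_transpose (z : Circle) : rot z * (rot z).transpose = 1 := by
  have h : (z : ℂ).re * (z : ℂ).re + (z : ℂ).im * (z : ℂ).im = 1 := by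
    rw [← Complex.normSq_apply]; exact Circle.normSq_coe z
  ext i j
  fin_cases i <;> fin_cases j <;>
    simp [rot, Matrix.mul_apply, Fin.sum_univ_two] <;> linarith

theorem rot_det (z : Circle) : (rot z).det = 1 := by
  have h : (z : ℂ).re * (z : ℂ).re + (z : ℂ).im * (z : ℂ).im = 1 := by
    rw [← Complex.normSq_apply]; exact Circle.normSq_coe z
  simp [rot, Matrix.det_fin_two]; linarith

/-- `SO(2n)`; the `2n` coordinates are indexed by `Fin 2 × Fin n`. -/
abbrev SOEven (n : ℕ) := Matrix.specialOrthogonalGroup (Fin 2 × Fin n) ℝ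

/-- `SO(2n+1)`; the `2n+1` coordinates are indexed by `(Fin 2 × Fin n) ⊕ Unit`. -/
abbrev SOOdd (n : ℕ) := Matrix.specialOrthogonalGroup ((Fin 2 × Fin n) ⊕ Unit) ℝ

theorem blockRot_mul_transpose {n : ℕ} (z : Fin n → Circle) :
    Matrix.blockDiagonal (fun i => rot (z i)) *
      (Matrix.blockDiagonal (fun i => rot (z i))).transpose = 1 := by
  rw [Matrix.blockDiagonal_transpose, ← Matrix.blockDiagonal_mul]
  simp only [rot_mul_transpose]
  exact Matrix.blockDiagonal_one

/-- The block diagonal matrix of `SO(2n)` with blocks the rotations `rot zᵢ`. -/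
noncomputable def torusSOEven {n : ℕ} (z : Fin n → Circle) : SOEven n :=
  ⟨Matrix.blockDiagonal (fun i => rot (z i)), by
    rw [Matrix.mem_specialOrthogonalGroup_iff, Matrix.mem_orthogonalGroup_iff]
    refine ⟨blockRot_mul_transpose z, ?_⟩
    simp [Matrix.det_blockDiagonal, rot_det]⟩

/-- The block diagonal matrix of `SO(2n+1)` with blocks the rotations `rot zᵢ` and `1`. -/
noncomputable def torusSOOdd {n : ℕ} (z : Fin n → Circle) : SOOdd n :=
  ⟨Matrix.fromBlocks (Matrix.blockDiagonal (fun i => rot (z i))) 0 0 1, by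
    rw [Matrix.mem_specialOrthogonalGroup_iff, Matrix.mem_orthogonalGroup_iff]
    constructor
    · rw [Matrix.fromBlocks_transpose, Matrix.fromBlocks_multiply]
      simp only [Matrix.transpose_zero, Matrix.mul_zero, Matrix.zero_mul, add_zero, zero_add,
        Matrix.transpose_one, Matrix.mul_one, blockRot_mul_transpose, Matrix.fromBlocks_one]
    · simp [Matrix.det_blockDiagonal, rot_det]⟩

/-- `χ` is the irreducible character of `SO(2n)` of highest weight `lam`. -/
def IsCharSOEven (n : ℕ) (lam : Fin n → ℤ) (χ : SOEven n → ℂ) : Prop :=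
  IsHighestWeightCharacter torusSOEven (fun z : Fin n → Circle => z) (simpleRootsD n) lam χ

/-- `χ` is the irreducible character of `SO(2n+1)` of highest weight `lam`. -/
def IsCharSOOdd (n : ℕ) (lam : Fin n → ℤ) (χ : SOOdd n → ℂ) : Prop :=
  IsHighestWeightCharacter torusSOOdd (fun z : Fin n → Circle => z) (simpleRootsB n) lam χ

end Orthogonal

section Symplectic

/-- The compact symplectic group `USp(n)`: the quaternionic matrices `S` with
`S S* = S* S = 1`. -/
noncomputable abbrev USp (n : ℕ) := unitary (Matrix (Fin n) (Fin n) (Quaternion ℝ))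

theorem circle_quaternion (z : Circle) :
    star (Quaternion.coeComplex (z : ℂ)) * Quaternion.coeComplex (z : ℂ) = 1 ∧
      Quaternion.coeComplex (z : ℂ) * star (Quaternion.coeComplex (z : ℂ)) = 1 := by
  have h : (z : ℂ).re * (z : ℂ).re + (z : ℂ).im * (z : ℂ).im = 1 := by
    rw [← Complex.normSq_apply]; exact Circle.normSq_coe z
  have h' : Quaternion.normSq (Quaternion.coeComplex (z : ℂ)) = 1 := by
    simp [Quaternion.normSq_def']; nlinarith
  constructor
  · rw [Quaternion.star_mul_self, h']; rfl
  · rw [Quaternion.self_mul_star, h']; rfl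

/-- The diagonal quaternionic matrix `diag(z₁, …, zₙ)`, with `zᵢ` in `ℂ = ℝ + ℝ i ⊂ ℍ`. -/
noncomputable def torusUSp {n : ℕ} (z : Fin n → Circle) : USp n :=
  ⟨Matrix.diagonal (fun i => Quaternion.coeComplex (z i : ℂ)), by
    rw [Unitary.mem_iff, Matrix.star_eq_conjTranspose, Matrix.diagonal_conjTranspose,
      Matrix.diagonal_mul_diagonal, Matrix.diagonal_mul_diagonal, ← Matrix.diagonal_one]
    exact ⟨congrArg Matrix.diagonal (funext fun i => (circle_quaternion (z i)).1),
      congrArg Matrix.diagonal (funext fun i => (circle_quaternion (z i)).2)⟩⟩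

/-- `χ` is the irreducible character of `USp(n)` of highest weight `lam`. -/
def IsCharUSp (n : ℕ) (lam : Fin n → ℤ) (χ : USp n → ℂ) : Prop :=
  IsHighestWeightCharacter torusUSp (fun z : Fin n → Circle => z) (simpleRootsC n) lam χ

end Symplectic

section Unitary

/-- `SU(n)`. -/
abbrev SUn (n : ℕ) := Matrix.specialUnitaryGroup (Fin n) ℂ

/-- The diagonal matrix `diag(z₁, …, zₙ)` of `SU(n)`, where `z₁ ⋯ zₙ = 1`. -/
noncomputable def torusSU {n : ℕ} (z : {z : Fin n → Circle // ∏ i, z i = 1}) : SUn n :=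
  ⟨Matrix.diagonal (fun i => (z.1 i : ℂ)), by
    rw [Matrix.mem_specialUnitaryGroup_iff, Matrix.mem_unitaryGroup_iff]
    constructor
    · rw [Matrix.star_eq_conjTranspose, Matrix.diagonal_conjTranspose,
        Matrix.diagonal_mul_diagonal, ← Matrix.diagonal_one]
      refine congrArg Matrix.diagonal (funext fun i => ?_)
      simp [Complex.mul_conj]
    · rw [Matrix.det_diagonal]
      have h := congrArg (Circle.coeHom) z.2
      rw [map_prod, map_one] at h
      exact h⟩

/-- The sequence `(lam₁, …, lamₙ₋₁)` completed by `lamₙ = 0`. -/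
def padZero {n : ℕ} (lam : Fin (n - 1) → ℤ) : Fin n → ℤ :=
  fun i => if h : (i : ℕ) < n - 1 then lam ⟨i, h⟩ else 0

/-- `χ` is the irreducible character of `SU(n)` of highest weight labelled by
`(lam₁, …, lamₙ₋₁)`. -/
def IsCharSU (n : ℕ) (lam : Fin (n - 1) → ℤ) (χ : SUn n → ℂ) : Prop :=
  IsHighestWeightCharacter torusSU
    (fun z : {z : Fin n → Circle // ∏ i, z i = 1} => z.1) (simpleRootsA n) (padZero lam) χ

end Unitary

section Labels

/-- The label `(a, b, b, …, b)` of length `m`. -/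
def hookLabel (m : ℕ) (a b : ℤ) : Fin m → ℤ := fun i => if (i : ℕ) = 0 then a else b

/-- The label `(1, 1, 0, …, 0)` of length `m`. -/
def twoOnesLabel (m : ℕ) : Fin m → ℤ := fun i => if (i : ℕ) < 2 then 1 else 0

end Labels

/-! Let $V$ be the standard complex representation, of dimension $N$, given by matrices $\tau(g)$.
Then $V\otimes V$ is the space of $N\times N$ matrices under $M\mapsto\tau(g)M\tau(g)^{T}$, with
character $(\operatorname{tr}\tau)^2$. For $\mathrm{SO}$ and $\mathrm{USp}$ there is an invariant
bilinear form $K$ (the identity, or the symplectic matrix), so $M\mapsto\operatorname{tr}(MK)$ is an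
invariant linear form, and the matrices split into an invariant line, the traceless symmetric
matrices and the traceless antisymmetric ones. The line lies in $S^2V$ for $\mathrm{SO}$ and in
$\Lambda^2V$ for $\mathrm{USp}$; treating both symmetries at once makes one argument serve all three
families (`standard_character_sq`). The traceless parts are irreducible, with highest weight vectors
$u\otimes u$ and $u\otimes v-v\otimes u$, of weights $2e^1$ and $e^1+e^2$. For $\mathrm{SU}$ one
uses $V\otimes\overline V$, the matrices under conjugation, which split into scalar and trace-zero
matrices; here $\operatorname{tr}\overline\tau=\overline{\operatorname{tr}\tau}$, and weights count
modulo $(1,\dots,1)$.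

Irreducibility is proved by hand: torus elements or sign matrices isolate coordinates of a non-zero
matrix in an invariant subspace (`Submodule.mem_of_diagonal_stable`), then signed permutations and
one rational rotation produce enough matrix units.

The characters in the theorem are those of arbitrary irreducible representations with the given
highest weights, so uniqueness is needed too (`IsMaximalTorus.eq_of_isHighestWeightCharacter`). It
is obtained without integration or Lie algebras. Multiplicities of generalized weights are invariant
under conjugations that preserve the torus. If every dominant weight below $\lambda$ is the highest
weight of a known irreducible representation, a triangular system writes the character of any
irreducible representation of highest weight $\lambda$ as a linear combination of the known ones,
first on the torus and then everywhere, since the torus meets every conjugacy class. The density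
theorem, applied to the group algebra, forces the representation to be isomorphic to a known one,
and comparing highest weights tells which.

This requires diagonalization in each group, realizations of enough Weyl group elements, and the
short list of dominant weights concerned: $0$, $e^1$, $2e^1$, $e^1+e^2$ outside type $A$. The bound
$n\ge3$ for $\mathrm{SO}(2n)$ excludes the weight $(1,-1)$ of $\mathrm{SO}(4)$. -/

/-! ### Linear independence of irreducible characters -/

section Characters

open Module

variable {K G : Type*} [Field K] [Monoid G]

/-- Two non-isomorphic irreducible representations are separated by an element of the group
algebra. -/
theorem exists_asAlgebraHom_eq_one_eq_zero {V W : Type*} [AddCommGroup V] [Module K V]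
    [FiniteDimensional K V] [AddCommGroup W] [Module K W] [FiniteDimensional K W]
    (ρ : Representation K G V) (σ : Representation K G W) (hρ : ρ.IsIrreducible)
    (hσ : σ.IsIrreducible) (h : IsEmpty (ρ.Equiv σ)) :
    ∃ r : MonoidAlgebra K G, ρ.asAlgebraHom r = 1 ∧ σ.asAlgebraHom r = 0 := by
  classical
  have h' : IsEmpty (σ.Equiv ρ) := ⟨fun e => h.false e.symm⟩
  let R := MonoidAlgebra K G
  have h₁ (f : ρ.asModule →ₗ[R] σ.asModule) : f = 0 := by
    obtain ⟨g, rfl⟩ := (Representation.IntertwiningMap.equivLinearMapAsModule ρ σ).surjective f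
    rw [Subsingleton.elim g 0, map_zero]
  have h₂ (f : σ.asModule →ₗ[R] ρ.asModule) : f = 0 := by
    obtain ⟨g, rfl⟩ := (Representation.IntertwiningMap.equivLinearMapAsModule σ ρ).surjective f
    rw [Subsingleton.elim g 0, map_zero]
  -- By Schur's lemma there are no morphisms between the two summands, so the projection `p`
  -- commutes with every endomorphism of the sum. The density theorem then realizes it on a finite
  -- basis by an element of the group algebra.
  let p : End R (ρ.asModule × σ.asModule) := LinearMap.inl R _ _ ∘ₗ LinearMap.fst R _ _
  have hp (f : End R (ρ.asModule × σ.asModule)) (m : ρ.asModule × σ.asModule) :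
      p (f m) = f (p m) := by
    have e₁ := LinearMap.congr_fun (h₁ (LinearMap.snd R _ _ ∘ₗ f ∘ₗ LinearMap.inl R _ _)) m.1
    have e₂ := LinearMap.congr_fun (h₂ (LinearMap.fst R _ _ ∘ₗ f ∘ₗ LinearMap.inr R _ _)) m.2
    simp only [LinearMap.comp_apply, LinearMap.snd_apply, LinearMap.fst_apply,
      LinearMap.inl_apply, LinearMap.inr_apply, LinearMap.zero_apply] at e₁ e₂
    have hm : m = (m.1, 0) + (0, m.2) := by simp
    have e₃ : (f m).1 = (f (m.1, 0)).1 := by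
      conv_lhs => rw [hm, map_add]
      simp [e₂]
    ext
    · simp [p, e₃]
    · simp [p, e₁]
  have : IsSemisimpleModule R (ρ.asModule × σ.asModule) := by
    have h₁ := IsSemisimpleModule.range (LinearMap.inl R ρ.asModule σ.asModule)
    have h₂ := IsSemisimpleModule.range (LinearMap.inr R ρ.asModule σ.asModule)
    have h₃ := h₁.sup h₂
    rw [LinearMap.sup_range_inl_inr] at h₃
    exact IsSemisimpleModule.congr Submodule.topEquiv.symm
  let P : End (End R (ρ.asModule × σ.asModule)) (ρ.asModule × σ.asModule) :=
    { toFun := p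
      map_add' := map_add p
      map_smul' := fun f m => hp f m }
  let b := (Module.finBasis K V).prod (Module.finBasis K W)
  obtain ⟨r, hr⟩ := jacobson_density (R := R) (M := ρ.asModule × σ.asModule) P
    (Finset.univ.image fun i => (ρ.asModuleEquiv.symm (b i).1, σ.asModuleEquiv.symm (b i).2))
  have hr' (i) : ρ.asAlgebraHom r (b i).1 = (b i).1 ∧ σ.asAlgebraHom r (b i).2 = 0 := by
    have := hr _ (Finset.mem_image_of_mem _ (Finset.mem_univ i))
    have e₁ := congrArg ρ.asModuleEquiv (congrArg Prod.fst this)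
    have e₂ := congrArg σ.asModuleEquiv (congrArg Prod.snd this)
    rw [Prod.smul_fst, Representation.asModuleEquiv_map_smul] at e₁
    rw [Prod.smul_snd, Representation.asModuleEquiv_map_smul] at e₂
    exact ⟨e₁.symm, e₂.symm⟩
  refine ⟨r, (Module.finBasis K V).ext fun i => ?_, (Module.finBasis K W).ext fun i => ?_⟩
  · simpa [b] using (hr' (Sum.inl i)).1
  · simpa [b] using (hr' (Sum.inr i)).2

/-- If the character of an irreducible representation is a linear combination of characters of
irreducible representations, then the representation is isomorphic to one of these. -/
theorem exists_equiv_of_trace_eq_sum [CharZero K] {V : Type*} [AddCommGroup V] [Module K V]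
    [FiniteDimensional K V] (ρ : Representation K G V) (hρ : ρ.IsIrreducible)
    {ι : Type*} [Fintype ι] {W : ι → Type*} [∀ i, AddCommGroup (W i)] [∀ i, Module K (W i)]
    [∀ i, FiniteDimensional K (W i)] (σ : ∀ i, Representation K G (W i))
    (hσ : ∀ i, (σ i).IsIrreducible) (c : ι → K)
    (h : ∀ g, LinearMap.trace K V (ρ g) = ∑ i, c i * LinearMap.trace K (W i) (σ i g)) :
    ∃ i, Nonempty (ρ.Equiv (σ i)) := by
  classical
  by_contra! hne
  choose r hr₁ hr₂ using fun i =>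
    exists_asAlgebraHom_eq_one_eq_zero ρ (σ i) hρ (hσ i) (hne i)
  have key (x : MonoidAlgebra K G) : LinearMap.trace K V (ρ.asAlgebraHom x) =
      ∑ i, c i * LinearMap.trace K (W i) ((σ i).asAlgebraHom x) := by
    induction x using MonoidAlgebra.induction_linear with
    | zero => simp
    | add x y hx hy => simp [hx, hy, mul_add, Finset.sum_add_distrib]
    | single g a =>
      simp only [Representation.asAlgebraHom_single, map_smul, h, smul_eq_mul, Finset.mul_sum]
      exact Finset.sum_congr rfl fun i _ => by ring
  -- A product of the elements `r i` acts as the identity on `V` and as zero on every `W i`.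
  have hex : ∀ s : Finset ι, ∃ x : MonoidAlgebra K G, ρ.asAlgebraHom x = 1 ∧
      ∀ i ∈ s, (σ i).asAlgebraHom x = 0 := by
    intro s
    induction s using Finset.induction_on with
    | empty => exact ⟨1, map_one _, by simp⟩
    | insert i s _ ih =>
      obtain ⟨x, hx, hx'⟩ := ih
      refine ⟨r i * x, by simp [hx, hr₁], fun j hj => ?_⟩
      rcases Finset.mem_insert.1 hj with rfl | hj
      · simp [hr₂]
      · simp [hx' j hj]
  obtain ⟨x, hx, hx'⟩ := hex Finset.univ
  -- Evaluated at `x`, the trace identity reads `dim V = 0`, which is impossible in characteristic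
  -- zero for a non-zero space.
  have := key x
  rw [hx, Finset.sum_eq_zero fun i hi => by rw [hx' i hi]; simp, LinearMap.trace_one] at this
  have hnt : Nontrivial V := by
    by_contra hV
    rw [not_nontrivial_iff_subsingleton] at hV
    obtain ⟨a, b, hab⟩ := hρ.toNontrivial
    exact hab (Subrepresentation.toSubmodule_injective (Subsingleton.elim _ _))
  exact (Module.finrank_pos (R := K) (M := V)).ne' (by exact_mod_cast this)

end Characters

/-! ### Generalized weights of commuting operators -/

section GeneralizedWeights

open Module

variable {V A : Type*} [AddCommGroup V] [Module ℂ V]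

/-- The generalized simultaneous eigenspace of a family of endomorphisms. -/
noncomputable def genWeight (f : A → End ℂ V) (ω : A → ℂ) : Submodule ℂ V :=
  ⨅ a, (f a).maxGenEigenspace (ω a)

/-- The multiplicity of `ω` as a generalized weight of a family of endomorphisms. -/
noncomputable def weightMult (f : A → End ℂ V) (ω : A → ℂ) : ℕ := finrank ℂ (genWeight f ω)

variable {f : A → End ℂ V}

theorem mapsTo_genWeight (hf : ∀ a b, Commute (f a) (f b)) (ω : A → ℂ) (a : A) :
    Set.MapsTo (f a) (genWeight f ω) (genWeight f ω) := by
  intro v hv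
  simp only [genWeight, SetLike.mem_coe, Submodule.mem_iInf] at hv ⊢
  exact fun b => End.mapsTo_maxGenEigenspace_of_comm (hf b a) (ω b) (hv b)

variable [FiniteDimensional ℂ V]

open scoped Classical in
theorem isInternal_genWeight (hf : ∀ a b, Commute (f a) (f b)) :
    DirectSum.IsInternal (genWeight f) := by
  refine (DirectSum.isInternal_submodule_iff_iSupIndep_and_iSup_eq_top _).2 ⟨?_, ?_⟩
  · exact End.independent_iInf_maxGenEigenspace_of_forall_mapsTo f fun i j φ =>
      End.mapsTo_maxGenEigenspace_of_comm (hf j i) φ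
  · exact End.iSup_iInf_maxGenEigenspace_eq_top_of_forall_mapsTo f
      (fun i j φ => End.mapsTo_maxGenEigenspace_of_comm (hf j i) φ)
      fun a => End.iSup_maxGenEigenspace_eq_top (f a)

theorem finite_genWeight_ne_bot (hf : ∀ a b, Commute (f a) (f b)) :
    {ω | genWeight f ω ≠ ⊥}.Finite := by
  classical
  exact WellFoundedGT.finite_ne_bot_of_iSupIndep (isInternal_genWeight hf).submodule_iSupIndep

theorem weightMult_ne_zero_iff {ω : A → ℂ} : weightMult f ω ≠ 0 ↔ genWeight f ω ≠ ⊥ := by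
  rw [weightMult, Ne, Submodule.finrank_eq_zero]

/-- On the generalized weight space `f a - ω a` is nilpotent, hence of trace zero. -/
theorem trace_restrict_genWeight (hf : ∀ a b, Commute (f a) (f b)) (ω : A → ℂ) (a : A) :
    LinearMap.trace ℂ _ ((f a).restrict (mapsTo_genWeight hf ω a)) = weightMult f ω * ω a := by
  set g := (f a).restrict (mapsTo_genWeight hf ω a)
  have hnil : IsNilpotent (g - algebraMap ℂ _ (ω a)) := by
    have h₁ := End.isNilpotent_restrict_maxGenEigenspace_sub_algebraMap (f a) (ω a)
    have h₂ : Set.MapsTo (f a - algebraMap ℂ (End ℂ V) (ω a)) (genWeight f ω) (genWeight f ω) :=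
      fun v hv => sub_mem (mapsTo_genWeight hf ω a hv) (Submodule.smul_mem _ _ hv)
    exact End.isNilpotent_restrict_of_le (hp := h₂) (iInf_le _ a) h₁
  have := LinearMap.isNilpotent_trace_of_isNilpotent hnil
  rw [isNilpotent_iff_eq_zero, map_sub, sub_eq_zero] at this
  rw [this, Algebra.algebraMap_eq_smul_one, map_smul, LinearMap.trace_one, smul_eq_mul, mul_comm]
  rfl

theorem trace_eq_sum_weightMult (hf : ∀ a b, Commute (f a) (f b)) (a : A) :
    LinearMap.trace ℂ V (f a) =
      ∑ ω ∈ (finite_genWeight_ne_bot hf).toFinset, (weightMult f ω : ℂ) * ω a := by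
  classical
  rw [LinearMap.trace_eq_sum_trace_restrict' (isInternal_genWeight hf)
    (finite_genWeight_ne_bot hf) (fun ω => mapsTo_genWeight hf ω a)]
  exact Finset.sum_congr rfl fun ω _ => trace_restrict_genWeight hf ω a

-- The source of the Weyl invariance of multiplicities: `e` intertwines `f a` with `f (s a)`, so it
-- carries one generalized weight space onto the other.
omit [FiniteDimensional ℂ V] in
theorem weightMult_comp (e : V ≃ₗ[ℂ] V) (s : A ≃ A) (h : ∀ a v, e (f a v) = f (s a) (e v))
    (ω : A → ℂ) : weightMult f (ω ∘ s) = weightMult f ω := by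
  have key : (genWeight f (ω ∘ s)).map (e : V →ₗ[ℂ] V) = genWeight f ω := by
    have hpow (a : A) (c : ℂ) (k : ℕ) (v : V) :
        e (((f a - c • (1 : End ℂ V)) ^ k) v) = ((f (s a) - c • (1 : End ℂ V)) ^ k) (e v) := by
      induction k generalizing v with
      | zero => simp
      | succ k ih => rw [pow_succ, pow_succ, Module.End.mul_apply, ih]; simp [h]
    ext v
    simp only [Submodule.mem_map_equiv, genWeight, End.mem_iInf_maxGenEigenspace_iff]
    rw [← s.forall_congr_right (q := fun a => ∃ k : ℕ, ((f a - ω a • (1 : End ℂ V)) ^ k) v = 0)]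
    refine forall_congr' fun a => exists_congr fun k => ?_
    rw [← map_eq_zero_iff e e.injective, hpow]
    simp
  rw [weightMult, weightMult, ← key]
  exact (e.finrank_map_eq _).symm

/-- A minimal non-zero invariant subspace of the generalized weight space consists of eigenvectors:
otherwise the kernel of some `f a - ω a` would cut out a smaller one, which is non-zero by
nilpotency and invariant by commutation. -/
theorem exists_eigenvector_of_genWeight_ne_bot (hf : ∀ a b, Commute (f a) (f b)) {ω : A → ℂ}
    (h : genWeight f ω ≠ ⊥) : ∃ v ≠ 0, ∀ a, f a v = ω a • v := by
  let S : Set (Submodule ℂ V) :=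
    {p | p ≠ ⊥ ∧ p ≤ genWeight f ω ∧ ∀ a, ∀ v ∈ p, f a v ∈ p}
  obtain ⟨p, ⟨hp, hle, hinv⟩, hmin⟩ := wellFounded_lt.has_min S
    ⟨genWeight f ω, h, le_rfl, fun a v hv => mapsTo_genWeight hf ω a hv⟩
  have hall (a : A) : p ≤ LinearMap.ker (f a - ω a • (1 : End ℂ V)) := by
    by_contra hcon
    refine hmin (p ⊓ LinearMap.ker (f a - ω a • (1 : End ℂ V))) ⟨?_, inf_le_left.trans hle, ?_⟩
      (inf_lt_left.2 hcon)
    · obtain ⟨v, hv, hv0⟩ := p.ne_bot_iff.1 hp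
      have hk := (End.mem_iInf_maxGenEigenspace_iff f ω v).1 (hle hv) a
      classical
      have hpos : Nat.find hk ≠ 0 := fun h0 => hv0 (by simpa [h0] using Nat.find_spec hk)
      obtain ⟨k, hk'⟩ := Nat.exists_eq_succ_of_ne_zero hpos
      -- The last non-zero vector among the powers of `f a - ω a` applied to `v` lies in the kernel.
      refine Submodule.ne_bot_iff _ |>.2 ⟨((f a - ω a • (1 : End ℂ V)) ^ k) v, ⟨?_, ?_⟩, ?_⟩
      · have : ∀ k : ℕ, ((f a - ω a • (1 : End ℂ V)) ^ k) v ∈ p := by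
          intro k
          induction k with
          | zero => simpa
          | succ k ih =>
            rw [pow_succ', Module.End.mul_apply]
            exact sub_mem (hinv a _ ih) (p.smul_mem _ ih)
        exact this k
      · have := Nat.find_spec hk
        rw [hk', pow_succ', Module.End.mul_apply] at this
        exact this
      · exact Nat.find_min hk (by omega)
    · rintro b v ⟨hv, hv'⟩
      refine ⟨hinv b v hv, ?_⟩
      have hc : Commute (f a - ω a • (1 : End ℂ V)) (f b) :=
        (hf a b).sub_left (Algebra.commute_algebraMap_left (ω a) (f b))
      have := LinearMap.congr_fun hc.eq v
      simp only [SetLike.mem_coe, LinearMap.mem_ker] at hv' ⊢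
      rw [Module.End.mul_apply, Module.End.mul_apply, hv', map_zero] at this
      exact this
  obtain ⟨v, hv, hv0⟩ := p.ne_bot_iff.1 hp
  exact ⟨v, hv0, fun a => by simpa [sub_eq_zero] using hall a hv⟩

omit [FiniteDimensional ℂ V] in
theorem genWeight_ne_bot_of_eigenvector {ω : A → ℂ} {v : V} (hv : v ≠ 0)
    (h : ∀ a, f a v = ω a • v) : genWeight f ω ≠ ⊥ := by
  refine (Submodule.ne_bot_iff _).2 ⟨v, ?_, hv⟩
  exact (End.mem_iInf_maxGenEigenspace_iff f ω v).2 fun a => ⟨1, by simp [h a]⟩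

end GeneralizedWeights

/-! ### Uniqueness of the irreducible character with a given highest weight -/

section Uniqueness

open Module

variable {G A : Type} [Group G] {n : ℕ}

/-- `ω` is a weight of `ρ`, that is, `t a` acts on some non-zero vector as `ω a`. -/
def HasWeight {V : Type*} [AddCommGroup V] [Module ℂ V] (t : A → G) (ρ : Representation ℂ G V)
    (ω : A → ℂ) : Prop :=
  ∃ v ≠ 0, ∀ a, ρ (t a) v = ω a • v

theorem weightSpace_ne_bot_iff {d : ℕ} {t : A → G} {ρ : Representation ℂ G (Fin d → ℂ)}
    {ω : A → ℂ} : weightSpace t ρ ω ≠ ⊥ ↔ HasWeight t ρ ω := by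
  rw [Submodule.ne_bot_iff]
  exact exists_congr fun v => and_comm

/-- `ω'` is deduced from `ω` by an automorphism of the torus induced by a conjugation. -/
def WeylConj (t : A → G) (ω ω' : A → ℂ) : Prop :=
  ∃ (g : G) (s : A ≃ A), (∀ a, t (s a) = g * t a * g⁻¹) ∧ ω' = ω ∘ s

theorem WeylConj.refl (t : A → G) (ω : A → ℂ) : WeylConj t ω ω :=
  ⟨1, Equiv.refl A, by simp, rfl⟩

theorem WeylConj.trans {t : A → G} {ω₁ ω₂ ω₃ : A → ℂ} (h : WeylConj t ω₁ ω₂)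
    (h' : WeylConj t ω₂ ω₃) : WeylConj t ω₁ ω₃ := by
  obtain ⟨g, s, hs, rfl⟩ := h
  obtain ⟨g', s', hs', rfl⟩ := h'
  exact ⟨g * g', s'.trans s, fun a => by simp [hs, hs', mul_assoc], rfl⟩

section

variable {V : Type*} [AddCommGroup V] [Module ℂ V] {t : A → G} {ρ : Representation ℂ G V}
  {ω ω' : A → ℂ}

theorem HasWeight.weylConj (h : HasWeight t ρ ω) (hc : WeylConj t ω ω') : HasWeight t ρ ω' := by
  obtain ⟨g, s, hs, rfl⟩ := hc
  obtain ⟨v, hv, h⟩ := h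
  refine ⟨ρ g⁻¹ v, fun h0 => hv ?_, fun a => ?_⟩
  · simpa using congrArg (ρ g) h0
  · have : ρ (t a) (ρ g⁻¹ v) = ρ g⁻¹ (ρ (t (s a)) v) := by
      simp only [← Module.End.mul_apply, ← map_mul, hs]
      congr 2
      group
    rw [this, h, map_smul]
    rfl

theorem HasWeight.equiv {W : Type*} [AddCommGroup W] [Module ℂ W] {σ : Representation ℂ G W}
    (h : HasWeight t ρ ω) (e : ρ.Equiv σ) : HasWeight t σ ω := by
  obtain ⟨v, hv, h⟩ := h
  refine ⟨e v, fun h0 => hv (e.toLinearEquiv.map_eq_zero_iff.1 h0), fun a => ?_⟩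
  have h₂ : e (ρ (t a) v) = σ (t a) (e v) := e.toIntertwiningMap.isIntertwining _ _ (t a) v
  rw [← h₂, h]
  exact e.toLinearEquiv.map_smul _ _

theorem weightMult_weylConj (hc : WeylConj t ω ω') :
    weightMult (fun a => ρ (t a)) ω' = weightMult (fun a => ρ (t a)) ω := by
  obtain ⟨g, s, hs, rfl⟩ := hc
  let e : V ≃ₗ[ℂ] V := LinearEquiv.ofLinearMap (ρ g) (ρ g⁻¹)
    (by rw [← Module.End.mul_eq_comp, ← map_mul]; simp; rfl)
    (by rw [← Module.End.mul_eq_comp, ← map_mul]; simp; rfl)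
  refine weightMult_comp e s (fun a v => ?_) ω
  have : ρ g * ρ (t a) = ρ (t (s a)) * ρ g := by
    rw [← map_mul, ← map_mul, hs]
    group
  exact LinearMap.congr_fun this v

theorem trace_apply_conj (p g : G) :
    LinearMap.trace ℂ V (ρ (p * g * p⁻¹)) = LinearMap.trace ℂ V (ρ g) := by
  rw [map_mul, LinearMap.trace_mul_comm, ← map_mul]
  congr 2
  group

theorem weightMult_ne_zero_iff_hasWeight [FiniteDimensional ℂ V]
    (ht : ∀ a b, Commute (t a) (t b)) :
    weightMult (fun a => ρ (t a)) ω ≠ 0 ↔ HasWeight t ρ ω := by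
  rw [weightMult_ne_zero_iff]
  exact ⟨exists_eigenvector_of_genWeight_ne_bot fun a b => (ht a b).map ρ,
    fun ⟨v, hv, h⟩ => genWeight_ne_bot_of_eigenvector hv h⟩

end

/-- A square system of linear equations which is triangular for a height function is solvable. -/
theorem exists_sum_eq_of_triangular {D : Type*} [Fintype D] (h : D → ℤ)
    (hinj : Function.Injective h) (m : D → D → ℂ) (hdiag : ∀ i, m i i ≠ 0)
    (htri : ∀ i j, h i < h j → m i j = 0) (φ : D → ℂ) :
    ∃ c : D → ℂ, ∀ j, φ j = ∑ i, c i * m i j := by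
  -- Ordered by height, the matrix of the system is triangular with non-zero diagonal, hence
  -- invertible.
  let _ : LinearOrder D := LinearOrder.lift' h hinj
  let M : Matrix D D ℂ := Matrix.of fun j i => m i j
  have hM : M.BlockTriangular id := fun j i hij => htri i j hij
  have hdet : IsUnit M.det := by
    rw [Matrix.det_of_isUpperTriangular hM, isUnit_iff_ne_zero]
    exact Finset.prod_ne_zero_iff.2 fun i _ => hdiag i
  refine ⟨M⁻¹.mulVec φ, fun j => ?_⟩
  have := congrFun (Matrix.mulVec_mulVec φ M M⁻¹) j
  rw [Matrix.mul_nonsing_inv _ hdet, Matrix.one_mulVec] at this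
  rw [← this]
  exact Finset.sum_congr rfl fun i _ => mul_comm _ _

/-- A representation whose weights are all conjugate to members of a list `δ` has a character which
is a linear combination of the characters of representations of highest weights the members of
`δ`. -/
theorem exists_trace_eq_sum {t : A → G} (ht : ∀ a b, Commute (t a) (t b))
    (hG : ∀ g, ∃ p a, g = p * t a * p⁻¹) {D : Type*} [Fintype D] (δ : D → A → ℂ)
    (h : D → ℤ) (hinj : Function.Injective h)
    {V : Type*} [AddCommGroup V] [Module ℂ V] [FiniteDimensional ℂ V] (ρ : Representation ℂ G V)
    (hρ : ∀ ω, HasWeight t ρ ω → ∃ i, WeylConj t ω (δ i))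
    {W : D → Type*} [∀ i, AddCommGroup (W i)] [∀ i, Module ℂ (W i)]
    [∀ i, FiniteDimensional ℂ (W i)] (σ : ∀ i, Representation ℂ G (W i))
    (hσ : ∀ i ω, HasWeight t (σ i) ω → ∃ j, WeylConj t ω (δ j))
    (hdiag : ∀ i, HasWeight t (σ i) (δ i))
    (htri : ∀ i j, HasWeight t (σ i) (δ j) → h j ≤ h i) :
    ∃ c : D → ℂ, ∀ g, LinearMap.trace ℂ V (ρ g) =
      ∑ i, c i * LinearMap.trace ℂ (W i) (σ i g) := by
  classical
  obtain ⟨c, hc⟩ := exists_sum_eq_of_triangular h hinj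
    (fun i j => (weightMult (fun a => σ i (t a)) (δ j) : ℂ))
    (fun i => Nat.cast_ne_zero.2 ((weightMult_ne_zero_iff_hasWeight ht).2 (hdiag i)))
    (fun i j hij => by
      by_contra hne
      exact absurd (htri i j ((weightMult_ne_zero_iff_hasWeight ht).1 (Nat.cast_ne_zero.1 hne)))
        (not_le.2 hij))
    (fun j => (weightMult (fun a => ρ (t a)) (δ j) : ℂ))
  -- The `c i` are chosen so that multiplicities agree at each `δ j`. Conjugation invariance extends
  -- this to the weights conjugate to some `δ j`, and no other weight occurs in any of the
  -- representations.
  have hmult (ω : A → ℂ) : (weightMult (fun a => ρ (t a)) ω : ℂ) =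
      ∑ i, c i * (weightMult (fun a => σ i (t a)) ω : ℂ) := by
    by_cases hω : ∃ j, WeylConj t ω (δ j)
    · obtain ⟨j, hj⟩ := hω
      simpa only [weightMult_weylConj hj] using hc j
    · have h₁ : weightMult (fun a => ρ (t a)) ω = 0 := by
        by_contra hne
        exact hω (hρ ω ((weightMult_ne_zero_iff_hasWeight ht).1 hne))
      have h₂ (i) : weightMult (fun a => σ i (t a)) ω = 0 := by
        by_contra hne
        exact hω (hσ i ω ((weightMult_ne_zero_iff_hasWeight ht).1 hne))
      simp [h₁, h₂]
  have hρt := finite_genWeight_ne_bot (f := fun a => ρ (t a)) fun a b => (ht a b).map ρ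
  have hσt (i) := finite_genWeight_ne_bot (f := fun a => σ i (t a)) fun a b => (ht a b).map (σ i)
  -- A common finite support, so that all traces are sums over the same set of weights.
  let S : Finset (A → ℂ) := hρt.toFinset ∪ Finset.univ.biUnion fun i => (hσt i).toFinset
  have h₁ (a : A) : LinearMap.trace ℂ V (ρ (t a)) =
      ∑ ω ∈ S, (weightMult (fun a => ρ (t a)) ω : ℂ) * ω a := by
    rw [trace_eq_sum_weightMult (f := fun a => ρ (t a)) (fun a b => (ht a b).map ρ) a]
    refine Finset.sum_subset Finset.subset_union_left fun ω _ hω => ?_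
    have : weightMult (fun a => ρ (t a)) ω = 0 := by
      by_contra hne
      exact hω (by simpa using weightMult_ne_zero_iff.1 hne)
    simp [this]
  have h₂ (i) (a : A) : LinearMap.trace ℂ (W i) (σ i (t a)) =
      ∑ ω ∈ S, (weightMult (fun a => σ i (t a)) ω : ℂ) * ω a := by
    rw [trace_eq_sum_weightMult (f := fun a => σ i (t a)) (fun a b => (ht a b).map (σ i)) a]
    refine Finset.sum_subset ((Finset.subset_biUnion_of_mem (fun i => (hσt i).toFinset)
      (Finset.mem_univ i)).trans Finset.subset_union_right) fun ω _ hω => ?_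
    have : weightMult (fun a => σ i (t a)) ω = 0 := by
      by_contra hne
      exact hω (by simpa using weightMult_ne_zero_iff.1 hne)
    simp [this]
  refine ⟨c, fun g => ?_⟩
  obtain ⟨p, a, rfl⟩ := hG g
  simp only [trace_apply_conj, h₁, h₂, Finset.mul_sum]
  rw [Finset.sum_comm]
  refine Finset.sum_congr rfl fun ω _ => ?_
  rw [hmult, Finset.sum_mul]
  exact Finset.sum_congr rfl fun i _ => by ring

theorem Circle.zpow_left_injective {k l : ℤ} (h : ∀ w : Circle, w ^ k = w ^ l) : k = l := by
  by_contra hne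
  have hm : (k - l : ℤ) ≠ 0 := sub_ne_zero.2 hne
  -- At this point the quotient of the two powers is $e^{\mathrm i\pi}=-1$.
  have h₁ := h (Circle.exp (Real.pi / (k - l : ℤ)))
  rw [← mul_inv_eq_one, ← zpow_neg, ← zpow_add, ← sub_eq_add_neg, ← Circle.exp_zsmul,
    zsmul_eq_mul, mul_div_cancel₀ _ (Int.cast_ne_zero.2 hm)] at h₁
  have := congrArg (fun w : Circle => (w : ℂ)) h₁
  simp at this
  norm_num at this

theorem torusChar_cochar {z : A → Fin n → Circle} {c : Circle → A} {h : Fin n → ℤ}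
    (hc : ∀ w i, z (c w) i = w ^ h i) (μ : Fin n → ℤ) (w : Circle) :
    torusChar z μ (c w) = ((w ^ ∑ i, h i * μ i : Circle) : ℂ) := by
  simp only [torusChar, hc]
  have (s : Finset (Fin n)) : ((w ^ ∑ i ∈ s, h i * μ i : Circle) : ℂ) =
      ∏ i ∈ s, ((w ^ h i : Circle) : ℂ) ^ μ i := by
    induction s using Finset.cons_induction with
    | empty => simp
    | cons a s ha ih => rw [Finset.sum_cons, Finset.prod_cons, zpow_add, ← ih, zpow_mul]; simp
  exact (this _).symm

/-- The properties of the torus `t` used for the determination of the characters: its elements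
commute and meet every conjugacy class, and the integer vector `h` is a dominant cocharacter. -/
structure IsMaximalTorus (t : A → G) (z : A → Fin n → Circle) (P : Set (Fin n → ℤ))
    (h : Fin n → ℤ) : Prop where
  commute : ∀ a b, Commute (t a) (t b)
  exists_conj : ∀ g, ∃ p a, g = p * t a * p⁻¹
  cochar : ∃ c : Circle → A, ∀ w i, z (c w) i = w ^ h i
  nonneg : ∀ α ∈ P, 0 ≤ ∑ i, h i * α i

/-- The list `δ` contains a representative of each conjugacy class of characters of the torus that
consists of characters lower than a member of `δ`. -/
def IsDominantList (t : A → G) (z : A → Fin n → Circle) (P : Set (Fin n → ℤ)) {D : Type*}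
    (δ : D → Fin n → ℤ) : Prop :=
  ∀ ω i, (∀ ω', WeylConj t ω ω' →
      ∃ β ∈ AddSubmonoid.closure P, ∀ a, ω' a * torusChar z β a = torusChar z (δ i) a) →
    ∃ j, WeylConj t ω (torusChar z (δ j))

/-- Along the cocharacter the relation becomes an equality of powers of one variable, and sums of
simple roots pair non-negatively with `h`. This turns the order on weights into an integer
inequality. -/
theorem IsMaximalTorus.le_of_mul_torusChar {t : A → G} {z : A → Fin n → Circle}
    {P : Set (Fin n → ℤ)} {h : Fin n → ℤ} (hT : IsMaximalTorus t z P h) {lam μ β : Fin n → ℤ}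
    (hβ : β ∈ AddSubmonoid.closure P)
    (heq : ∀ a, torusChar z μ a * torusChar z β a = torusChar z lam a) :
    ∑ i, h i * μ i ≤ ∑ i, h i * lam i := by
  obtain ⟨c, hc⟩ := hT.cochar
  have hβ0 : 0 ≤ ∑ i, h i * β i := by
    clear heq
    induction hβ using AddSubmonoid.closure_induction with
    | mem α hα => exact hT.nonneg α hα
    | zero => simp
    | add x y _ _ hx hy => simpa [mul_add, Finset.sum_add_distrib] using add_nonneg hx hy
  have : ∑ i, h i * μ i + ∑ i, h i * β i = ∑ i, h i * lam i :=
    Circle.zpow_left_injective fun w => by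
      have := heq (c w)
      rw [torusChar_cochar hc, torusChar_cochar hc, torusChar_cochar hc, ← Circle.coe_mul,
        ← zpow_add] at this
      exact Subtype.coe_injective this
  omega

variable [TopologicalSpace G]

/-- An irreducible character is determined by its highest weight in a list of dominant weights
which are all highest weights. -/
theorem IsMaximalTorus.eq_of_isHighestWeightCharacter {t : A → G} {z : A → Fin n → Circle}
    {P : Set (Fin n → ℤ)} {h : Fin n → ℤ} (hT : IsMaximalTorus t z P h) {D : Type*} [Fintype D]
    {δ : D → Fin n → ℤ} (hδ : IsDominantList t z P δ)
    (hinj : Function.Injective fun i => ∑ k, h k * δ i k) {χ : D → G → ℂ}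
    (hχ : ∀ i, IsHighestWeightCharacter t z P (δ i) (χ i)) {i : D} {χ' : G → ℂ}
    (h' : IsHighestWeightCharacter t z P (δ i) χ') : χ' = χ i := by
  choose d σ _ hirr hw htr using hχ
  obtain ⟨e, ρ, _, hρirr, hρw, hρtr⟩ := h'
  have hdom {d : ℕ} {τ : Representation ℂ G (Fin d → ℂ)} {j : D}
      (hτ : IsHighestWeight t z P τ (δ j)) (ω : A → ℂ) (hω : HasWeight t τ ω) :
      ∃ k, WeylConj t ω (torusChar z (δ k)) :=
    hδ ω j fun ω' hω' => hτ.2 ω' (weightSpace_ne_bot_iff.2 (hω.weylConj hω'))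
  have hheight {d : ℕ} {τ : Representation ℂ G (Fin d → ℂ)} {j k : D}
      (hτ : IsHighestWeight t z P τ (δ j)) (hk : HasWeight t τ (torusChar z (δ k))) :
      ∑ l, h l * δ k l ≤ ∑ l, h l * δ j l := by
    obtain ⟨β, hβ, heq⟩ := hτ.2 _ (weightSpace_ne_bot_iff.2 hk)
    exact hT.le_of_mul_torusChar hβ heq
  obtain ⟨c, hc⟩ := exists_trace_eq_sum hT.commute hT.exists_conj (fun i => torusChar z (δ i))
    _ hinj ρ (hdom hρw) σ (fun i => hdom (hw i)) (fun i => weightSpace_ne_bot_iff.1 (hw i).1)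
    (fun i j hij => hheight (hw i) hij)
  obtain ⟨j, ⟨f⟩⟩ := exists_equiv_of_trace_eq_sum ρ hρirr σ hirr c hc
  -- Isomorphic representations have the same weights, so each of the two highest weights is a
  -- weight of the other representation and their heights agree.
  have hij : i = j := hinj (le_antisymm
    (hheight (hw j) ((weightSpace_ne_bot_iff.1 hρw.1).equiv f))
    (hheight hρw ((weightSpace_ne_bot_iff.1 (hw j).1).equiv f.symm)))
  subst hij
  funext g
  rw [hρtr, htr, ← Representation.Equiv.conj_apply_self g f]
  exact (LinearMap.trace_conj' _ _).symm

end Uniqueness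

/-! ### Simple roots, heights and the small dominant labels -/

section Dominance

variable {n : ℕ}

theorem nonneg_of_mem_closure {P : Set (Fin n → ℤ)} (f : (Fin n → ℤ) →+ ℤ)
    (hf : ∀ α ∈ P, 0 ≤ f α) {β : Fin n → ℤ} (hβ : β ∈ AddSubmonoid.closure P) : 0 ≤ f β := by
  induction hβ using AddSubmonoid.closure_induction with
  | mem α hα => exact hf α hα
  | zero => simp
  | add x y _ _ hx hy => simpa using add_nonneg hx hy

/-- The sum of the coordinates weighted by `c`. -/
def weightedSum (c : Fin n → ℤ) : (Fin n → ℤ) →+ ℤ where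
  toFun μ := ∑ i, c i * μ i
  map_zero' := by simp
  map_add' x y := by simp [mul_add, Finset.sum_add_distrib]

theorem weightedSum_apply (c μ : Fin n → ℤ) : weightedSum c μ = ∑ i, c i * μ i := rfl

theorem weightedSum_single (c : Fin n → ℤ) (i : Fin n) (x : ℤ) :
    weightedSum c (Pi.single i x) = c i * x := by
  rw [weightedSum_apply, Finset.sum_eq_single i] <;> simp +contextual

theorem weightedSum_simpleRootsA {c : Fin n → ℤ}
    (hc : ∀ i j : Fin n, (j : ℕ) = i + 1 → c j ≤ c i) :
    ∀ α ∈ simpleRootsA n, 0 ≤ weightedSum c α := by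
  rintro α ⟨i, j, hij, rfl⟩
  rw [map_sub, weightedSum_single, weightedSum_single]
  have := hc i j hij
  omega

theorem weightedSum_simpleRootsB {c : Fin n → ℤ}
    (hc : ∀ i j : Fin n, (j : ℕ) = i + 1 → c j ≤ c i) (h0 : ∀ i, 0 ≤ c i) :
    ∀ α ∈ simpleRootsB n, 0 ≤ weightedSum c α := by
  rintro α (hα | ⟨i, _, rfl⟩)
  · exact weightedSum_simpleRootsA hc α hα
  · rw [weightedSum_single]
    have := h0 i
    omega

theorem weightedSum_simpleRootsC {c : Fin n → ℤ}
    (hc : ∀ i j : Fin n, (j : ℕ) = i + 1 → c j ≤ c i) (h0 : ∀ i, 0 ≤ c i) :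
    ∀ α ∈ simpleRootsC n, 0 ≤ weightedSum c α := by
  rintro α (hα | ⟨i, _, rfl⟩)
  · exact weightedSum_simpleRootsA hc α hα
  · rw [weightedSum_single]
    have := h0 i
    omega

theorem weightedSum_simpleRootsD {c : Fin n → ℤ}
    (hc : ∀ i j : Fin n, (j : ℕ) = i + 1 → c j ≤ c i)
    (h0 : ∀ i j : Fin n, (i : ℕ) + 2 = n → (j : ℕ) + 1 = n → 0 ≤ c i + c j) :
    ∀ α ∈ simpleRootsD n, 0 ≤ weightedSum c α := by
  rintro α (hα | ⟨i, j, hi, hj, rfl⟩)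
  · exact weightedSum_simpleRootsA hc α hα
  · rw [map_add, weightedSum_single, weightedSum_single]
    have := h0 i j hi hj
    omega

/-- The cocharacter `(n, n - 1, …, 1)`. -/
def stairs (n : ℕ) : Fin n → ℤ := fun i => n - i

/-- The four dominant labels `0`, `(1, 0, …)`, `(2, 0, …)`, `(1, 1, 0, …)`. -/
def smallLabels (n : ℕ) : Fin 4 → Fin n → ℤ :=
  ![0, hookLabel n 1 0, hookLabel n 2 0, twoOnesLabel n]

/-- The second coordinate decides. If it is positive, the sum bound leaves only $(1,1,0,\dots)$; if
it is zero, so are the later ones, and the first is at most $2$. -/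
theorem exists_eq_smallLabels (hn : 2 ≤ n) {μ : Fin n → ℤ} (hanti : Antitone μ)
    (h0 : ∀ i, 0 ≤ μ i) (hsum : ∑ i, μ i ≤ 2) : ∃ j, μ = smallLabels n j := by
  obtain ⟨m, rfl⟩ := Nat.exists_eq_add_of_le' hn
  rw [Fin.sum_univ_succ, Fin.sum_univ_succ] at hsum
  have hrest : 0 ≤ ∑ i : Fin m, μ i.succ.succ := Finset.sum_nonneg fun i _ => h0 _
  have h01 : μ (Fin.succ 0) ≤ μ 0 := hanti (Fin.zero_le _)
  have h00 := h0 0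
  rcases (h0 (Fin.succ 0)).lt_or_eq with h1 | h1
  · have hz : ∑ i : Fin m, μ i.succ.succ = 0 := by omega
    rw [Finset.sum_eq_zero_iff_of_nonneg fun i _ => h0 _] at hz
    refine ⟨3, funext fun i => ?_⟩
    refine Fin.cases ?_ (fun i => Fin.cases ?_ (fun i => ?_) i) i
    · simp [smallLabels, twoOnesLabel]; omega
    · have : smallLabels (m + 2) 3 (Fin.succ 0) = 1 := by simp [smallLabels, twoOnesLabel]
      omega
    · have := hz i (Finset.mem_univ _)
      simp [smallLabels, twoOnesLabel, this]
  · have hz (i : Fin (m + 1)) : μ i.succ = 0 :=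
      le_antisymm (h1.symm ▸ hanti (Fin.succ_le_succ_iff.2 (Fin.zero_le _))) (h0 _)
    have hlt : μ 0 = 0 ∨ μ 0 = 1 ∨ μ 0 = 2 := by omega
    rcases hlt with h | h | h
    · refine ⟨0, funext fun i => Fin.cases ?_ (fun i => ?_) i⟩ <;> simp [smallLabels, h, hz]
    · refine ⟨1, funext fun i => Fin.cases ?_ (fun i => ?_) i⟩ <;>
        simp [smallLabels, hookLabel, h, hz]
    · refine ⟨2, funext fun i => Fin.cases ?_ (fun i => ?_) i⟩ <;>
        simp [smallLabels, hookLabel, h, hz]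

theorem smallLabels_nonneg (n : ℕ) (j : Fin 4) (i : Fin n) : 0 ≤ smallLabels n j i := by
  fin_cases j <;> simp [smallLabels, hookLabel, twoOnesLabel] <;> split_ifs <;> simp

theorem weightedSum_hookLabel (hn : 0 < n) (c : Fin n → ℤ) (a : ℤ) :
    weightedSum c (hookLabel n a 0) = c ⟨0, hn⟩ * a := by
  have : hookLabel n a 0 = Pi.single ⟨0, hn⟩ a := by
    funext i
    simp [hookLabel, Pi.single_apply, Fin.ext_iff]
  rw [this, weightedSum_single]

theorem weightedSum_twoOnesLabel (hn : 1 < n) (c : Fin n → ℤ) :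
    weightedSum c (twoOnesLabel n) = c ⟨0, by omega⟩ + c ⟨1, hn⟩ := by
  have : twoOnesLabel n = Pi.single ⟨0, by omega⟩ 1 + Pi.single ⟨1, hn⟩ 1 := by
    funext i
    simp only [twoOnesLabel, Pi.add_apply, Pi.single_apply, Fin.ext_iff]
    split_ifs <;> omega
  rw [this, map_add, weightedSum_single, weightedSum_single, mul_one, mul_one]

theorem weightedSum_smallLabels_le (hn : 2 ≤ n) (j : Fin 4) :
    weightedSum 1 (smallLabels n j) ≤ 2 := by
  fin_cases j
  · exact (map_zero (weightedSum (1 : Fin n → ℤ))).trans_le (by norm_num)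
  · exact (weightedSum_hookLabel (by omega) _ _).trans_le (by norm_num)
  · exact (weightedSum_hookLabel (by omega) _ _).trans_le (by norm_num)
  · exact (weightedSum_twoOnesLabel (by omega) _).trans_le (by norm_num)

/-- The heights are $0$, $n$, $2n$ and $2n-1$, which are distinct for $n\ge2$. -/
theorem injective_weightedSum_smallLabels (hn : 2 ≤ n) :
    Function.Injective fun j => ∑ k, stairs n k * smallLabels n j k := by
  have h0 : weightedSum (stairs n) (smallLabels n 0) = 0 := map_zero _
  have h1 : weightedSum (stairs n) (smallLabels n 1) = n :=
    (weightedSum_hookLabel (by omega) _ _).trans (by simp [stairs])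
  have h2 : weightedSum (stairs n) (smallLabels n 2) = 2 * n :=
    (weightedSum_hookLabel (by omega) _ _).trans (by simp [stairs]; ring)
  have h3 : weightedSum (stairs n) (smallLabels n 3) = 2 * n - 1 :=
    (weightedSum_twoOnesLabel (by omega) _).trans (by simp [stairs]; ring)
  intro i j hij
  change weightedSum (stairs n) (smallLabels n i) = weightedSum (stairs n) (smallLabels n j) at hij
  fin_cases i <;> fin_cases j <;> first | rfl | (exfalso; simp at hij; omega)

/-- In type $D$ dominance allows a negative last coordinate. All the others are then at least $1$,
so the sum of absolute values is at least $n\ge3$, while `hsum` bounds it by $2$. For $n=2$ the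
vector $(1,-1)$ would survive. -/
theorem nonneg_of_dominantD (hn : 3 ≤ n) {μ : Fin n → ℤ} (hanti : Antitone μ)
    (hlast : ∀ i j : Fin n, (i : ℕ) + 2 = n → (j : ℕ) + 1 = n → 0 ≤ μ i + μ j)
    (hsum : ∀ j : Fin n, (j : ℕ) + 1 = n → ∑ i, μ i - 2 * μ j ≤ 2) (i : Fin n) : 0 ≤ μ i := by
  obtain ⟨m, rfl⟩ := Nat.exists_eq_add_of_le' hn
  have h1 := hlast ⟨m + 1, by omega⟩ (Fin.last _) rfl rfl
  have h2 := hsum (Fin.last _) rfl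
  refine le_trans ?_ (hanti (Fin.le_last i))
  by_contra! hneg
  have h3 (i : Fin (m + 2)) : 1 ≤ μ i.castSucc := by
    have : μ ⟨m + 1, by omega⟩ ≤ μ i.castSucc := hanti (by
      rw [Fin.le_def]; simp; omega)
    omega
  have h4 := Finset.card_nsmul_le_sum Finset.univ (fun i : Fin (m + 2) => μ i.castSucc) 1
    fun i _ => h3 i
  simp only [Finset.card_univ, Fintype.card_fin, nsmul_eq_mul] at h4
  rw [Fin.sum_univ_castSucc] at h2
  push_cast at h4
  omega

end Dominance

/-! ### Torus characters and dominant representatives -/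

section TorusCharacters

variable {n : ℕ}

theorem torusChar_add {A : Type} (z : A → Fin n → Circle) (μ ν : Fin n → ℤ) (a : A) :
    torusChar z (μ + ν) a = torusChar z μ a * torusChar z ν a := by
  simp [torusChar, zpow_add₀, Finset.prod_mul_distrib]

theorem torusChar_zero {A : Type} (z : A → Fin n → Circle) (a : A) : torusChar z 0 a = 1 := by
  simp [torusChar]

theorem torusChar_single {A : Type} (z : A → Fin n → Circle) (i : Fin n) (k : ℤ) (a : A) :
    torusChar z (Pi.single i k) a = (z a i : ℂ) ^ k := by
  rw [torusChar, Finset.prod_eq_single i] <;> simp +contextual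

theorem torusChar_ne_zero {A : Type} (z : A → Fin n → Circle) (μ : Fin n → ℤ) (a : A) :
    torusChar z μ a ≠ 0 :=
  Finset.prod_ne_zero_iff.2 fun _ _ => zpow_ne_zero _ (Circle.coe_ne_zero _)

theorem torusChar_neg {A : Type} (z : A → Fin n → Circle) (μ : Fin n → ℤ) (a : A) :
    torusChar z (-μ) a = (torusChar z μ a)⁻¹ := by
  simp [torusChar]

theorem torusChar_sub {A : Type} (z : A → Fin n → Circle) (μ ν : Fin n → ℤ) (a : A) :
    torusChar z (μ - ν) a = torusChar z μ a / torusChar z ν a := by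
  rw [sub_eq_add_neg, torusChar_add, torusChar_neg, div_eq_mul_inv]

theorem torusChar_injective {μ ν : Fin n → ℤ}
    (h : ∀ a, torusChar (fun z : Fin n → Circle => z) μ a = torusChar (fun z => z) ν a) :
    μ = ν := by
  funext i
  refine Circle.zpow_left_injective fun w => Circle.ext ?_
  have (k : Fin n → ℤ) : torusChar (fun z : Fin n → Circle => z) k (Pi.mulSingle i w) =
      ((w ^ k i : Circle) : ℂ) := by
    rw [torusChar, Finset.prod_eq_single i] <;> simp +contextual
  rw [← this, ← this, h]

theorem torusChar_comp_perm {A : Type} {z z' : A → Fin n → Circle} (σ : Equiv.Perm (Fin n))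
    {a : A} (h : ∀ i, z' a i = z a (σ i)) (μ : Fin n → ℤ) :
    torusChar z' μ a = torusChar z (μ ∘ σ.symm) a := by
  simp only [torusChar, h]
  exact Fintype.prod_equiv σ _ _ fun i => by simp

theorem torusChar_inv (μ : Fin n → ℤ) (ε : Fin n → ℤˣ) (a : Fin n → Circle) :
    torusChar (fun z : Fin n → Circle => z) μ (fun i => a i ^ (ε i : ℤ)) =
      torusChar (fun z => z) (fun i => ε i * μ i) a := by
  simp [torusChar, zpow_mul]

theorem exists_isMax_weightedSum {S : Set (Fin n → ℤ)} (hS : S.Nonempty) (h : Fin n → ℤ) (b : ℤ)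
    (hb : ∀ μ ∈ S, weightedSum h μ ≤ b) :
    ∃ μ ∈ S, ∀ ν ∈ S, weightedSum h ν ≤ weightedSum h μ := by
  obtain ⟨_, ⟨μ, hμ, rfl⟩, hmax⟩ := Int.exists_greatest_of_bdd
    (P := fun x => ∃ μ ∈ S, weightedSum h μ = x) ⟨b, by rintro _ ⟨μ, hμ, rfl⟩; exact hb μ hμ⟩
    (let ⟨μ, hμ⟩ := hS; ⟨_, μ, hμ, rfl⟩)
  exact ⟨μ, hμ, fun ν hν => hmax _ ⟨ν, hν, rfl⟩⟩

theorem weightedSum_comp_swap (h μ : Fin n → ℤ) {i j : Fin n} (hij : i ≠ j) :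
    weightedSum h (μ ∘ Equiv.swap i j) = weightedSum h μ + (h i - h j) * (μ j - μ i) := by
  have : μ ∘ Equiv.swap i j = μ + Pi.single i (μ j - μ i) + Pi.single j (μ i - μ j) := by
    funext k
    by_cases hki : k = i
    · subst hki; simp [hij]
    · by_cases hkj : k = j
      · subst hkj; simp [hki]
      · simp [Equiv.swap_apply_of_ne_of_ne hki hkj, hki, hkj]
  rw [this, map_add, map_add, weightedSum_single, weightedSum_single]
  ring

/-- Rearrangement inequality: exchanging two coordinates in the wrong order would strictly increase
the pairing with a strictly decreasing `h`. -/
theorem antitone_of_isMax {h μ : Fin n → ℤ} (hh : StrictAnti h)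
    (hmax : ∀ i j, i < j → weightedSum h (μ ∘ Equiv.swap i j) ≤ weightedSum h μ) :
    Antitone μ := by
  intro i j hij
  rcases hij.eq_or_lt with rfl | hij
  · rfl
  · have h1 := hmax i j hij
    rw [weightedSum_comp_swap _ _ hij.ne] at h1
    have h2 := hh hij
    by_contra! hlt
    have : 0 < (h i - h j) * (μ j - μ i) := mul_pos (by omega) (by omega)
    omega

theorem strictAnti_stairs (n : ℕ) : StrictAnti (stairs n) := fun i j hij => by
  have : (i : ℕ) < j := hij
  simp only [stairs]
  omega

/-- Among the integer vectors conjugate to `ω`, one with the largest pairing with `stairs` is taken;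
it exists because all of them lie below the same label. Maximality under permutations makes it
antitone, and maximality under available sign changes is handed to `hlist`, the only part that
depends on the type. -/
theorem isDominantList_aux {G : Type} [Group G] {t : (Fin n → Circle) → G} {P : Set (Fin n → ℤ)}
    (hP : ∀ α ∈ P, 0 ≤ weightedSum (stairs n) α)
    (hswap : ∀ σ : Equiv.Perm (Fin n), ∃ g, ∀ z, t (z ∘ σ) = g * t z * g⁻¹)
    (hlist : ∀ μ : Fin n → ℤ, Antitone μ →
      (∀ (ε : Fin n → ℤˣ) (σ : Equiv.Perm (Fin n)),
        (∃ g, ∀ z, t (fun i => z i ^ (ε i : ℤ)) = g * t z * g⁻¹) →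
        weightedSum (stairs n) (fun i => ε (σ i) * μ (σ i)) ≤ weightedSum (stairs n) μ) →
      (∃ j, ∃ β ∈ AddSubmonoid.closure P, μ + β = smallLabels n j) → ∃ j, μ = smallLabels n j) :
    IsDominantList t (fun z : Fin n → Circle => z) P (smallLabels n) := by
  intro ω i hω
  have hlow {μ : Fin n → ℤ} (hμ : WeylConj t ω (torusChar (fun z => z) μ)) :
      ∃ β ∈ AddSubmonoid.closure P, μ + β = smallLabels n i := by
    obtain ⟨β, hβ, heq⟩ := hω _ hμ
    exact ⟨β, hβ, torusChar_injective fun a => by rw [torusChar_add, heq]⟩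
  have hperm (μ : Fin n → ℤ) (σ : Equiv.Perm (Fin n)) :
      WeylConj t (torusChar (fun z => z) μ) (torusChar (fun z => z) (μ ∘ σ)) := by
    obtain ⟨g, hg⟩ := hswap σ.symm
    refine ⟨g, Equiv.arrowCongr σ (Equiv.refl _), hg, funext fun a => ?_⟩
    exact (torusChar_comp_perm (z := fun z => z) (z' := fun z => z ∘ σ.symm) σ.symm
      (fun i => rfl) μ).symm
  obtain ⟨μ, hμ, hmax⟩ := exists_isMax_weightedSum
    (S := {μ | WeylConj t ω (torusChar (fun z => z) μ)}) (by
      obtain ⟨β, hβ, heq⟩ := hω ω (WeylConj.refl t ω)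
      -- A priori `ω` is only a function on the torus; being lower than a label makes it the
      -- character of an integer vector.
      refine ⟨smallLabels n i - β, ?_⟩
      have : ω = torusChar (fun z => z) (smallLabels n i - β) := by
        funext a
        rw [torusChar_sub, ← heq, mul_div_cancel_right₀ _ (torusChar_ne_zero _ _ _)]
      rw [Set.mem_ofPred_eq, ← this]
      exact WeylConj.refl t ω)
    (stairs n) (weightedSum (stairs n) (smallLabels n i)) (fun μ hμ => by
      obtain ⟨β, hβ, heq⟩ := hlow hμ
      rw [← heq, map_add]
      have := nonneg_of_mem_closure _ hP hβ
      omega)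
  have hsign (ε : Fin n → ℤˣ) (g : G) (hg : ∀ z, t (fun i => z i ^ (ε i : ℤ)) = g * t z * g⁻¹) :
      WeylConj t (torusChar (fun z => z) μ) (torusChar (fun z => z) (fun i => ε i * μ i)) := by
    have hinv : Function.Involutive fun (z : Fin n → Circle) i => z i ^ (ε i : ℤ) := by
      intro z
      funext k
      rcases Int.units_eq_one_or (ε k) with h | h <;> simp [h]
    exact ⟨g, hinv.toPerm, hg, funext fun a => (torusChar_inv μ ε a).symm⟩
  obtain ⟨j, hj⟩ := hlist μ
    (antitone_of_isMax (strictAnti_stairs n) fun i j _ => hmax _ (hμ.trans (hperm μ _)))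
    (fun ε σ ⟨g, hg⟩ =>
      hmax _ (hμ.trans ((hsign ε g hg).trans (hperm (fun i => ε i * μ i) σ))))
    ⟨i, hlow hμ⟩
  exact ⟨j, hj ▸ hμ⟩

/-- The list `smallLabels` is dominant when the sign changes of the coordinates of the torus are
induced by conjugations and the simple roots have non-negative coordinate sums. -/
theorem isDominantList_of_flip (hn : 2 ≤ n) {G : Type} [Group G] {t : (Fin n → Circle) → G}
    {P : Set (Fin n → ℤ)} (hP : ∀ α ∈ P, 0 ≤ weightedSum (stairs n) α)
    (hP' : ∀ α ∈ P, 0 ≤ weightedSum 1 α)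
    (hswap : ∀ σ : Equiv.Perm (Fin n), ∃ g, ∀ z, t (z ∘ σ) = g * t z * g⁻¹)
    (hflip : ∀ ε : Fin n → ℤˣ, ∃ g, ∀ z, t (fun i => z i ^ (ε i : ℤ)) = g * t z * g⁻¹) :
    IsDominantList t (fun z : Fin n → Circle => z) P (smallLabels n) := by
  refine isDominantList_aux hP hswap fun μ hanti hmax ⟨j, β, hβ, hj⟩ => ?_
  refine exists_eq_smallLabels hn hanti (fun i => ?_) ?_
  -- Changing the sign of the coordinate `i` adds `-2 * μ i` times a positive number to the height,
  -- so maximality forces `0 ≤ μ i`.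
  · have h1 := hmax (Function.update 1 i (-1)) (Equiv.refl _) (hflip _)
    have h2 : (fun k => ((Function.update (1 : Fin n → ℤˣ) i (-1) (Equiv.refl _ k) : ℤˣ) : ℤ) *
        μ (Equiv.refl _ k)) = μ + Pi.single i (-2 * μ i) := by
      funext k
      by_cases hk : k = i
      · subst hk; simp; ring
      · simp [hk]
    rw [h2, map_add, weightedSum_single] at h1
    by_contra! hneg
    have h3 : 0 < stairs n i := by simp only [stairs]; omega
    have h4 : 0 < stairs n i * (-2 * μ i) := mul_pos h3 (by omega)
    omega
  · have h1 := nonneg_of_mem_closure _ hP' hβ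
    have h2 := congrArg (weightedSum 1) hj
    rw [map_add] at h2
    have h3 := weightedSum_smallLabels_le (n := n) (by omega) j
    simp only [weightedSum_apply, Pi.one_apply, one_mul] at h1 h2 h3
    omega

/-- The list `smallLabels` is dominant when the even sign changes of the coordinates of the torus
are induced by conjugations, for the simple roots of type `D`. -/
theorem isDominantList_of_flip_even (hn : 3 ≤ n) {G : Type} [Group G] {t : (Fin n → Circle) → G}
    (hswap : ∀ σ : Equiv.Perm (Fin n), ∃ g, ∀ z, t (z ∘ σ) = g * t z * g⁻¹)
    (hflip : ∀ ε : Fin n → ℤˣ, ∏ i, ε i = 1 →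
      ∃ g, ∀ z, t (fun i => z i ^ (ε i : ℤ)) = g * t z * g⁻¹) :
    IsDominantList t (fun z : Fin n → Circle => z) (simpleRootsD n) (smallLabels n) := by
  have hstairs : ∀ α ∈ simpleRootsD n, 0 ≤ weightedSum (stairs n) α :=
    weightedSum_simpleRootsD (fun i j hij => by simp only [stairs]; omega)
      (fun i j _ _ => by simp only [stairs]; omega)
  refine isDominantList_aux hstairs hswap fun μ hanti hmax ⟨j, β, hβ, hj⟩ => ?_
  have h3 := weightedSum_smallLabels_le (n := n) (by omega) j
  have h2 := congrArg (weightedSum 1) hj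
  have hsum : ∑ i, μ i ≤ 2 := by
    have h1 := nonneg_of_mem_closure _ (weightedSum_simpleRootsD (n := n) (c := 1)
      (fun i j _ => le_rfl) (fun i j _ _ => by simp)) hβ
    rw [map_add] at h2
    simp only [weightedSum_apply, Pi.one_apply, one_mul] at h1 h2 h3
    omega
  refine exists_eq_smallLabels (by omega) hanti
    (nonneg_of_dominantD hn hanti (fun i k hi hk => ?_) (fun k hk => ?_)) hsum
  · have hik : i ≠ k := fun h => by rw [h] at hi; omega
    -- Changing the last two signs and exchanging these coordinates is the reflection in
    -- $e^{n-1}+e^n$. It changes the height by $-3(\mu_i+\mu_k)$, so the maximum has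
    -- $\mu_i+\mu_k\ge0$.
    have h1 := hmax (Function.update (Function.update 1 i (-1)) k (-1)) (Equiv.swap i k)
      (hflip _ (by
        rw [Finset.prod_update_of_mem (Finset.mem_univ _),
          Finset.prod_update_of_mem (by simp [hik])]
        simp))
    have h2 : (fun l => ((Function.update (Function.update (1 : Fin n → ℤˣ) i (-1)) k (-1)
        (Equiv.swap i k l) : ℤˣ) : ℤ) * μ (Equiv.swap i k l)) =
        μ + Pi.single i (-μ i - μ k) + Pi.single k (-μ i - μ k) := by
      funext l
      by_cases hli : l = i
      · subst hli; simp [hik]; ring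
      · by_cases hlk : l = k
        · subst hlk; simp [hik]
        · simp [Equiv.swap_apply_of_ne_of_ne hli hlk, hli, hlk]
    rw [h2, map_add, map_add, weightedSum_single, weightedSum_single] at h1
    have h4 : stairs n i = 2 := by simp only [stairs]; omega
    have h5 : stairs n k = 1 := by simp only [stairs]; omega
    rw [h4, h5] at h1
    omega
  -- The functional $(1,\dots,1,-1)$ is non-negative on the simple roots of type $D$ and at most $2$
  -- on the labels, hence at most $2$ on `μ`.
  · have h1 := nonneg_of_mem_closure _ (weightedSum_simpleRootsD (n := n)
      (c := 1 - Pi.single k 2) (fun i l hil => by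
        have : k ≠ i := fun h => by subst h; omega
        by_cases hl : l = k <;> simp [this.symm, hl])
      (fun i l hi hl => by
        have : l = k := Fin.ext (by omega)
        have : i ≠ k := fun h => by rw [h] at hi; omega
        simp [*])) hβ
    have h2 := congrArg (weightedSum (1 - Pi.single k 2)) hj
    have h6 (ν : Fin n → ℤ) : weightedSum (1 - Pi.single k 2) ν = weightedSum 1 ν - 2 * ν k := by
      simp only [weightedSum_apply, Pi.sub_apply, sub_mul, Finset.sum_sub_distrib]
      congr 1
      rw [Finset.sum_eq_single k] <;> simp +contextual
    rw [map_add, h6 μ, h6 β, h6 (smallLabels n j)] at h2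
    rw [h6 β] at h1
    have h7 : 0 ≤ smallLabels n j k := smallLabels_nonneg n j k
    simp only [weightedSum_apply, Pi.one_apply, one_mul] at h1 h2 h3
    omega

end TorusCharacters

/-! ### Dominant weights of the special unitary groups -/

section DominanceA

variable {n : ℕ}

theorem eq_single_zero_of_antitone {m : ℕ} {f : Fin (m + 1) → ℤ} (h0 : ∀ i, 0 ≤ f i)
    (hf : Antitone f) (hsum : ∑ i, f i = 1) : f = Pi.single 0 1 := by
  rw [Fin.sum_univ_succ] at hsum
  have hrest : 0 ≤ ∑ i : Fin m, f i.succ := Finset.sum_nonneg fun i _ => h0 _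
  have h1 : f 0 ≠ 0 := fun h => by
    have : ∑ i : Fin m, f i.succ = 0 :=
      Finset.sum_eq_zero fun i _ => le_antisymm (h ▸ hf (Fin.zero_le _)) (h0 _)
    omega
  have h2 := h0 0
  have h3 : ∑ i : Fin m, f i.succ = 0 := by omega
  rw [Finset.sum_eq_zero_iff_of_nonneg fun i _ => h0 _] at h3
  funext i
  refine Fin.cases ?_ (fun i => ?_) i
  · simp; omega
  · simpa using h3 i (Finset.mem_univ i)

/-- Duality: the complement `1 - f`, read backwards, satisfies the hypotheses of
`eq_single_zero_of_antitone`. -/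
theorem eq_one_sub_single_last_of_antitone {m : ℕ} {f : Fin (m + 1) → ℤ} (h1 : ∀ i, f i ≤ 1)
    (hf : Antitone f) (hsum : ∑ i, f i = m) : f = 1 - Pi.single (Fin.last m) 1 := by
  have h := eq_single_zero_of_antitone (f := fun i => 1 - f i.rev)
    (fun i => sub_nonneg.2 (h1 _)) (fun i j hij => sub_le_sub_left (hf (Fin.rev_le_rev.2 hij)) 1)
    (by
      rw [Finset.sum_sub_distrib, Fintype.sum_equiv Fin.revPerm (fun i => f i.rev) f (by simp),
        hsum]
      simp)
  funext i
  have := congrFun h i.rev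
  simp only [Fin.rev_rev] at this
  rw [Pi.sub_apply, Pi.one_apply, show (Pi.single (Fin.last m) 1 : Fin (m + 1) → ℤ) i =
    (Pi.single 0 1 : Fin (m + 1) → ℤ) i.rev by
      simp only [Pi.single_apply, Fin.rev_eq_iff, Fin.rev_zero], ← this]
  ring

/-- The elements of the torus of `SU(n)`. -/
abbrev SUTorus (n : ℕ) := {z : Fin n → Circle // ∏ i, z i = 1}

/-- Torus elements with only two non-trivial coordinates $w$ and $w^{-1}$ show that all the
coordinates of `x` are equal. Thus characters are integer vectors modulo $(1,\dots,1)$, and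
prescribing the coordinate sum makes the vector unique. -/
theorem SUTorus.eq_zero_of_torusChar_eq_one {x : Fin n → ℤ} (hx : ∑ i, x i = 0)
    (h : ∀ a : SUTorus n, torusChar (fun z : SUTorus n => z.1) x a = 1) : x = 0 := by
  have key (i j : Fin n) : x i = x j := by
    by_cases hij : i = j
    · rw [hij]
    refine Circle.zpow_left_injective fun w => ?_
    have h1 := h ⟨Pi.mulSingle i w * Pi.mulSingle j w⁻¹, by
      simp [Finset.prod_mul_distrib, Finset.prod_pi_mulSingle']⟩
    have h2 : torusChar (fun z : SUTorus n => z.1) x ⟨Pi.mulSingle i w * Pi.mulSingle j w⁻¹, by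
        simp [Finset.prod_mul_distrib, Finset.prod_pi_mulSingle']⟩ =
        ((w ^ x i * (w ^ x j)⁻¹ : Circle) : ℂ) := by
      simp only [torusChar, Pi.mul_apply, Circle.coe_mul, mul_zpow, Finset.prod_mul_distrib]
      congr 1
      · rw [Finset.prod_eq_single i] <;> simp +contextual
      · rw [Finset.prod_eq_single j] <;> simp +contextual
    rw [h2] at h1
    exact mul_inv_eq_one.1 (Circle.ext h1)
  funext i
  have h1 : ∑ j, x j = n * x i := by
    rw [Finset.sum_congr rfl fun j _ => key j i]
    simp
  have hn : (n : ℤ) ≠ 0 := by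
    have := i.pos
    omega
  rw [hx] at h1
  exact (mul_eq_zero.1 h1.symm).resolve_left hn

theorem SUTorus.torusChar_one (a : SUTorus n) :
    torusChar (fun z : SUTorus n => z.1) 1 a = 1 := by
  have h := congrArg (Circle.coeHom) a.2
  rw [map_prod, map_one] at h
  simp only [torusChar, Pi.one_apply, zpow_one]
  exact h

/-- The cocharacter `(n - 1, n - 3, …, 1 - n)`. -/
def centeredStairs (n : ℕ) : Fin n → ℤ := fun i => n - 1 - 2 * i

/-- This is what makes the cocharacter land in the matrices of determinant $1$; the vector `stairs`
would not do. -/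
theorem sum_centeredStairs (n : ℕ) : ∑ i, centeredStairs n i = 0 := by
  have h1 : ∑ i, centeredStairs n i = ∑ i : Fin n, centeredStairs n i.rev :=
    (Fintype.sum_equiv Fin.revPerm _ _ (by simp)).symm
  have h2 : ∑ i : Fin n, centeredStairs n i.rev = - ∑ i, centeredStairs n i := by
    rw [← Finset.sum_neg_distrib]
    refine Finset.sum_congr rfl fun i _ => ?_
    simp only [centeredStairs, Fin.val_rev]
    have := i.2
    omega
  omega

theorem strictAnti_centeredStairs (n : ℕ) : StrictAnti (centeredStairs n) := fun i j hij => by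
  have : (i : ℕ) < j := hij
  simp only [centeredStairs]
  omega

theorem weightedSum_centeredStairs_nonneg : ∀ α ∈ simpleRootsA n,
    0 ≤ weightedSum (centeredStairs n) α :=
  weightedSum_simpleRootsA fun i j hij => by simp only [centeredStairs]; omega

theorem sum_eq_zero_of_mem_closure_simpleRootsA {β : Fin n → ℤ}
    (hβ : β ∈ AddSubmonoid.closure (simpleRootsA n)) : ∑ i, β i = 0 := by
  have h1 := nonneg_of_mem_closure _ (weightedSum_simpleRootsA (c := 1) fun i j _ => le_rfl) hβ
  have h2 := nonneg_of_mem_closure _ (weightedSum_simpleRootsA (c := -1) fun i j _ => le_rfl) hβ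
  simp only [weightedSum_apply, Pi.one_apply, Pi.neg_apply, neg_mul, one_mul,
    Finset.sum_neg_distrib] at h1 h2
  omega

/-- The vectors representing a character are normalized by the coordinate sum of `δ i`, which
subtracting roots does not change; a maximal permutation is then chosen. The conclusion of `hlist`
compares characters and not vectors because $(1,\dots,1)$ and $0$ give the same one. -/
theorem isDominantList_SU {G : Type} [Group G] {t : SUTorus n → G}
    (hswap : ∀ σ : Equiv.Perm (Fin n), ∃ g, ∀ z z' : SUTorus n, (∀ i, z'.1 i = z.1 (σ i)) →
      t z' = g * t z * g⁻¹) {D : Type*} {δ : D → Fin n → ℤ}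
    (hlist : ∀ μ : Fin n → ℤ, Antitone μ → ∀ i, ∀ β ∈ AddSubmonoid.closure (simpleRootsA n),
      μ + β = δ i → ∃ j, torusChar (fun z : SUTorus n => z.1) μ = torusChar (fun z => z.1) (δ j)) :
    IsDominantList t (fun z : SUTorus n => z.1) (simpleRootsA n) δ := by
  intro ω i hω
  have hlow {μ : Fin n → ℤ} (hμ : WeylConj t ω (torusChar (fun z => z.1) μ))
      (hsum : ∑ k, μ k = ∑ k, δ i k) :
      ∃ β ∈ AddSubmonoid.closure (simpleRootsA n), μ + β = δ i := by
    obtain ⟨β, hβ, heq⟩ := hω _ hμ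
    refine ⟨β, hβ, sub_eq_zero.1 (SUTorus.eq_zero_of_torusChar_eq_one ?_ fun a => ?_)⟩
    · simp only [Pi.sub_apply, Pi.add_apply, Finset.sum_sub_distrib, Finset.sum_add_distrib,
        sum_eq_zero_of_mem_closure_simpleRootsA hβ, hsum]
      ring
    · rw [torusChar_sub, torusChar_add, heq, div_self (torusChar_ne_zero _ _ _)]
  have hperm (μ : Fin n → ℤ) (σ : Equiv.Perm (Fin n)) :
      WeylConj t (torusChar (fun z : SUTorus n => z.1) μ) (torusChar (fun z => z.1) (μ ∘ σ)) := by
    obtain ⟨g, hg⟩ := hswap σ.symm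
    have hmem (τ : Equiv.Perm (Fin n)) (z : SUTorus n) : ∏ i, (z.1 ∘ τ) i = 1 := by
      refine Eq.trans ?_ z.2
      exact Fintype.prod_equiv τ _ _ fun i => rfl
    refine ⟨g, ⟨fun z => ⟨z.1 ∘ σ.symm, hmem _ z⟩, fun z => ⟨z.1 ∘ σ, hmem _ z⟩,
      fun z => Subtype.ext (by funext i; simp), fun z => Subtype.ext (by funext i; simp)⟩,
      fun a => hg a _ fun i => rfl, funext fun a => ?_⟩
    exact (torusChar_comp_perm (z := fun z : SUTorus n => z.1)
      (z' := fun z : SUTorus n => z.1 ∘ σ.symm) σ.symm (fun i => rfl) μ).symm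
  have hsumperm (μ : Fin n → ℤ) (σ : Equiv.Perm (Fin n)) : ∑ k, (μ ∘ σ) k = ∑ k, μ k :=
    Fintype.sum_equiv σ _ _ fun i => rfl
  obtain ⟨μ, ⟨hμ, hμsum⟩, hmax⟩ := exists_isMax_weightedSum
    (S := {μ | WeylConj t ω (torusChar (fun z => z.1) μ) ∧ ∑ k, μ k = ∑ k, δ i k}) (by
      obtain ⟨β, hβ, heq⟩ := hω ω (WeylConj.refl t ω)
      refine ⟨δ i - β, ?_, ?_⟩
      · have : ω = torusChar (fun z => z.1) (δ i - β) := by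
          funext a
          rw [torusChar_sub, ← heq, mul_div_cancel_right₀ _ (torusChar_ne_zero _ _ _)]
        rw [← this]
        exact WeylConj.refl t ω
      · simp [sum_eq_zero_of_mem_closure_simpleRootsA hβ])
    (centeredStairs n) (weightedSum (centeredStairs n) (δ i)) (fun μ ⟨hμ, hs⟩ => by
      obtain ⟨β, hβ, heq⟩ := hlow hμ hs
      rw [← heq, map_add]
      have := nonneg_of_mem_closure _ weightedSum_centeredStairs_nonneg hβ
      omega)
  obtain ⟨β, hβ, heq⟩ := hlow hμ hμsum
  obtain ⟨j, hj⟩ := hlist μ (antitone_of_isMax (strictAnti_centeredStairs n) fun k l _ =>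
    hmax _ ⟨hμ.trans (hperm μ _), (hsumperm μ _).trans hμsum⟩) i β hβ heq
  exact ⟨j, hj ▸ hμ⟩

theorem padZero_hookLabel_one_zero (m : ℕ) :
    (padZero (hookLabel (m + 2 - 1) 1 0) : Fin (m + 2) → ℤ) = Pi.single 0 1 := by
  funext i
  simp only [padZero, hookLabel, Pi.single_apply, Fin.ext_iff, Fin.val_zero]
  split_ifs <;> omega

theorem padZero_one (m : ℕ) :
    (padZero (fun _ : Fin (m + 2 - 1) => 1) : Fin (m + 2) → ℤ) =
      1 - Pi.single (Fin.last _) 1 := by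
  funext i
  have := i.2
  simp only [padZero, Pi.sub_apply, Pi.one_apply, Pi.single_apply, Fin.ext_iff, Fin.val_last]
  split_ifs <;> omega

theorem padZero_hookLabel_two_one (m : ℕ) :
    (padZero (hookLabel (m + 2 - 1) 2 1) : Fin (m + 2) → ℤ) =
      1 + Pi.single 0 1 - Pi.single (Fin.last _) 1 := by
  funext i
  have := i.2
  simp only [padZero, hookLabel, Pi.add_apply, Pi.sub_apply, Pi.one_apply, Pi.single_apply,
    Fin.ext_iff, Fin.val_last, Fin.val_zero]
  split_ifs <;> omega

theorem padZero_zero (n : ℕ) : (padZero 0 : Fin n → ℤ) = 0 := by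
  funext i
  simp [padZero]

/-- Each bound is a pairing with a non-increasing vector ($e^1$, $-e^n$ or $e^1+e^2$), and such
vectors pair non-negatively with every $e^i-e^{i+1}$. -/
theorem bounds_of_mem_closure_simpleRootsA {m : ℕ} {β : Fin (m + 2) → ℤ}
    (hβ : β ∈ AddSubmonoid.closure (simpleRootsA (m + 2))) :
    0 ≤ β 0 ∧ β (Fin.last _) ≤ 0 ∧ 0 ≤ β 0 + β 1 := by
  have key (c : Fin (m + 2) → ℤ) (hc : Antitone c) : 0 ≤ weightedSum c β :=
    nonneg_of_mem_closure _ (weightedSum_simpleRootsA fun i j hij =>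
      hc (by rw [Fin.le_def]; omega)) hβ
  have hs (i : Fin (m + 2)) : weightedSum (Pi.single i 1) β = β i := by
    rw [weightedSum_apply, Finset.sum_eq_single i] <;> simp +contextual
  have hadd (c d : Fin (m + 2) → ℤ) : weightedSum (c + d) β
      = weightedSum c β + weightedSum d β := by
    simp [weightedSum_apply, add_mul, Finset.sum_add_distrib]
  have h1 : Antitone (Pi.single 0 1 : Fin (m + 2) → ℤ) := fun i j hij => by
    have z0 : ((0 : Fin (m + 2)) : ℕ) = 0 := rfl
    simp only [Pi.single_apply, Fin.ext_iff, Fin.le_def] at hij ⊢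
    split_ifs <;> omega
  have h2 : Antitone (Pi.single (Fin.last _) (-1) : Fin (m + 2) → ℤ) := fun i j hij => by
    have := j.2
    simp only [Pi.single_apply, Fin.ext_iff, Fin.le_def, Fin.val_last] at hij ⊢
    split_ifs <;> omega
  have h3 : Antitone (Pi.single 0 1 + Pi.single 1 1 : Fin (m + 2) → ℤ) := fun i j hij => by
    have z0 : ((0 : Fin (m + 2)) : ℕ) = 0 := rfl
    have z1 : ((1 : Fin (m + 2)) : ℕ) = 1 := rfl
    simp only [Pi.add_apply, Pi.single_apply, Fin.ext_iff, Fin.le_def] at hij ⊢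
    split_ifs <;> omega
  refine ⟨hs 0 ▸ key _ h1, ?_, by rw [← hs 0, ← hs 1, ← hadd]; exact key _ h3⟩
  have h4 := key _ h2
  have h5 : weightedSum (Pi.single (Fin.last _) (-1)) β = - β (Fin.last _) := by
    rw [weightedSum_apply, Finset.sum_eq_single (Fin.last _)] <;> simp +contextual
  omega

/-- The weight $e^1$ is minuscule: a non-increasing vector below it has non-negative entries of sum
$1$, hence equals it. -/
theorem isDominantList_SU_standard (hn : 2 ≤ n) {G : Type} [Group G] {t : SUTorus n → G}
    (hswap : ∀ σ : Equiv.Perm (Fin n), ∃ g, ∀ z z' : SUTorus n, (∀ i, z'.1 i = z.1 (σ i)) →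
      t z' = g * t z * g⁻¹) :
    IsDominantList t (fun z : SUTorus n => z.1) (simpleRootsA n)
      fun _ : Unit => padZero (hookLabel (n - 1) 1 0) := by
  obtain ⟨m, rfl⟩ := Nat.exists_eq_add_of_le' hn
  refine isDominantList_SU hswap fun μ hanti i β hβ heq => ⟨i, ?_⟩
  have hb := bounds_of_mem_closure_simpleRootsA hβ
  have hs := sum_eq_zero_of_mem_closure_simpleRootsA hβ
  rw [padZero_hookLabel_one_zero] at heq ⊢
  have h0 (k) : 0 ≤ μ k := by
    refine le_trans ?_ (hanti (Fin.le_last k))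
    have := congrFun heq (Fin.last _)
    simp at this
    omega
  rw [eq_single_zero_of_antitone h0 hanti ?_]
  have := congrArg (fun x : Fin (m + 2) → ℤ => ∑ k, x k) heq
  simpa [Finset.sum_add_distrib, hs] using this

/-- The dual weight is minuscule as well: a non-increasing vector below it has entries at most $1$
and sum $n-1$. -/
theorem isDominantList_SU_dual (hn : 2 ≤ n) {G : Type} [Group G] {t : SUTorus n → G}
    (hswap : ∀ σ : Equiv.Perm (Fin n), ∃ g, ∀ z z' : SUTorus n, (∀ i, z'.1 i = z.1 (σ i)) →
      t z' = g * t z * g⁻¹) :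
    IsDominantList t (fun z : SUTorus n => z.1) (simpleRootsA n)
      fun _ : Unit => padZero (fun _ : Fin (n - 1) => 1) := by
  obtain ⟨m, rfl⟩ := Nat.exists_eq_add_of_le' hn
  refine isDominantList_SU hswap fun μ hanti i β hβ heq => ⟨i, ?_⟩
  have hb := bounds_of_mem_closure_simpleRootsA hβ
  have hs := sum_eq_zero_of_mem_closure_simpleRootsA hβ
  rw [padZero_one] at heq ⊢
  have h0 (k) : μ k ≤ 1 := by
    refine (hanti (Fin.zero_le k)).trans ?_
    have := congrFun heq 0
    simp [Fin.ext_iff] at this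
    omega
  rw [eq_one_sub_single_last_of_antitone h0 hanti ?_]
  have := congrArg (fun x : Fin (m + 2) → ℤ => ∑ k, x k) heq
  simp only [Pi.add_apply, Pi.sub_apply, Finset.sum_add_distrib, hs, Finset.sum_sub_distrib,
    Pi.one_apply, Fin.sum_const, Fintype.sum_pi_single', nsmul_eq_mul] at this
  push_cast at this ⊢
  linarith

theorem isDominantList_SU_adjoint (hn : 2 ≤ n) {G : Type} [Group G] {t : SUTorus n → G}
    (hswap : ∀ σ : Equiv.Perm (Fin n), ∃ g, ∀ z z' : SUTorus n, (∀ i, z'.1 i = z.1 (σ i)) →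
      t z' = g * t z * g⁻¹) :
    IsDominantList t (fun z : SUTorus n => z.1) (simpleRootsA n)
      ![padZero 0, padZero (hookLabel (n - 1) 2 1)] := by
  obtain ⟨m, rfl⟩ := Nat.exists_eq_add_of_le' hn
  refine isDominantList_SU hswap fun μ hanti i β hβ heq => ?_
  have hb := bounds_of_mem_closure_simpleRootsA hβ
  have hs := sum_eq_zero_of_mem_closure_simpleRootsA hβ
  have hzero := congrFun heq 0
  have hlast := congrFun heq (Fin.last _)
  have hone := congrFun heq 1
  have hsum := congrArg (fun x : Fin (m + 2) → ℤ => ∑ k, x k) heq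
  simp only [Pi.add_apply, Finset.sum_add_distrib, hs, add_zero] at hsum hzero hlast hone
  fin_cases i
  · refine ⟨0, ?_⟩
    simp only [Fin.zero_eta, Matrix.cons_val_zero, padZero_zero, Pi.zero_apply] at hzero hlast ⊢
    rw [show μ = 0 from funext fun k => le_antisymm ((hanti (Fin.zero_le k)).trans
        (by simp only [Pi.zero_apply]; omega))
      (le_trans (by simp only [Pi.zero_apply]; omega) (hanti (Fin.le_last k)))]
  · simp only [Fin.mk_one, Matrix.cons_val_one, Matrix.cons_val_fin_one,
      padZero_hookLabel_two_one, Pi.add_apply, Pi.sub_apply, Pi.one_apply,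
      Finset.sum_add_distrib, Finset.sum_sub_distrib, Fin.sum_const, Fintype.sum_pi_single',
      nsmul_eq_mul, mul_one] at hzero hlast hsum hone
    push_cast at hsum
    have hl0 : (Fin.last (m + 1)) ≠ 0 := by simp [Fin.ext_iff]
    rw [Pi.single_eq_same, Pi.single_eq_of_ne hl0.symm] at hzero
    rw [Pi.single_eq_same, Pi.single_eq_of_ne hl0] at hlast
    rw [Pi.single_eq_of_ne (by simp)] at hone
    have hle : (Pi.single (Fin.last (m + 1)) 1 : Fin (m + 2) → ℤ) 1 = 0 ∨ m = 0 := by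
      rcases Nat.eq_zero_or_pos m with h | h
      · exact Or.inr h
      · left
        refine Pi.single_eq_of_ne (fun h1 => ?_) _
        have : (1 : ℕ) = m + 1 := congrArg Fin.val h1
        omega
    have h01 : μ 1 ≤ μ 0 := hanti (Fin.zero_le _)
    have hsp : 0 ≤ (Pi.single (Fin.last (m + 1)) 1 : Fin (m + 2) → ℤ) 1 := by
      rw [Pi.single_apply]; split_ifs <;> omega
    have h1 : μ 1 ≤ 1 := by omega
    by_cases h0 : μ 0 ≤ 1
    -- All entries are at most $1$ and their sum is the length, so `μ` is $(1,\dots,1)$, which is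
    -- trivial on the torus by the determinant condition.
    · refine ⟨0, ?_⟩
      have h2 : ∑ k, (1 - μ k) = 0 := by
        rw [Finset.sum_sub_distrib, hsum]
        simp
      rw [Finset.sum_eq_zero_iff_of_nonneg fun k _ =>
        sub_nonneg.2 ((hanti (Fin.zero_le k)).trans h0)] at h2
      have h3 : μ = 1 := funext fun k => (sub_eq_zero.1 (h2 k (Finset.mem_univ k))).symm
      funext a
      rw [h3, SUTorus.torusChar_one]
      simp [padZero_zero, torusChar_zero]
    · refine ⟨1, ?_⟩
      have h2 : μ 0 = 2 := by omega
      rw [Fin.sum_univ_succ] at hsum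
      have h3 := eq_one_sub_single_last_of_antitone (f := fun k => μ k.succ)
        (fun k => (hanti (Fin.succ_le_succ_iff.2 (Fin.zero_le k))).trans h1)
        (fun k l hkl => hanti (Fin.succ_le_succ_iff.2 hkl)) (by linarith)
      congr 1
      simp only [Matrix.cons_val_one, Matrix.cons_val_fin_one, padZero_hookLabel_two_one]
      funext k
      refine Fin.cases ?_ (fun k => ?_) k
      · simp [h2]
      · rw [show μ k.succ = _ from congrFun h3 k]
        simp only [Pi.sub_apply, Pi.add_apply, Pi.one_apply, Pi.single_apply, Fin.ext_iff,
          Fin.val_last, Fin.val_succ]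
        have z0 : ((0 : Fin (m + 2)) : ℕ) = 0 := rfl
        split_ifs <;> omega

theorem injective_weightedSum_padZero (hn : 2 ≤ n) :
    Function.Injective fun i => ∑ k, centeredStairs n k *
      (![padZero 0, padZero (hookLabel (n - 1) 2 1)] : Fin 2 → Fin n → ℤ) i k := by
  obtain ⟨m, rfl⟩ := Nat.exists_eq_add_of_le' hn
  have h0 : ∑ k, centeredStairs (m + 2) k * (padZero 0 : Fin (m + 2) → ℤ) k = 0 := by
    simp [padZero_zero]
  have h1 : ∑ k, centeredStairs (m + 2) k *
      (padZero (hookLabel (m + 2 - 1) 2 1) : Fin (m + 2) → ℤ) k = 2 * (m + 1) := by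
    have hone : weightedSum (centeredStairs (m + 2)) 1 = 0 := by
      simp [weightedSum_apply, sum_centeredStairs]
    rw [padZero_hookLabel_two_one, ← weightedSum_apply, map_sub, map_add, weightedSum_single,
      weightedSum_single, hone]
    simp [centeredStairs]
  intro i j hij
  fin_cases i <;> fin_cases j <;> first
    | rfl
    | (exfalso; simp only [Fin.zero_eta, Fin.mk_one, Matrix.cons_val_zero, Matrix.cons_val_one,
        Matrix.cons_val_fin_one, h0, h1] at hij; omega)

end DominanceA

/-! ### Unitary diagonalization over the complex numbers and the quaternions -/

section Diagonalization

open Matrix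

variable {R : Type*} [NormedDivisionRing R] [StarRing R] [NormedAlgebra ℝ R] [StarModule ℝ R]

theorem unit_mul_norm (h : ∀ a : R, star a * a = algebraMap ℝ R (‖a‖ ^ 2)) (a : R) :
    ∃ α : R, star α * α = 1 ∧ α * star α = 1 ∧ a = α * algebraMap ℝ R ‖a‖ := by
  suffices ∃ α : R, star α * α = 1 ∧ a = α * algebraMap ℝ R ‖a‖ by
    obtain ⟨α, hα, ha⟩ := this
    exact ⟨α, hα, mul_eq_one_comm.1 hα, ha⟩
  by_cases ha : a = 0
  · exact ⟨1, by simp, by simp [ha]⟩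
  · have hn : ‖a‖ ≠ 0 := norm_ne_zero_iff.2 ha
    refine ⟨‖a‖⁻¹ • a, ?_, ?_⟩
    · rw [star_smul, smul_mul_smul_comm, h, star_trivial, Algebra.smul_def, ← map_mul]
      rw [show ‖a‖⁻¹ * ‖a‖⁻¹ * ‖a‖ ^ 2 = 1 by field_simp, map_one]
    · rw [← Algebra.commutes, ← Algebra.smul_def, smul_smul, mul_inv_cancel₀ hn, one_smul]

/-- A unit vector is the first column of a unitary matrix (a Householder reflection, up to a
factor). -/
theorem exists_unitary_col (h : ∀ a : R, star a * a = algebraMap ℝ R (‖a‖ ^ 2)) {n : ℕ}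
    (v : Fin (n + 1) → R) (hv : ∑ i, star (v i) * v i = 1) :
    ∃ P ∈ unitary (Matrix (Fin (n + 1)) (Fin (n + 1)) R), ∀ i, P i 0 = v i := by
  obtain ⟨α, hα, hα', hv0⟩ := unit_mul_norm h (v 0)
  set s := ‖v 0‖
  have hs : 0 ≤ s := norm_nonneg _
  -- Here `α` is the phase of `v 0`; with this choice of sign the squared norm of `u` is `2 * (1 +
  -- s)`, which never vanishes.
  let u : Fin (n + 1) → R := v + Pi.single 0 α
  have hstar : star (algebraMap ℝ R s) = algebraMap ℝ R s := by
    rw [← algebraMap_star_comm, star_trivial]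
  have huv : ∑ i, star (u i) * v i = algebraMap ℝ R (1 + s) := by
    have : ∀ i, star (u i) * v i = star (v i) * v i + star ((Pi.single 0 α : Fin (n + 1) → R) i) *
      v i := fun i => by simp [u, add_mul]
    rw [Finset.sum_congr rfl fun i _ => this i, Finset.sum_add_distrib, hv,
      Finset.sum_eq_single 0 (by simp +contextual) (by simp), Pi.single_eq_same, hv0,
      ← mul_assoc, hα, one_mul, map_add, map_one]
  have huα : star (u 0) * α = algebraMap ℝ R (1 + s) := by
    simp only [u, Pi.add_apply, Pi.single_eq_same, star_add, add_mul, hα]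
    rw [hv0, star_mul, hstar, mul_assoc, hα, mul_one, map_add, map_one, add_comm]
  have huu : ∑ i, star (u i) * u i = algebraMap ℝ R (2 * (1 + s)) := by
    have : ∀ i, star (u i) * u i = star (u i) * v i + star (u i) *
      (Pi.single 0 α : Fin (n + 1) → R) i := fun i => by simp [u, mul_add]
    rw [Finset.sum_congr rfl fun i _ => this i, Finset.sum_add_distrib, huv,
      Finset.sum_eq_single 0 (by simp +contextual) (by simp), Pi.single_eq_same, huα, ← map_add]
    ring_nf
  let K : Matrix (Fin (n + 1)) (Fin (n + 1)) R := vecMulVec u (star u)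
  have hKK : K * K = (2 * (1 + s)) • K := by
    ext i j
    simp only [K, mul_apply, vecMulVec_apply, Matrix.smul_apply, Pi.star_apply]
    calc ∑ k, u i * star (u k) * (u k * star (u j))
        = u i * (∑ k, star (u k) * u k) * star (u j) := by
          simp only [Finset.mul_sum, Finset.sum_mul, mul_assoc]
      _ = _ := by rw [huu, ← Algebra.commutes, mul_assoc, ← Algebra.smul_def]
  have hKs : star K = K := by
    ext i j
    simp [K, star_apply, vecMulVec_apply]
  let c : ℝ := (1 + s)⁻¹
  let H : Matrix (Fin (n + 1)) (Fin (n + 1)) R := 1 - c • K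
  have hHs : star H = H := by simp [H, star_sub, hKs]
  have hc : c * (1 + s) = 1 := inv_mul_cancel₀ (by positivity)
  have hHH : H * H = 1 := by
    simp only [H, mul_sub, sub_mul, one_mul, mul_one, smul_mul_smul_comm, hKK, smul_smul]
    rw [show c * c * (2 * (1 + s)) = 2 * c by linear_combination 2 * c * hc, two_mul, add_smul]
    abel
  have hH : H ∈ unitary (Matrix (Fin (n + 1)) (Fin (n + 1)) R) :=
    Unitary.mem_iff.2 ⟨by rw [hHs, hHH], by rw [hHs, hHH]⟩
  -- The reflection `H` sends $\alpha e_0$ to $-v$, so its first column must be multiplied on the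
  -- right by $-\alpha$ to become $v$.
  let d : Fin (n + 1) → R := Function.update 1 0 (-α)
  have hd : diagonal d ∈ unitary (Matrix (Fin (n + 1)) (Fin (n + 1)) R) := by
    rw [Unitary.mem_iff, star_eq_conjTranspose, diagonal_conjTranspose, diagonal_mul_diagonal,
      diagonal_mul_diagonal, ← diagonal_one]
    constructor <;> congr 1 <;> funext i <;> by_cases hi : i = 0 <;> simp [d, hi, hα, hα']
  refine ⟨H * diagonal d, mul_mem hH hd, fun i => ?_⟩
  have h1 : u i * (star (u 0) * α) = (1 + s) • u i := by
    rw [huα, ← Algebra.commutes, ← Algebra.smul_def]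
  rw [mul_diagonal]
  simp only [d, Function.update_self, H, K, Matrix.sub_apply, Matrix.smul_apply,
      vecMulVec_apply, Pi.star_apply,
    mul_neg, sub_mul, smul_mul_assoc, mul_assoc, h1, smul_smul, hc, one_smul]
  by_cases hi : i = 0
  · subst hi; simp [u]
  · simp [u, hi]

omit [NormedAlgebra ℝ R] [StarModule ℝ R] in
theorem unitary_cons {n : ℕ} {P : Matrix (Fin n) (Fin n) R} (hP : P ∈ unitary (Matrix _ _ R)) :
    (Matrix.of (Fin.cons (Fin.cons 1 0) fun i => Fin.cons 0 (P i)) :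
      Matrix (Fin (n + 1)) (Fin (n + 1)) R) ∈ unitary (Matrix _ _ R) := by
  rw [Unitary.mem_iff] at hP ⊢
  constructor
  · ext i j
    have h2 := fun i j => congrFun (congrFun hP.1 i) j
    simp only [mul_apply, star_apply] at h2
    refine Fin.cases ?_ (fun i => ?_) i <;> refine Fin.cases ?_ (fun j => ?_) j <;>
      simp [mul_apply, Fin.sum_univ_succ, star_apply, h2, one_apply, (Fin.succ_ne_zero _).symm]
  · ext i j
    have h2 := fun i j => congrFun (congrFun hP.2 i) j
    simp only [mul_apply, star_apply] at h2
    refine Fin.cases ?_ (fun i => ?_) i <;> refine Fin.cases ?_ (fun j => ?_) j <;>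
      simp [mul_apply, Fin.sum_univ_succ, star_apply, h2, one_apply, (Fin.succ_ne_zero _).symm]

/-- Unitary matrices are diagonalizable by unitary matrices, provided that matrices have
eigenvectors for eigenvalues in the image of the complex numbers. -/
theorem exists_unitary_diagonalization
    (h : ∀ a : R, star a * a = algebraMap ℝ R (‖a‖ ^ 2)) (f : ℂ → R) (hf : ∀ z, ‖f z‖ = ‖z‖)
    (heig : ∀ (n : ℕ) (S : Matrix (Fin (n + 1)) (Fin (n + 1)) R),
      ∃ v : Fin (n + 1) → R, v ≠ 0 ∧ ∃ z, ∀ i, ∑ j, S i j * v j = v i * f z) (n : ℕ)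
    (S : Matrix (Fin n) (Fin n) R) (hS : S ∈ unitary (Matrix (Fin n) (Fin n) R)) :
    ∃ P ∈ unitary (Matrix (Fin n) (Fin n) R), ∃ z : Fin n → Circle,
      S * P = P * diagonal fun i => f (z i) := by
  induction n with
  | zero => exact ⟨1, one_mem _, fun i => i.elim0, by ext i; exact i.elim0⟩
  | succ n ih =>
    obtain ⟨w, hw0, z₀, hw⟩ := heig n S
    have hpos : 0 < ∑ i, ‖w i‖ ^ 2 := by
      obtain ⟨i, hi⟩ := Function.ne_iff.1 hw0
      exact Finset.sum_pos' (fun _ _ => by positivity)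
        ⟨i, Finset.mem_univ i, by have := norm_pos_iff.2 hi; positivity⟩
    let r := Real.sqrt (∑ i, ‖w i‖ ^ 2)
    have hr : r ^ 2 = ∑ i, ‖w i‖ ^ 2 := Real.sq_sqrt hpos.le
    have hr0 : r ≠ 0 := (Real.sqrt_pos.2 hpos).ne'
    obtain ⟨P, hP, hPv⟩ := exists_unitary_col h (fun i => r⁻¹ • w i) (by
      simp only [star_smul, smul_mul_smul_comm, h, star_trivial, ← Finset.smul_sum]
      rw [← map_sum, ← hr, Algebra.smul_def, ← map_mul,
        show r⁻¹ * r⁻¹ * r ^ 2 = 1 by field_simp, map_one])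
    -- The first column of `P` is a unit eigenvector, so the first column of `T` is `f z₀` followed
    -- by zeros. Unitarity then gives `z₀` modulus one and splits off the remaining block.
    let T := star P * S * P
    have hT : T ∈ unitary (Matrix (Fin (n + 1)) (Fin (n + 1)) R) :=
      mul_mem (mul_mem (Unitary.star_mem hP) hS) hP
    have hSP (i) : (S * P) i 0 = P i 0 * f z₀ := by
      simp only [mul_apply, hPv, mul_smul_comm, ← Finset.smul_sum, hw, smul_mul_assoc]
    have hcol (i) : T i 0 = (1 : Matrix (Fin (n + 1)) (Fin (n + 1)) R) i 0 * f z₀ := by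
      have : T i 0 = (star P * (S * P)) i 0 := by simp only [T, Matrix.mul_assoc]
      rw [this, mul_apply, Finset.sum_congr rfl fun j _ => by rw [hSP j, ← mul_assoc],
        ← Finset.sum_mul, ← mul_apply, (Unitary.mem_iff.1 hP).1]
    have hz : star (f z₀) * f z₀ = 1 := by
      have := congrFun (congrFun (Unitary.mem_iff.1 hT).1 0) 0
      rw [mul_apply, Finset.sum_eq_single 0 (fun i _ hi => by simp [hcol, hi]) (by simp)] at this
      simpa [hcol, star_apply] using this
    have hz' : ‖z₀‖ = 1 := by
      rw [h, hf] at hz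
      have : (‖z₀‖ ^ 2 : ℝ) = 1 := (algebraMap ℝ R).injective (by rw [hz, map_one])
      exact (pow_eq_one_iff_of_nonneg (norm_nonneg _) two_ne_zero).1 this
    -- Orthogonality of the first column to the others: only its top entry, which is non-zero,
    -- contributes.
    have hrow (j : Fin n) : T 0 j.succ = 0 := by
      have := congrFun (congrFun (Unitary.mem_iff.1 hT).1 0) j.succ
      rw [mul_apply, Finset.sum_eq_single 0 (fun i _ hi => by simp [hcol, hi, star_apply])
        (by simp)] at this
      have hne : star (f z₀) ≠ 0 := left_ne_zero_of_mul_eq_one hz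
      simpa [hcol, star_apply, hne, one_apply, (Fin.succ_ne_zero j).symm] using this
    let T' : Matrix (Fin n) (Fin n) R := Matrix.of fun i j => T i.succ j.succ
    have hT' : T' ∈ unitary (Matrix (Fin n) (Fin n) R) := by
      refine Unitary.mem_iff.2 ⟨?_, ?_⟩ <;> ext i j
      · have := congrFun (congrFun (Unitary.mem_iff.1 hT).1 i.succ) j.succ
        simpa [mul_apply, Fin.sum_univ_succ, star_apply, hrow, T', one_apply] using this
      · have := congrFun (congrFun (Unitary.mem_iff.1 hT).2 i.succ) j.succ
        simpa [mul_apply, Fin.sum_univ_succ, star_apply, hcol, T', one_apply,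
          Fin.succ_ne_zero] using this
    obtain ⟨Q, hQ, z, hz⟩ := ih T' hT'
    let zz : Fin (n + 1) → Circle := Fin.cons ⟨z₀, by simp [Submonoid.unitSphere, hz']⟩ z
    have hzz0 : (zz 0 : ℂ) = z₀ := rfl
    have hzz (i : Fin n) : zz i.succ = z i := rfl
    refine ⟨_, mul_mem hP (unitary_cons hQ), zz, ?_⟩
    have hST : S * P = P * T := by
      simp only [T, ← Matrix.mul_assoc, (Unitary.mem_iff.1 hP).2, Matrix.one_mul]
    rw [← Matrix.mul_assoc, hST, Matrix.mul_assoc P T, Matrix.mul_assoc P]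
    congr 1
    ext i j
    have hz := fun i j => congrFun (congrFun hz i) j
    simp only [mul_diagonal] at hz
    simp only [mul_apply, T', of_apply] at hz
    rw [mul_diagonal]
    refine Fin.cases ?_ (fun i => ?_) i <;> refine Fin.cases ?_ (fun j => ?_) j <;>
      simp [mul_apply, Fin.sum_univ_succ, hcol, hrow, hz, hzz0, hzz,
        Fin.succ_ne_zero]

theorem exists_unitary_diagonalization_complex {n : ℕ} {S : Matrix (Fin n) (Fin n) ℂ}
    (hS : S ∈ unitary (Matrix (Fin n) (Fin n) ℂ)) :
    ∃ P ∈ unitary (Matrix (Fin n) (Fin n) ℂ), ∃ z : Fin n → Circle,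
      S * P = P * diagonal fun i => (z i : ℂ) := by
  refine exists_unitary_diagonalization (fun a => ?_) (fun z => z) (fun z => rfl)
    (fun n S => ?_) n S hS
  · rw [Complex.star_def, Complex.conj_mul']
    simp
  · obtain ⟨μ, hμ⟩ := Module.End.exists_eigenvalue (Matrix.toLin' S)
    obtain ⟨v, hv⟩ := hμ.exists_hasEigenvector
    refine ⟨v, hv.2, μ, fun i => ?_⟩
    have := congrFun hv.apply_eq_smul i
    rw [Matrix.toLin'_apply] at this
    exact this.trans (mul_comm _ _)

/-- With complex scalars acting on the right, quaternionic column vectors form a finite-dimensional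
complex space on which left multiplication by `S` is linear, so an eigenvalue exists there. -/
theorem exists_quaternion_eigenvector {n : ℕ}
    (S : Matrix (Fin (n + 1)) (Fin (n + 1)) (Quaternion ℝ)) :
    ∃ v : Fin (n + 1) → Quaternion ℝ, v ≠ 0 ∧ ∃ z : ℂ,
      ∀ i, ∑ j, S i j * v j = v i * Quaternion.coeComplex z := by
  let f : ℂ →+* (Quaternion ℝ)ᵐᵒᵖ :=
    { toFun := fun z => MulOpposite.op (Quaternion.coeComplex z)
      map_one' := by simp
      map_mul' := fun a b => by rw [mul_comm]; simp
      map_zero' := by simp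
      map_add' := fun a b => by simp }
  let _ : Module ℂ (Fin (n + 1) → Quaternion ℝ) := Module.compHom _ f
  have hsmul (z : ℂ) (v : Fin (n + 1) → Quaternion ℝ) (i) :
      (z • v) i = v i * Quaternion.coeComplex z := rfl
  have : IsScalarTower ℝ ℂ (Fin (n + 1) → Quaternion ℝ) := ⟨fun x z v => by
    funext i
    rw [Pi.smul_apply, hsmul, hsmul, Complex.real_smul, Quaternion.coeComplex_mul,
      Quaternion.coeComplex_coe, ← mul_smul_comm, ← Quaternion.coe_mul_eq_smul]⟩
  have : FiniteDimensional ℂ (Fin (n + 1) → Quaternion ℝ) :=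
      Module.Finite.of_restrictScalars_finite ℝ ℂ _
  let T : Module.End ℂ (Fin (n + 1) → Quaternion ℝ) :=
    { toFun := fun v i => ∑ j, S i j * v j
      map_add' := fun v w => by
        funext i
        simp [mul_add, Finset.sum_add_distrib]
      map_smul' := fun z v => by
        funext i
        simp only [hsmul, RingHom.id_apply, Finset.sum_mul, mul_assoc] }
  obtain ⟨μ, hμ⟩ := Module.End.exists_eigenvalue T
  obtain ⟨v, hv⟩ := hμ.exists_hasEigenvector
  exact ⟨v, hv.2, μ, fun i => congrFun hv.apply_eq_smul i⟩

theorem exists_unitary_diagonalization_quaternion {n : ℕ}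
    {S : Matrix (Fin n) (Fin n) (Quaternion ℝ)}
    (hS : S ∈ unitary (Matrix (Fin n) (Fin n) (Quaternion ℝ))) :
    ∃ P ∈ unitary (Matrix (Fin n) (Fin n) (Quaternion ℝ)), ∃ z : Fin n → Circle,
      S * P = P * diagonal fun i => Quaternion.coeComplex (z i : ℂ) := by
  have : StarModule ℝ (Quaternion ℝ) := ⟨fun r a => by rw [Quaternion.star_smul]; rfl⟩
  refine exists_unitary_diagonalization (fun a => ?_) Quaternion.coeComplex (fun z => ?_)
    (fun n S => exists_quaternion_eigenvector S) n S hS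
  · rw [Quaternion.star_mul_self, Quaternion.normSq_eq_norm_mul_self, sq]
    rfl
  · rw [← sq_eq_sq₀ (norm_nonneg _) (norm_nonneg _), sq, ← Quaternion.normSq_eq_norm_mul_self,
      Quaternion.normSq_def', Complex.sq_norm, Complex.normSq_apply]
    simp
    ring

theorem USp.exists_conj_torus {n : ℕ} (g : USp n) :
    ∃ (p : USp n) (z : Fin n → Circle), g = p * torusUSp z * p⁻¹ := by
  obtain ⟨P, hP, z, h⟩ := exists_unitary_diagonalization_quaternion g.2
  refine ⟨⟨P, hP⟩, z, eq_mul_inv_of_mul_eq (Subtype.ext h)⟩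

theorem SUn.exists_conj_torus {n : ℕ} (g : SUn n) :
    ∃ (p : SUn n) (z : SUTorus n), g = p * torusSU z * p⁻¹ := by
  obtain ⟨hgu, hgd⟩ := Matrix.mem_specialUnitaryGroup_iff.1 g.2
  obtain ⟨P, hP, z, h⟩ := exists_unitary_diagonalization_complex hgu
  have hPdet : star P.det * P.det = 1 := by
    have := congrArg Matrix.det (Unitary.mem_iff.1 hP).1
    rwa [det_mul, det_one, star_eq_conjTranspose, det_conjTranspose] at this
  have hz : ∏ i, z i = 1 := by
    have := congrArg Matrix.det h
    rw [det_mul, det_mul, hgd, one_mul, det_diagonal] at this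
    have h1 : ∏ i, (z i : ℂ) = 1 := (mul_eq_left₀ (right_ne_zero_of_mul_eq_one hPdet)).1 this.symm
    refine Circle.ext ?_
    have h2 := map_prod Circle.coeHom z Finset.univ
    exact h2.trans h1
  rcases Nat.eq_zero_or_pos n with rfl | hn
  · exact ⟨1, ⟨z, hz⟩, Subtype.ext (by ext i; exact i.elim0)⟩
  -- A diagonal correction of the determinant of `P`; it commutes with the diagonalized matrix, so
  -- the conjugation relation is unaffected.
  let D : Matrix (Fin n) (Fin n) ℂ := diagonal (Function.update 1 ⟨0, hn⟩ (star P.det))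
  have hD : D ∈ unitary (Matrix (Fin n) (Fin n) ℂ) := by
    rw [Unitary.mem_iff, star_eq_conjTranspose, diagonal_conjTranspose, diagonal_mul_diagonal,
      diagonal_mul_diagonal, ← diagonal_one]
    constructor <;> congr 1 <;> funext i <;> by_cases hi : i = ⟨0, hn⟩ <;>
      simp [hi] <;> first | exact hPdet | (rw [mul_comm]; exact hPdet)
  refine ⟨⟨P * D, Matrix.mem_specialUnitaryGroup_iff.2 ⟨mul_mem hP hD, ?_⟩⟩, ⟨z, hz⟩,
    eq_mul_inv_of_mul_eq (Subtype.ext ?_)⟩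
  · rw [det_mul, det_diagonal, Finset.prod_update_of_mem (Finset.mem_univ _)]
    simp only [Pi.one_apply, Finset.prod_const_one, mul_one]
    rw [mul_comm]
    exact hPdet
  · change g.1 * (P * D) = (P * D) * diagonal fun i => (z i : ℂ)
    rw [← Matrix.mul_assoc, h, Matrix.mul_assoc, Matrix.mul_assoc, diagonal_mul_diagonal,
      diagonal_mul_diagonal]
    simp only [mul_comm]

end Diagonalization

/-! ### Normal form of real isometries -/

section RotationPlanes

open Module RealInnerProductSpace

variable {E : Type*} [NormedAddCommGroup E] [InnerProductSpace ℝ E]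

/-- `T` acts on the plane of the vectors `u`, `v` as the rotation of angle the argument of `z`. -/
def ActsAsRotation (T : E →ₗᵢ[ℝ] E) (u v : E) (z : Circle) : Prop :=
  T u = (z : ℂ).re • u + (z : ℂ).im • v ∧ T v = -(z : ℂ).im • u + (z : ℂ).re • v

theorem Circle.re_sq_add_im_sq (z : Circle) : (z : ℂ).re ^ 2 + (z : ℂ).im ^ 2 = 1 := by
  have := Circle.normSq_coe z
  rw [Complex.normSq_apply] at this
  linarith

/-- The relation makes the span of `u` and `T u` invariant, and pairing it with `T u` gives $\langle
u,Tu\rangle=c$. Gram–Schmidt then exhibits a rotation of cosine $c$, unless $c=\pm1$, where `T u = ±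
u`. -/
theorem actsAsRotation_or_eq (T : E →ₗᵢ[ℝ] E) {u : E} (hu : ‖u‖ = 1) {c : ℝ}
    (h : T (T u) + u = (2 * c) • T u) :
    (∃ v z, Orthonormal ℝ ![u, v] ∧ ActsAsRotation T u v z) ∨ T u = u ∨ T u = -u := by
  have huu : ⟪u, u⟫ = 1 := by rw [real_inner_self_eq_norm_sq, hu, one_pow]
  have hTT : ⟪T u, T u⟫ = 1 := by rw [T.inner_map_map, huu]
  have hc : ⟪u, T u⟫ = c := by
    have h1 := congrArg (fun x => ⟪T u, x⟫) h
    simp only [inner_add_right, T.inner_map_map, inner_smul_right] at h1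
    rw [real_inner_comm u (T u), huu] at h1
    linarith
  have hc' : ⟪T u, u⟫ = c := by rw [real_inner_comm, hc]
  have hw : ⟪T u - c • u, T u - c • u⟫ = 1 - c ^ 2 := by
    simp only [inner_sub_left, inner_sub_right, inner_smul_left, inner_smul_right, hTT, hc, hc',
      huu, RCLike.conj_to_real]
    ring
  have hw0 : 0 ≤ 1 - c ^ 2 := hw ▸ real_inner_self_nonneg
  by_cases hs : 1 - c ^ 2 = 0
  · right
    have h1 : T u = c • u := by
      rw [hs, inner_self_eq_zero, sub_eq_zero] at hw
      exact hw
    have h2 : (c - 1) * (c + 1) = 0 := by linarith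
    rcases mul_eq_zero.1 h2 with h3 | h3
    · left; rw [h1, sub_eq_zero.1 h3, one_smul]
    · right; rw [h1, eq_neg_of_add_eq_zero_left h3, neg_one_smul]
  · left
    let s := Real.sqrt (1 - c ^ 2)
    have hs2 : s ^ 2 = 1 - c ^ 2 := Real.sq_sqrt hw0
    have hs0 : s ≠ 0 := fun h0 => hs (by rw [← hs2, h0]; norm_num)
    let v := s⁻¹ • (T u - c • u)
    have hTu : T u = c • u + s • v := by simp [v, smul_smul, hs0]
    have huv : ⟪u, v⟫ = 0 := by simp [v, inner_smul_right, inner_sub_right, hc, hu]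
    have hvv : ⟪v, v⟫ = 1 := by
      simp only [v, inner_smul_left, inner_smul_right, hw, ← hs2, RCLike.conj_to_real]
      field_simp
    refine ⟨v, ⟨⟨c, s⟩, by
      simp only [Submonoid.unitSphere, Submonoid.mem_mk, Subsemigroup.mem_mk, mem_sphere_iff_norm,
        sub_zero, Complex.norm_def, Complex.normSq_mk]
      rw [show c * c + s * s = 1 by linarith, Real.sqrt_one]⟩, ?_, hTu, ?_⟩
    · rw [orthonormal_iff_ite]
      intro i j
      fin_cases i <;> fin_cases j
      · exact huu.trans (by simp)
      · exact huv.trans (by simp)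
      · exact ((real_inner_comm u v).trans huv).trans (by simp)
      · exact hvv.trans (by simp)
    · have h1 : T (T u) = (2 * c) • T u - u := eq_sub_of_add_eq h
      have h2 : s • T v = s • (-s • u + c • v) := by
        have h3 : T (T u) = c • T u + s • T v := by
          conv_lhs => rw [hTu, map_add, map_smul, map_smul]
        have h4 : s • T v = c • T u - u := by
          rw [← sub_eq_iff_eq_add'.2 h3, h1]
          module
        rw [h4, hTu]
        have : c • (c • u + s • v) - u = (-(1 - c ^ 2)) • u + (c * s) • v := by module
        rw [this, ← hs2]
        module
      exact smul_right_injective E hs0 h2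

/-- The operator $T+T^{-1}$ is symmetric, and each of its eigenvectors satisfies the quadratic
relation of `actsAsRotation_or_eq`. If three orthonormal ones give no plane, each is fixed or
negated, and two with the same sign span a plane rotated by $0$ or $\pi$. -/
theorem exists_actsAsRotation [FiniteDimensional ℝ E] (T : E →ₗᵢ[ℝ] E) (h : 3 ≤ finrank ℝ E) :
    ∃ u v z, Orthonormal ℝ ![u, v] ∧ ActsAsRotation T u v z := by
  let e := T.toLinearIsometryEquiv rfl
  have he (x) : e x = T x := rfl
  have hinv (x) : T (e.symm x) = x := e.apply_symm_apply x
  let S : E →ₗ[ℝ] E := T.toLinearMap + e.symm.toLinearEquiv.toLinearMap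
  have hS : S.IsSymmetric := by
    intro x y
    have h1 : ⟪T x, y⟫ = ⟪x, e.symm y⟫ := by
      conv_lhs => rw [← hinv y]
      rw [T.inner_map_map]
    have h2 : ⟪e.symm x, y⟫ = ⟪x, T y⟫ := by
      conv_rhs => rw [← hinv x]
      rw [T.inner_map_map]
    change ⟪T x + e.symm x, y⟫ = ⟪x, T y + e.symm y⟫
    rw [inner_add_left, inner_add_right, h1, h2, add_comm]
  let b := hS.eigenvectorBasis rfl
  have hb (i) : T (T (b i)) + b i = (2 * (hS.eigenvalues rfl i / 2)) • T (b i) := by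
    have h1 := congrArg T (hS.apply_eigenvectorBasis rfl i)
    have h2 : S (b i) = T (b i) + e.symm (b i) := rfl
    rw [h2, map_add, hinv, map_smul] at h1
    rw [h1, mul_div_cancel₀ _ two_ne_zero]
    rfl
  have hsame {u v : E} (ε : Circle) (hε : (ε : ℂ).im = 0) (huv : Orthonormal ℝ ![u, v])
      (hu : T u = (ε : ℂ).re • u) (hv : T v = (ε : ℂ).re • v) :
      ∃ u v z, Orthonormal ℝ ![u, v] ∧ ActsAsRotation T u v z :=
    ⟨u, v, ε, huv, by simp [hu, hε], by simp [hv, hε]⟩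
  have hpair (i j : Fin (finrank ℝ E)) (hij : i ≠ j) : Orthonormal ℝ ![b i, b j] := by
    have := b.orthonormal.comp ![i, j] (by
      intro k l hkl
      fin_cases k <;> fin_cases l <;> simp_all [hij.symm])
    convert this using 1
    funext k
    fin_cases k <;> rfl
  have hone {i j : Fin (finrank ℝ E)} (hij : i ≠ j) (hi : T (b i) = b i) (hj : T (b j) = b j) :=
    hsame (1 : Circle) (by simp) (hpair i j hij) (by simp [hi]) (by simp [hj])
  have hneg {i j : Fin (finrank ℝ E)} (hij : i ≠ j) (hi : T (b i) = -b i)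
      (hj : T (b j) = -b j) :=
    hsame (-1 : Circle) (by simp) (hpair i j hij) (by simp [hi]) (by simp [hj])
  let i₀ : Fin (finrank ℝ E) := ⟨0, by omega⟩
  let i₁ : Fin (finrank ℝ E) := ⟨1, by omega⟩
  let i₂ : Fin (finrank ℝ E) := ⟨2, by omega⟩
  have h01 : i₀ ≠ i₁ := by simp [i₀, i₁]
  have h02 : i₀ ≠ i₂ := by simp [i₀, i₂]
  have h12 : i₁ ≠ i₂ := by simp [i₁, i₂]
  have hcase (i) := actsAsRotation_or_eq T (b.norm_eq_one i) (hb i)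
  rcases hcase i₀ with ⟨v, z, hv⟩ | h0 | h0
  · exact ⟨_, v, z, hv⟩
  all_goals rcases hcase i₁ with ⟨v, z, hv⟩ | h1 | h1
  all_goals first | exact ⟨_, v, z, hv⟩ | skip
  all_goals rcases hcase i₂ with ⟨v, z, hv⟩ | h2 | h2
  all_goals first
    | exact ⟨_, v, z, hv⟩ | exact hone h01 h0 h1 | exact hone h02 h0 h2 | exact hone h12 h1 h2
    | exact hneg h01 h0 h1 | exact hneg h02 h0 h2 | exact hneg h12 h1 h2

/-- Induction on the orthogonal complement of one rotation plane. The bound $2m+1$ leaves dimension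
at least $3$ whenever another plane is extracted. -/
theorem exists_rotation_planes (m : ℕ) : ∀ {E : Type} [NormedAddCommGroup E]
    [InnerProductSpace ℝ E] [FiniteDimensional ℝ E] (T : E →ₗᵢ[ℝ] E), 2 * m + 1 ≤ finrank ℝ E →
    ∃ (b : Fin 2 × Fin m → E) (z : Fin m → Circle), Orthonormal ℝ b ∧
      ∀ i, ActsAsRotation T (b (0, i)) (b (1, i)) (z i) := by
  induction m with
  | zero =>
    intro E _ _ _ T _
    exact ⟨fun x => x.2.elim0, fun i => i.elim0,
      ⟨fun x => x.2.elim0, fun x => x.2.elim0⟩, fun i => i.elim0⟩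
  | succ m ih =>
    intro E _ _ _ T hE
    obtain ⟨u, v, z, huv, hu, hv⟩ := exists_actsAsRotation T (by omega)
    rw [orthonormal_iff_ite] at huv
    have huu : ⟪u, u⟫ = 1 := by simpa using huv 0 0
    have hvv : ⟪v, v⟫ = 1 := by simpa using huv 1 1
    have huv' : ⟪u, v⟫ = 0 := by simpa using huv 0 1
    have hvu : ⟪v, u⟫ = 0 := by simpa using huv 1 0
    let F : Submodule ℝ E := (Submodule.span ℝ {u, v})ᗮ
    have hF (x : E) : x ∈ F ↔ ⟪u, x⟫ = 0 ∧ ⟪v, x⟫ = 0 := by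
      rw [Submodule.mem_orthogonal]
      refine ⟨fun h => ⟨h u (Submodule.subset_span (by simp)),
        h v (Submodule.subset_span (by simp))⟩, fun ⟨h1, h2⟩ y hy => ?_⟩
      obtain ⟨a, b, rfl⟩ := Submodule.mem_span_pair.1 hy
      simp [inner_add_left, inner_smul_left, h1, h2]
    have hz := Circle.re_sq_add_im_sq z
    have hTF (x : E) (hx : x ∈ F) : T x ∈ F := by
      obtain ⟨h1, h2⟩ := (hF x).1 hx
      have h3 : ⟪T u, T x⟫ = 0 := by rw [T.inner_map_map, h1]
      have h4 : ⟪T v, T x⟫ = 0 := by rw [T.inner_map_map, h2]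
      rw [hu, inner_add_left, inner_smul_left, inner_smul_left] at h3
      rw [hv, inner_add_left, inner_smul_left, inner_smul_left] at h4
      simp only [RCLike.conj_to_real] at h3 h4
      refine (hF _).2 ⟨?_, ?_⟩
      · linear_combination (z : ℂ).re * h3 - (z : ℂ).im * h4 - ⟪u, T x⟫ * hz
      · linear_combination (z : ℂ).im * h3 + (z : ℂ).re * h4 - ⟪v, T x⟫ * hz
    let T' : F →ₗᵢ[ℝ] F :=
      { toLinearMap := T.toLinearMap.restrict hTF
        norm_map' := fun x => T.norm_map x }
    have hdim : 2 * m + 1 ≤ finrank ℝ F := by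
      have h1 := Submodule.finrank_add_finrank_orthogonal (Submodule.span ℝ {u, v})
      have h2 : finrank ℝ (Submodule.span ℝ {u, v}) ≤ 2 := by
        classical
        have := finrank_span_finset_le_card (R := ℝ) ({u, v} : Finset E)
        simp only [Finset.coe_insert, Finset.coe_singleton] at this
        exact this.trans Finset.card_le_two
      change 2 * m + 1 ≤ finrank ℝ (Submodule.span ℝ {u, v})ᗮ
      omega
    obtain ⟨b, w, hb, hbT⟩ := ih T' hdim
    rw [orthonormal_iff_ite] at hb
    let b' : Fin 2 × Fin (m + 1) → E := fun x =>
      (Fin.cons (![u, v] x.1) (fun i => (b (x.1, i) : E)) : Fin (m + 1) → E) x.2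
    have hb0 (a) : b' (a, 0) = ![u, v] a := rfl
    have hbs (a i) : b' (a, Fin.succ i) = b (a, i) := rfl
    let w' : Fin (m + 1) → Circle := Fin.cons z w
    refine ⟨b', w', orthonormal_iff_ite.2 ?_, fun i => ?_⟩
    · have hperp (a c i) : ⟪![u, v] a, (b (c, i) : E)⟫ = 0 := by
        have := (hF _).1 (b (c, i)).2
        fin_cases a
        · exact this.1
        · exact this.2
      rintro ⟨a, i⟩ ⟨c, j⟩
      refine Fin.cases ?_ (fun i => ?_) i <;> refine Fin.cases ?_ (fun j => ?_) j
      · rw [hb0, hb0, huv]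
        simp
      · rw [hb0, hbs, hperp]
        simp [(Fin.succ_ne_zero j).symm]
      · rw [hb0, hbs, real_inner_comm, hperp]
        simp [Fin.succ_ne_zero i]
      · rw [hbs, hbs]
        exact (hb (a, i) (c, j)).trans (by simp)
    · refine Fin.cases ⟨hu, hv⟩ (fun i => ?_) i
      obtain ⟨h1, h2⟩ := hbT i
      exact ⟨congrArg Subtype.val h1, congrArg Subtype.val h2⟩

end RotationPlanes

/-! ### Conjugation into the torus of the special orthogonal groups -/

section OrthogonalTorus

open Matrix RealInnerProductSpace

theorem torusSOEven_coe {n : ℕ} (z : Fin n → Circle) :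
    (torusSOEven z).1 = blockDiagonal fun i => rot (z i) := rfl

theorem torusSOOdd_coe {n : ℕ} (z : Fin n → Circle) :
    (torusSOOdd z).1 = fromBlocks (blockDiagonal fun i => rot (z i)) 0 0 1 := rfl

/-- The vectors spanning the rotation planes are placed at the indices chosen by `j` and completed
to an orthonormal basis, whose members are the columns of `P`. -/
theorem exists_orthogonal_rotation_columns {ι : Type} [Fintype ι] [DecidableEq ι] {m : ℕ}
    (j : Fin 2 × Fin m → ι) (hj : Function.Injective j) (hcard : 2 * m + 1 ≤ Fintype.card ι)
    (g : Matrix ι ι ℝ) (hg : gᵀ * g = 1) :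
    ∃ (P : Matrix ι ι ℝ) (z : Fin m → Circle), Pᵀ * P = 1 ∧ ∀ i x,
      (Pᵀ * g * P) x (j (0, i)) = (z i : ℂ).re * (1 : Matrix ι ι ℝ) x (j (0, i)) +
        (z i : ℂ).im * (1 : Matrix ι ι ℝ) x (j (1, i)) ∧
      (Pᵀ * g * P) x (j (1, i)) = -(z i : ℂ).im * (1 : Matrix ι ι ℝ) x (j (0, i)) +
        (z i : ℂ).re * (1 : Matrix ι ι ℝ) x (j (1, i)) := by
  let T : EuclideanSpace ℝ ι →ₗᵢ[ℝ] EuclideanSpace ℝ ι :=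
    { toLinearMap := Matrix.toEuclideanLin g
      norm_map' := fun x => by
        rw [← sq_eq_sq₀ (norm_nonneg _) (norm_nonneg _), ← real_inner_self_eq_norm_sq,
          ← real_inner_self_eq_norm_sq, EuclideanSpace.inner_eq_star_dotProduct,
          EuclideanSpace.inner_eq_star_dotProduct]
        simp only [Matrix.toLpLin_apply, star_trivial]
        rw [Matrix.dotProduct_mulVec, Matrix.vecMul_mulVec, ← Matrix.dotProduct_mulVec, hg,
          Matrix.one_mulVec] }
  have hT (x : EuclideanSpace ℝ ι) (k : ι) : T x k = ∑ l, g k l * x l := rfl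
  obtain ⟨v, z, hv, hvT⟩ := exists_rotation_planes m T (by simpa using hcard)
  obtain ⟨b, hb⟩ := Orthonormal.exists_orthonormalBasis_extension_of_card_eq (𝕜 := ℝ)
    (E := EuclideanSpace ℝ ι) (ι := ι) (by simp)
    (v := fun x => if h : ∃ y, j y = x then v h.choose else 0) (s := Set.range j) (by
      have hval (x) : (if h : ∃ y, j y = j x then v h.choose else 0) = v x := by
        have hx : (∃ y, j y = j x) := ⟨x, rfl⟩
        rw [dif_pos hx, hj hx.choose_spec]
      rw [orthonormal_iff_ite] at hv ⊢
      rintro ⟨_, x, rfl⟩ ⟨_, y, rfl⟩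
      rw [Set.domRestrict_apply, Set.domRestrict_apply, hval, hval, hv]
      exact if_congr (hj.eq_iff.symm.trans Subtype.mk_eq_mk.symm) rfl rfl)
  have hbj (x) : b (j x) = v x := by
    rw [hb _ ⟨x, rfl⟩]
    have hx : (∃ y, j y = j x) := ⟨x, rfl⟩
    rw [dif_pos hx, hj hx.choose_spec]
  let P : Matrix ι ι ℝ := Matrix.of fun k l => b l k
  have hP : Pᵀ * P = 1 := by
    ext k l
    have := orthonormal_iff_ite.1 b.orthonormal k l
    rw [EuclideanSpace.inner_eq_star_dotProduct] at this
    rw [mul_apply, one_apply, ← this]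
    simp [P, dotProduct, mul_comm]
  have hcol (x y : ι) : (Pᵀ * g * P) x y = ∑ k, P k x * T (b y) k := by
    rw [Matrix.mul_assoc, mul_apply]
    simp only [mul_apply, transpose_apply, hT]
    rfl
  have hPb (x y : ι) : ∑ k, P k x * b y k = (1 : Matrix ι ι ℝ) x y := by
    rw [← hP, mul_apply]
    rfl
  refine ⟨P, z, hP, fun i x => ⟨?_, ?_⟩⟩
  · rw [hcol, hbj, (hvT i).1, ← hPb, ← hPb, Finset.mul_sum, Finset.mul_sum,
      ← Finset.sum_add_distrib, hbj, hbj]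
    exact Finset.sum_congr rfl fun k _ => by simp; ring
  · rw [hcol, hbj, (hvT i).2, ← hPb, ← hPb, Finset.mul_sum, Finset.mul_sum,
      ← Finset.sum_add_distrib, hbj, hbj]
    exact Finset.sum_congr rfl fun k _ => by simp; ring

/-- Orthogonality of the column `y` to the columns `x₀` and `x₁` says that a rotation matrix kills
the vector of the two entries, and a rotation is invertible. -/
theorem row_eq_zero_of_rotation_columns {ι : Type} [Fintype ι] [DecidableEq ι]
    {M : Matrix ι ι ℝ} (hM : Mᵀ * M = 1) {z : Circle} {x₀ x₁ y : ι}
    (h : ∀ x, M x x₀ = (z : ℂ).re * (1 : Matrix ι ι ℝ) x x₀ + (z : ℂ).im *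
        (1 : Matrix ι ι ℝ) x x₁ ∧
      M x x₁ = -(z : ℂ).im * (1 : Matrix ι ι ℝ) x x₀ + (z : ℂ).re * (1 : Matrix ι ι ℝ) x x₁)
    (hy₀ : x₀ ≠ y) (hy₁ : x₁ ≠ y) : M x₀ y = 0 ∧ M x₁ y = 0 := by
  have h0 := congrFun (congrFun hM x₀) y
  have h1 := congrFun (congrFun hM x₁) y
  rw [mul_apply, one_apply_ne hy₀] at h0
  rw [mul_apply, one_apply_ne hy₁] at h1
  simp only [transpose_apply, (h _).1, (h _).2, add_mul, Finset.sum_add_distrib, one_apply,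
    mul_ite, mul_one, mul_zero, ite_mul, zero_mul, Finset.sum_ite_eq', Finset.mem_univ,
    if_true] at h0 h1
  have hz := Circle.re_sq_add_im_sq z
  constructor
  · linear_combination (z : ℂ).re * h0 - (z : ℂ).im * h1 - M x₀ y * hz
  · linear_combination (z : ℂ).im * h0 + (z : ℂ).re * h1 - M x₁ y * hz

theorem det_eq_one_or_of_transpose_mul {ι : Type} [Fintype ι] [DecidableEq ι] {P : Matrix ι ι ℝ}
    (h : Pᵀ * P = 1) : P.det = 1 ∨ P.det = -1 := by
  have := congrArg Matrix.det h
  rw [det_mul, det_transpose, det_one] at this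
  exact mul_self_eq_one_iff.1 this

theorem specialOrthogonalGroup_iff {ι : Type} [Fintype ι] [DecidableEq ι] {P : Matrix ι ι ℝ} :
    P ∈ Matrix.specialOrthogonalGroup ι ℝ ↔ Pᵀ * P = 1 ∧ P.det = 1 := by
  rw [Matrix.mem_specialOrthogonalGroup_iff, Matrix.mem_orthogonalGroup_iff']

theorem SOOdd.exists_conj_torus {n : ℕ} (g : SOOdd n) :
    ∃ (p : SOOdd n) (z : Fin n → Circle), g = p * torusSOOdd z * p⁻¹ := by
  obtain ⟨hg, hgd⟩ := specialOrthogonalGroup_iff.1 g.2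
  obtain ⟨P, z, hP, hcol⟩ := exists_orthogonal_rotation_columns (Sum.inl : Fin 2 × Fin n → _)
    Sum.inl_injective (by simp) g.1 hg
  set M := Pᵀ * g.1 * P with hMdef
  have hP' : P * Pᵀ = 1 := mul_eq_one_comm.1 hP
  have hM : Mᵀ * M = 1 := by
    rw [hMdef, transpose_mul, transpose_mul, transpose_transpose]
    calc _ = Pᵀ * (g.1ᵀ * (P * Pᵀ) * g.1) * P := by simp only [Matrix.mul_assoc]
      _ = 1 := by rw [hP', Matrix.mul_one, hg, Matrix.mul_one, hP]
  have hMt : M = Matrix.fromBlocks (Matrix.blockDiagonal fun i => rot (z i)) 0 0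
      (Matrix.of fun _ _ => M (Sum.inr ()) (Sum.inr ())) := by
    ext x y
    rcases x with ⟨a, i⟩ | u <;> rcases y with ⟨b, k⟩ | w
    · by_cases hik : i = k
      · subst hik
        fin_cases b <;> fin_cases a <;>
          simp [hcol, rot, blockDiagonal_apply, one_apply]
      · fin_cases b <;> simp [hcol, blockDiagonal_apply, one_apply, hik]
    · have := row_eq_zero_of_rotation_columns hM (x₀ := Sum.inl (0, i)) (x₁ := Sum.inl (1, i))
        (y := Sum.inr w) (hcol i) (by simp) (by simp)
      fin_cases a
      · exact this.1
      · exact this.2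
    · fin_cases b <;> simp [hcol, one_apply]
    · rfl
  have hMd : M.det = 1 := by
    rw [hMdef, det_mul, det_mul, hgd, mul_one, ← det_mul, hP, det_one]
  have hM1 : M = (torusSOOdd z).1 := by
    -- The rotation blocks have determinant $1$, so the remaining diagonal entry equals the
    -- determinant of `M`, that is $1$.
    have h1 := hMd
    rw [hMt, det_fromBlocks_zero₂₁, det_blockDiagonal] at h1
    simp only [rot_det, Finset.prod_const_one, one_mul, det_unique, of_apply] at h1
    rw [hMt, h1]
    change _ = Matrix.fromBlocks _ _ _ _
    congr 1
  have hgP : g.1 * P = P * (torusSOOdd z).1 := by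
    rw [← hM1, hMdef, ← Matrix.mul_assoc, ← Matrix.mul_assoc, hP', Matrix.one_mul]
  rcases det_eq_one_or_of_transpose_mul hP with h | h
  · exact ⟨⟨P, specialOrthogonalGroup_iff.2 ⟨hP, h⟩⟩, z, eq_mul_inv_of_mul_eq (Subtype.ext hgP)⟩
  -- In odd dimension `-P` has the opposite determinant and conjugates in the same way.
  · refine ⟨⟨-P, specialOrthogonalGroup_iff.2 ⟨by simpa using hP, ?_⟩⟩, z,
      eq_mul_inv_of_mul_eq (Subtype.ext ?_)⟩
    · rw [det_neg, h]
      simp [pow_add, pow_mul]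
    · change g.1 * -P = -P * (torusSOOdd z).1
      rw [Matrix.mul_neg, hgP, Matrix.neg_mul]

theorem exists_eq_rot {N : Matrix (Fin 2) (Fin 2) ℝ} (h : N ∈ specialOrthogonalGroup (Fin 2) ℝ) :
    ∃ z, N = rot z := by
  obtain ⟨h0, h1, h2⟩ := Matrix.mem_specialOrthogonalGroup_fin_two_iff.1 h
  refine ⟨⟨⟨N 0 0, N 1 0⟩, ?_⟩, ?_⟩
  · simp only [Submonoid.unitSphere, Submonoid.mem_mk, Subsemigroup.mem_mk, mem_sphere_iff_norm,
      sub_zero, Complex.norm_def, Complex.normSq_mk]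
    rw [Real.sqrt_eq_one]
    rw [h1] at h2
    linarith
  · ext i j
    fin_cases i <;> fin_cases j <;> first | rfl | exact h1 | exact h0.symm

theorem SOEven.exists_conj_torus {n : ℕ} (hn : 0 < n) (g : SOEven n) :
    ∃ (p : SOEven n) (z : Fin n → Circle), g = p * torusSOEven z * p⁻¹ := by
  obtain ⟨m, rfl⟩ := Nat.exists_eq_add_of_le' hn
  obtain ⟨hg, hgd⟩ := specialOrthogonalGroup_iff.1 g.2
  obtain ⟨P, z, hP, hcol⟩ := exists_orthogonal_rotation_columns
    (fun x : Fin 2 × Fin m => ((x.1, x.2.castSucc) : Fin 2 × Fin (m + 1)))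
    (fun x y h => by
      simp only [Prod.mk.injEq, Fin.castSucc_inj] at h
      exact Prod.ext h.1 h.2) (by simp [mul_add]) g.1 hg
  set M := Pᵀ * g.1 * P with hMdef
  have hP' : P * Pᵀ = 1 := mul_eq_one_comm.1 hP
  have hM : Mᵀ * M = 1 := by
    rw [hMdef, transpose_mul, transpose_mul, transpose_transpose]
    calc _ = Pᵀ * (g.1ᵀ * (P * Pᵀ) * g.1) * P := by simp only [Matrix.mul_assoc]
      _ = 1 := by rw [hP', Matrix.mul_one, hg, Matrix.mul_one, hP]
  let N : Fin (m + 1) → Matrix (Fin 2) (Fin 2) ℝ := fun i => Matrix.of fun a b => M (a, i) (b, i)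
  have hMN : M = blockDiagonal N := by
    ext ⟨a, i⟩ ⟨b, k⟩
    rw [blockDiagonal_apply]
    by_cases hik : i = k
    · subst hik
      simp [N]
    · simp only [hik, if_false]
      revert hik
      refine Fin.lastCases ?_ (fun k => ?_) k <;> intro hik
      · obtain ⟨i, rfl⟩ := Fin.exists_castSucc_eq.2 hik
        have := row_eq_zero_of_rotation_columns hM (x₀ := (0, i.castSucc)) (x₁ := (1, i.castSucc))
          (y := (b, Fin.last m)) (hcol i) (by simp [hik]) (by simp [hik])
        fin_cases a
        · exact this.1
        · exact this.2
      · fin_cases b <;> simp [hcol, one_apply, hik]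
  have hNrot (i : Fin m) : N i.castSucc = rot (z i) := by
    ext a b
    fin_cases b <;> fin_cases a <;> simp [N, hcol, rot, one_apply]
  -- Only $m=n-1$ planes come from the normal form; the last block is orthogonal of determinant $1$,
  -- hence also a rotation.
  have hNlast : N (Fin.last m) ∈ specialOrthogonalGroup (Fin 2) ℝ := by
    refine specialOrthogonalGroup_iff.2 ⟨?_, ?_⟩
    · rw [hMN, blockDiagonal_transpose, ← blockDiagonal_mul, ← blockDiagonal_one] at hM
      exact congrFun (blockDiagonal_injective hM) (Fin.last m)
    · have hMd : M.det = 1 := by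
        rw [hMdef, det_mul, det_mul, hgd, mul_one, ← det_mul, hP, det_one]
      rw [hMN, det_blockDiagonal, Fin.prod_univ_castSucc] at hMd
      simpa [hNrot, rot_det] using hMd
  obtain ⟨w, hw⟩ := exists_eq_rot hNlast
  let zz : Fin (m + 1) → Circle := Fin.snoc z w
  have hM1 : M = (torusSOEven zz).1 := by
    rw [hMN]
    rw [torusSOEven_coe]
    congr 1
    funext i
    refine Fin.lastCases ?_ (fun i => ?_) i
    · simp [zz, hw]
    · simp [zz, hNrot]
  have hgP : g.1 * P = P * (torusSOEven zz).1 := by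
    rw [← hM1, hMdef, ← Matrix.mul_assoc, ← Matrix.mul_assoc, hP', Matrix.one_mul]
  rcases det_eq_one_or_of_transpose_mul hP with h | h
  · exact ⟨⟨P, specialOrthogonalGroup_iff.2 ⟨hP, h⟩⟩, zz, eq_mul_inv_of_mul_eq (Subtype.ext hgP)⟩
  -- A reflection in the first plane repairs the determinant of `P`; it stabilizes the torus,
  -- replacing the first coordinate by its inverse.
  · let F : Matrix (Fin 2 × Fin (m + 1)) (Fin 2 × Fin (m + 1)) ℝ :=
      blockDiagonal (Function.update 1 0 !![1, 0; 0, -1])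
    have hFF : F * F = 1 := by
      rw [← blockDiagonal_mul, ← blockDiagonal_one]
      congr 1
      funext i
      by_cases hi : i = 0
      · subst hi
        ext a b
        fin_cases a <;> fin_cases b <;> simp [mul_apply]
      · simp [hi]
    have hFt : Fᵀ = F := by
      rw [blockDiagonal_transpose]
      congr 1
      funext i
      by_cases hi : i = 0
      · subst hi
        ext a b
        fin_cases a <;> fin_cases b <;> simp
      · simp [hi]
    have hFd : F.det = -1 := by
      rw [det_blockDiagonal, Fin.prod_univ_succ]
      simp [Fin.succ_ne_zero]
    have hconj : F * (torusSOEven zz).1 = (torusSOEven (Function.update zz 0 (zz 0)⁻¹)).1 * F := by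
      rw [torusSOEven_coe, torusSOEven_coe]
      rw [← blockDiagonal_mul, ← blockDiagonal_mul]
      congr 1
      funext i
      by_cases hi : i = 0
      · subst hi
        ext a b
        fin_cases a <;> fin_cases b <;> simp [mul_apply, rot]
      · simp [hi]
    refine ⟨⟨P * F, specialOrthogonalGroup_iff.2 ⟨?_, by rw [det_mul, h, hFd]; norm_num⟩⟩,
      Function.update zz 0 (zz 0)⁻¹, eq_mul_inv_of_mul_eq (Subtype.ext ?_)⟩
    · rw [transpose_mul, hFt]
      calc _ = F * (Pᵀ * P) * F := by simp only [Matrix.mul_assoc]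
        _ = 1 := by rw [hP, Matrix.mul_one, hFF]
    · change g.1 * (P * F) = P * F * (torusSOEven _).1
      have h2 : (torusSOEven zz).1 * F = F * (torusSOEven (Function.update zz 0 (zz 0)⁻¹)).1 := by
        calc _ = F * F * (torusSOEven zz).1 * F := by rw [hFF, Matrix.one_mul]
          _ = F * (F * (torusSOEven zz).1) * F := by simp only [Matrix.mul_assoc]
          _ = F * (torusSOEven (Function.update zz 0 (zz 0)⁻¹)).1 * (F * F) := by
            rw [hconj]; simp only [Matrix.mul_assoc]
          _ = _ := by rw [hFF, Matrix.mul_one]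
      rw [← Matrix.mul_assoc, hgP, Matrix.mul_assoc, h2, Matrix.mul_assoc]

end OrthogonalTorus

/-! ### Signed permutation matrices -/

section SignedPermutations

open Matrix

variable {ι : Type} [Fintype ι] [DecidableEq ι]

/-- The signed permutation matrix with entries `ε x` at the places `(x, σ x)`. -/
def signedPerm (σ : Equiv.Perm ι) (ε : ι → ℤˣ) : Matrix ι ι ℝ :=
  Matrix.of fun x y => if σ x = y then ((ε x : ℤ) : ℝ) else 0

theorem det_signedPerm (σ : Equiv.Perm ι) (ε : ι → ℤˣ) :
    (signedPerm σ ε).det = (((∏ x, ε x) * Equiv.Perm.sign σ : ℤˣ) : ℤ) := by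
  have : signedPerm σ ε = diagonal (fun x => ((ε x : ℤ) : ℝ)) * σ.permMatrix ℝ := by
    ext x y
    rw [diagonal_mul]
    simp [signedPerm, Equiv.Perm.permMatrix, PEquiv.toMatrix_apply]
  rw [this, det_mul, det_diagonal, det_permutation]
  simp [Units.coe_prod]

theorem signedPerm_map_mul {R : Type*} [Ring R] [Algebra ℝ R] (σ : Equiv.Perm ι) (ε : ι → ℤˣ)
    (M : Matrix ι ι R) (x y : ι) :
    ((signedPerm σ ε).map (algebraMap ℝ R) * M) x y = ((ε x : ℤ) : R) * M (σ x) y := by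
  rw [mul_apply, Finset.sum_eq_single (σ x)]
  · simp [signedPerm]
  · intro k _ hk
    simp [signedPerm, hk.symm]
  · simp

theorem mul_signedPerm_map_transpose {R : Type*} [Ring R] [Algebra ℝ R] (σ : Equiv.Perm ι)
    (ε : ι → ℤˣ) (M : Matrix ι ι R) (x y : ι) :
    (M * ((signedPerm σ ε).map (algebraMap ℝ R))ᵀ) x y = M x (σ y) * ((ε y : ℤ) : R) := by
  rw [mul_apply, Finset.sum_eq_single (σ y)]
  · simp [signedPerm]
  · intro k _ hk
    simp [signedPerm, hk.symm]
  · simp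

/-- Stated over any real algebra, so that the same matrices can be used over $\mathbb R$, $\mathbb
C$ and $\mathbb H$. -/
theorem signedPerm_map_conj {R : Type*} [Ring R] [Algebra ℝ R] (σ : Equiv.Perm ι)
    (ε : ι → ℤˣ) (M : Matrix ι ι R) (x y : ι) :
    ((signedPerm σ ε).map (algebraMap ℝ R) * M * ((signedPerm σ ε).map (algebraMap ℝ R))ᵀ) x y =
      ((ε x : ℤ) : R) * M (σ x) (σ y) * ((ε y : ℤ) : R) := by
  rw [mul_signedPerm_map_transpose, signedPerm_map_mul]

theorem signedPerm_conj (σ : Equiv.Perm ι) (ε : ι → ℤˣ) (M : Matrix ι ι ℝ) (x y : ι) :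
    (signedPerm σ ε * M * (signedPerm σ ε)ᵀ) x y =
      ((ε x : ℤ) : ℝ) * M (σ x) (σ y) * ((ε y : ℤ) : ℝ) := by
  have := signedPerm_map_conj σ ε M x y
  simpa using this

theorem Int.cast_units_mul_self {R : Type*} [Ring R] (u : ℤˣ) :
    ((u : ℤ) : R) * ((u : ℤ) : R) = 1 := by
  rw [← Int.cast_mul, ← Units.val_mul, Int.units_mul_self]
  simp

theorem signedPerm_mul_transpose (σ : Equiv.Perm ι) (ε : ι → ℤˣ) :
    signedPerm σ ε * (signedPerm σ ε)ᵀ = 1 := by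
  ext x y
  have := signedPerm_conj σ ε 1 x y
  rw [Matrix.mul_one] at this
  rw [this, one_apply, one_apply]
  by_cases hxy : x = y
  · subst hxy
    simp [Int.cast_units_mul_self]
  · simp [hxy]

theorem signedPerm_mem {σ : Equiv.Perm ι} {ε : ι → ℤˣ} (h : (∏ x, ε x) * Equiv.Perm.sign σ = 1) :
    signedPerm σ ε ∈ specialOrthogonalGroup ι ℝ := by
  rw [specialOrthogonalGroup_iff, det_signedPerm, h]
  exact ⟨mul_eq_one_comm.1 (signedPerm_mul_transpose σ ε), by simp⟩

theorem signedPerm_conj_mul (σ : Equiv.Perm ι) (ε : ι → ℤˣ) {M M' : Matrix ι ι ℝ}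
    (h : ∀ x y, M' x y = ((ε x : ℤ) : ℝ) * M (σ x) (σ y) * ((ε y : ℤ) : ℝ)) :
    M' * signedPerm σ ε = signedPerm σ ε * M := by
  have : M' = signedPerm σ ε * M * (signedPerm σ ε)ᵀ := by
    ext x y
    rw [h, signedPerm_conj]
  rw [this, Matrix.mul_assoc, mul_eq_one_comm.1 (signedPerm_mul_transpose σ ε), Matrix.mul_one]

/-- Applied with `u` the sign of a permutation: one sign change at `x` brings the determinant back
to $1$. -/
theorem exists_prod_units_mul_eq_one [Nonempty ι] (u : ℤˣ) (x : ι) :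
    (∏ y, Function.update (1 : ι → ℤˣ) x u y) * u = 1 := by
  rw [Finset.prod_update_of_mem (Finset.mem_univ x)]
  simp

end SignedPermutations

/-! ### Weyl group elements of the special orthogonal groups -/

section OrthogonalWeyl

open Matrix

variable {n : ℕ}

theorem rot_mul (z w : Circle) : rot (z * w) = rot z * rot w := by
  ext a b
  fin_cases a <;> fin_cases b <;> simp [rot, mul_apply] <;> ring

theorem torusSOEven_mul (z w : Fin n → Circle) :
    torusSOEven (z * w) = torusSOEven z * torusSOEven w := by
  apply Subtype.ext
  rw [Submonoid.coe_mul, torusSOEven_coe, torusSOEven_coe, torusSOEven_coe]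
  rw [← blockDiagonal_mul]
  simp [rot_mul]

theorem torusSOOdd_mul (z w : Fin n → Circle) :
    torusSOOdd (z * w) = torusSOOdd z * torusSOOdd w := by
  apply Subtype.ext
  rw [Submonoid.coe_mul, torusSOOdd_coe, torusSOOdd_coe, torusSOOdd_coe, fromBlocks_multiply]
  simp [rot_mul, ← blockDiagonal_mul]

theorem rot_flip (w : Circle) (u : ℤˣ) (a b : Fin 2) :
    rot (w ^ (u : ℤ)) a b = (((![1, u] : Fin 2 → ℤˣ) a : ℤ) : ℝ) * rot w a b *
      (((![1, u] : Fin 2 → ℤˣ) b : ℤ) : ℝ) := by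
  rcases Int.units_eq_one_or u with rfl | rfl <;> fin_cases a <;> fin_cases b <;> simp [rot]

/-- The permutation acts on both coordinates of the planes, so its sign occurs squared. -/
theorem sign_prodCongr_refl (σ : Equiv.Perm (Fin n)) :
    Equiv.Perm.sign ((Equiv.prodCongr (Equiv.refl (Fin 2)) σ : Equiv.Perm (Fin 2 × Fin n))) = 1
        := by
  have h := Equiv.Perm.sign_prodCongrRight (fun _ : Fin 2 => σ)
  have h' : (Equiv.prodCongrRight fun _ : Fin 2 => σ) =
      (Equiv.prodCongr (Equiv.refl (Fin 2)) σ : Equiv.Perm (Fin 2 × Fin n)) := by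
    ext x <;> rfl
  rw [← h', h]
  simp

theorem SOEven.exists_swap (σ : Equiv.Perm (Fin n)) :
    ∃ g : SOEven n, ∀ z, torusSOEven (z ∘ σ) = g * torusSOEven z * g⁻¹ := by
  refine ⟨⟨signedPerm (Equiv.prodCongr (Equiv.refl _) σ) 1,
    signedPerm_mem (by simp [sign_prodCongr_refl])⟩, fun z => eq_mul_inv_of_mul_eq <|
      Subtype.ext <| signedPerm_conj_mul _ _ ?_⟩
  rintro ⟨a, i⟩ ⟨b, k⟩
  simp [torusSOEven_coe, blockDiagonal_apply]

/-- Each inversion of a rotation block costs a determinant $-1$, hence the restriction to even sign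
changes. -/
theorem SOEven.exists_flip (ε : Fin n → ℤˣ) (hε : ∏ i, ε i = 1) :
    ∃ g : SOEven n, ∀ z, torusSOEven (fun i => z i ^ (ε i : ℤ)) = g * torusSOEven z * g⁻¹ := by
  refine ⟨⟨signedPerm (Equiv.refl _) fun x => (![1, ε x.2] : Fin 2 → ℤˣ) x.1,
    signedPerm_mem (by simp [Fintype.prod_prod_type, hε])⟩, fun z => eq_mul_inv_of_mul_eq <|
      Subtype.ext <| signedPerm_conj_mul _ _ ?_⟩
  rintro ⟨a, i⟩ ⟨b, k⟩
  simp only [torusSOEven_coe, blockDiagonal_apply, Equiv.refl_apply]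
  by_cases hik : i = k
  · subst hik
    simp only [if_true, rot_flip]
  · simp [hik]

theorem SOOdd.exists_swap (σ : Equiv.Perm (Fin n)) :
    ∃ g : SOOdd n, ∀ z, torusSOOdd (z ∘ σ) = g * torusSOOdd z * g⁻¹ := by
  refine ⟨⟨signedPerm (Equiv.sumCongr (Equiv.prodCongr (Equiv.refl _) σ) (Equiv.refl _)) 1,
    signedPerm_mem (by simp [Equiv.Perm.sign_sumCongr, sign_prodCongr_refl])⟩,
    fun z => eq_mul_inv_of_mul_eq <| Subtype.ext <| signedPerm_conj_mul _ _ ?_⟩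
  rintro (⟨a, i⟩ | u) (⟨b, k⟩ | w) <;> simp [torusSOOdd_coe, blockDiagonal_apply]

/-- Here the extra coordinate absorbs the determinant, and every sign change is realized. -/
theorem SOOdd.exists_flip (ε : Fin n → ℤˣ) :
    ∃ g : SOOdd n, ∀ z, torusSOOdd (fun i => z i ^ (ε i : ℤ)) = g * torusSOOdd z * g⁻¹ := by
  refine ⟨⟨signedPerm (Equiv.refl _) (Sum.elim (fun x => (![1, ε x.2] : Fin 2 → ℤˣ) x.1)
    fun _ => ∏ i, ε i), signedPerm_mem (by simp [Fintype.prod_prod_type, Int.units_mul_self])⟩,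
    fun z => eq_mul_inv_of_mul_eq <| Subtype.ext <| signedPerm_conj_mul _ _ ?_⟩
  rintro (⟨a, i⟩ | u) (⟨b, k⟩ | w)
  · simp only [torusSOOdd_coe, fromBlocks_apply₁₁, blockDiagonal_apply, Equiv.refl_apply,
      Sum.elim_inl]
    by_cases hik : i = k
    · subst hik
      simp only [if_true, rot_flip]
    · simp [hik]
  · simp [torusSOOdd_coe]
  · simp [torusSOOdd_coe]
  · have h := Int.cast_units_mul_self (R := ℝ) (∏ i, ε i)
    simpa [torusSOOdd_coe] using h.symm

theorem commute_of_mul {A G : Type} [CommMonoid A] [Monoid G] {t : A → G}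
    (h : ∀ a b, t (a * b) = t a * t b) (a b : A) : Commute (t a) (t b) := by
  rw [Commute, SemiconjBy, ← h, ← h, mul_comm]

theorem isMaximalTorus_SOEven (hn : 0 < n) :
    IsMaximalTorus torusSOEven (fun z : Fin n → Circle => z) (simpleRootsD n) (stairs n) where
  commute := commute_of_mul torusSOEven_mul
  exists_conj := SOEven.exists_conj_torus hn
  cochar := ⟨fun w i => w ^ stairs n i, fun _ _ => rfl⟩
  nonneg α hα := by
    rw [← weightedSum_apply]
    exact weightedSum_simpleRootsD (fun i j hij => by simp only [stairs]; omega)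
      (fun i j _ _ => by simp only [stairs]; omega) α hα

theorem isMaximalTorus_SOOdd :
    IsMaximalTorus torusSOOdd (fun z : Fin n → Circle => z) (simpleRootsB n) (stairs n) where
  commute := commute_of_mul torusSOOdd_mul
  exists_conj := SOOdd.exists_conj_torus
  cochar := ⟨fun w i => w ^ stairs n i, fun _ _ => rfl⟩
  nonneg α hα := by
    rw [← weightedSum_apply]
    exact weightedSum_simpleRootsB (fun i j hij => by simp only [stairs]; omega)
      (fun i => by simp only [stairs]; omega) α hα

end OrthogonalWeyl

/-! ### The torus of the compact symplectic group and its Weyl group elements -/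

section QuaternionicTorus

open Matrix Quaternion

variable {n : ℕ}

theorem torusUSp_coe (z : Fin n → Circle) :
    (torusUSp z).1 = diagonal fun i => Quaternion.coeComplex (z i : ℂ) := rfl

theorem torusUSp_mul (z w : Fin n → Circle) : torusUSp (z * w) = torusUSp z * torusUSp w := by
  apply Subtype.ext
  rw [Submonoid.coe_mul, torusUSp_coe, torusUSp_coe, torusUSp_coe, diagonal_mul_diagonal]
  simp

/-- A real orthogonal matrix, as an element of `USp(n)`. -/
noncomputable def USp.ofOrthogonal (P : Matrix (Fin n) (Fin n) ℝ) (hP : Pᵀ * P = 1) : USp n :=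
  ⟨P.map (algebraMap ℝ ℍ[ℝ]), by
    have h : star (P.map (algebraMap ℝ ℍ[ℝ])) = Pᵀ.map (algebraMap ℝ ℍ[ℝ]) := by
      ext i j : 1
      simp [star_apply]
    rw [Unitary.mem_iff, h, ← Matrix.map_mul, ← Matrix.map_mul, hP, mul_eq_one_comm.1 hP]
    exact ⟨Matrix.map_one _ (map_zero _) (map_one _), Matrix.map_one _ (map_zero _) (map_one _)⟩⟩

/-- The diagonal matrix of `USp(n)` with coefficients the unit quaternions `q i`. -/
noncomputable def USp.diag (q : Fin n → unitary ℍ[ℝ]) : USp n :=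
  ⟨diagonal fun i => (q i : ℍ[ℝ]), by
    rw [Unitary.mem_iff, star_eq_conjTranspose, diagonal_conjTranspose, diagonal_mul_diagonal,
      diagonal_mul_diagonal, ← diagonal_one]
    exact ⟨congrArg diagonal (funext fun i => (Unitary.mem_iff.1 (q i).2).1),
      congrArg diagonal (funext fun i => (Unitary.mem_iff.1 (q i).2).2)⟩⟩

/-- The quaternion `c + s j`. -/
def Quaternion.reJ (c s : ℝ) : ℍ[ℝ] := ⟨c, 0, s, 0⟩

section

variable (c s : ℝ)

@[simp] theorem Quaternion.re_reJ : (Quaternion.reJ c s).re = c := rfl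

@[simp] theorem Quaternion.imI_reJ : (Quaternion.reJ c s).imI = 0 := rfl

@[simp] theorem Quaternion.imJ_reJ : (Quaternion.reJ c s).imJ = s := rfl

@[simp] theorem Quaternion.imK_reJ : (Quaternion.reJ c s).imK = 0 := rfl

end

theorem Quaternion.reJ_mem_unitary {c s : ℝ} (h : c ^ 2 + s ^ 2 = 1) :
    Quaternion.reJ c s ∈ unitary ℍ[ℝ] := by
  rw [Unitary.mem_iff]
  constructor <;> apply Quaternion.ext <;> simp <;> linarith

theorem USp.exists_swap (σ : Equiv.Perm (Fin n)) :
    ∃ g : USp n, ∀ z, torusUSp (z ∘ σ) = g * torusUSp z * g⁻¹ := by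
  have hP : (signedPerm σ 1)ᵀ * signedPerm σ 1 = 1 :=
    mul_eq_one_comm.1 (signedPerm_mul_transpose σ 1)
  refine ⟨USp.ofOrthogonal (signedPerm σ 1) hP, fun z => eq_mul_inv_of_mul_eq <| Subtype.ext ?_⟩
  change (torusUSp (z ∘ σ)).1 * (signedPerm σ 1).map (algebraMap ℝ ℍ[ℝ]) =
    (signedPerm σ 1).map (algebraMap ℝ ℍ[ℝ]) * (torusUSp z).1
  have h : (torusUSp (z ∘ σ)).1 = (signedPerm σ 1).map (algebraMap ℝ ℍ[ℝ]) * (torusUSp z).1 *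
      ((signedPerm σ 1).map (algebraMap ℝ ℍ[ℝ]))ᵀ := by
    refine Matrix.ext fun i k => ?_
    rw [signedPerm_map_conj, torusUSp_coe, torusUSp_coe, diagonal_apply, diagonal_apply]
    simp
  rw [h, Matrix.mul_assoc, ← transpose_map, ← Matrix.map_mul, hP,
    Matrix.map_one _ (map_zero _) (map_one _), Matrix.mul_one]

/-- Conjugation by the quaternion $\mathrm j$ is complex conjugation on $\mathbb C\subset\mathbb H$,
that is, inversion on the unit circle. -/
theorem USp.exists_flip (ε : Fin n → ℤˣ) :
    ∃ g : USp n, ∀ z, torusUSp (fun i => z i ^ (ε i : ℤ)) = g * torusUSp z * g⁻¹ := by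
  refine ⟨USp.diag fun i => if ε i = 1 then 1 else
    ⟨Quaternion.reJ 0 1, Quaternion.reJ_mem_unitary (by norm_num)⟩, fun z => eq_mul_inv_of_mul_eq <|
      Subtype.ext ?_⟩
  rw [Submonoid.coe_mul, Submonoid.coe_mul, torusUSp_coe, torusUSp_coe, USp.diag,
    diagonal_mul_diagonal, diagonal_mul_diagonal]
  congr 1
  funext i
  rcases Int.units_eq_one_or (ε i) with h | h
  · simp [h]
  · rw [h, if_neg (by decide)]
    simp only [Units.val_neg, Units.val_one, _root_.zpow_neg, zpow_one, Circle.coe_inv_eq_conj]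
    apply Quaternion.ext <;> simp

theorem isMaximalTorus_USp :
    IsMaximalTorus torusUSp (fun z : Fin n → Circle => z) (simpleRootsC n) (stairs n) where
  commute := commute_of_mul torusUSp_mul
  exists_conj := USp.exists_conj_torus
  cochar := ⟨fun w i => w ^ stairs n i, fun _ _ => rfl⟩
  nonneg α hα := by
    rw [← weightedSum_apply]
    exact weightedSum_simpleRootsC (fun i j hij => by simp only [stairs]; omega)
      (fun i => by simp only [stairs]; omega) α hα

end QuaternionicTorus

/-! ### The torus of the special unitary group and coordinate permutations -/

section UnitaryTorus

open Matrix

variable {n : ℕ}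

theorem torusSU_coe (z : SUTorus n) : (torusSU z).1 = diagonal fun i => (z.1 i : ℂ) := rfl

theorem commute_torusSU (z w : SUTorus n) : Commute (torusSU z) (torusSU w) := by
  apply Subtype.ext
  rw [Submonoid.coe_mul, Submonoid.coe_mul, torusSU_coe, torusSU_coe, diagonal_mul_diagonal,
    diagonal_mul_diagonal]
  simp only [mul_comm]

/-- A real special orthogonal matrix, as an element of `SU(n)`. -/
noncomputable def SUn.ofSO (P : specialOrthogonalGroup (Fin n) ℝ) : SUn n :=
  ⟨P.1.map (algebraMap ℝ ℂ), by
    obtain ⟨hP, hd⟩ := specialOrthogonalGroup_iff.1 P.2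
    have h : star (P.1.map (algebraMap ℝ ℂ)) = P.1ᵀ.map (algebraMap ℝ ℂ) := by
      ext i j : 1
      simp [star_apply]
    rw [mem_specialUnitaryGroup_iff, mem_unitaryGroup_iff, h, ← Matrix.map_mul,
      mul_eq_one_comm.1 hP, ← RingHom.mapMatrix_apply, ← RingHom.mapMatrix_apply,
      ← RingHom.map_det, hd]
    simp⟩

theorem exists_signedPerm_mem (σ : Equiv.Perm (Fin n)) :
    ∃ ε, signedPerm σ ε ∈ specialOrthogonalGroup (Fin n) ℝ := by
  rcases n with _ | n
  · exact ⟨1, signedPerm_mem (by rw [Subsingleton.elim σ 1]; simp)⟩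
  · exact ⟨_, signedPerm_mem (exists_prod_units_mul_eq_one _ 0)⟩

theorem SUn.exists_swap (σ : Equiv.Perm (Fin n)) :
    ∃ g : SUn n, ∀ z z' : SUTorus n, (∀ i, z'.1 i = z.1 (σ i)) →
      torusSU z' = g * torusSU z * g⁻¹ := by
  obtain ⟨ε, hε⟩ := exists_signedPerm_mem σ
  refine ⟨SUn.ofSO ⟨_, hε⟩, fun z z' hz => eq_mul_inv_of_mul_eq <| Subtype.ext ?_⟩
  change (torusSU z').1 * (signedPerm σ ε).map (algebraMap ℝ ℂ) =
    (signedPerm σ ε).map (algebraMap ℝ ℂ) * (torusSU z).1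
  have h : (torusSU z').1 = (signedPerm σ ε).map (algebraMap ℝ ℂ) * (torusSU z).1 *
      ((signedPerm σ ε).map (algebraMap ℝ ℂ))ᵀ := by
    refine Matrix.ext fun i k => ?_
    rw [signedPerm_map_conj, torusSU_coe, torusSU_coe, diagonal_apply, diagonal_apply]
    by_cases hik : i = k
    · subst hik
      rw [mul_right_comm, Int.cast_units_mul_self]
      simp [hz]
    · simp [hik]
  rw [h, Matrix.mul_assoc, ← transpose_map, ← Matrix.map_mul, (specialOrthogonalGroup_iff.1 hε).1]
  simp

theorem isMaximalTorus_SU :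
    IsMaximalTorus torusSU (fun z : SUTorus n => z.1) (simpleRootsA n) (centeredStairs n) where
  commute := commute_torusSU
  exists_conj := SUn.exists_conj_torus
  cochar := ⟨fun w => ⟨fun i => w ^ centeredStairs n i, by
    have (s : Finset (Fin n)) : ∏ i ∈ s, w ^ centeredStairs n i
        = w ^ ∑ i ∈ s, centeredStairs n i := by
      induction s using Finset.cons_induction with
      | empty => simp
      | cons a s ha ih => rw [Finset.sum_cons, Finset.prod_cons, _root_.zpow_add, ih]
    rw [this, sum_centeredStairs, zpow_zero]⟩, fun _ _ => rfl⟩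
  nonneg α hα := by
    rw [← weightedSum_apply]
    exact weightedSum_centeredStairs_nonneg α hα

end UnitaryTorus

/-! ### Characters of invariant subspaces -/

section HighestWeightCharacters

variable {G A V : Type} [Group G] [TopologicalSpace G] {n : ℕ} [AddCommGroup V] [Module ℂ V]

/-- The submodule `U` contains no proper nonzero submodule invariant under `ρ`. -/
def IrreducibleOn (ρ : Representation ℂ G V) (U : Submodule ℂ V) : Prop :=
  ∀ W ≤ U, W ≠ ⊥ → (∀ g, ∀ v ∈ W, ρ g v ∈ W) → U ≤ W

/-- The character of the subrepresentation `U` is written as a trace over the whole of `V`, with a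
projection inserted. Relations between characters then follow from relations between projections. -/
theorem isHighestWeightCharacter_of_isProj [TopologicalSpace V] [IsTopologicalAddGroup V]
    [ContinuousSMul ℂ V] [T2Space V] [FiniteDimensional ℂ V] {t : A → G} {z : A → Fin n → Circle}
    {P : Set (Fin n → ℤ)} {lam : Fin n → ℤ} (ρ : Representation ℂ G V)
    (hcont : ∀ v, Continuous fun g => ρ g v) {p : V →ₗ[ℂ] V} {U : Submodule ℂ V}
    (hp : LinearMap.IsProj U p) (hU : ∀ g, ∀ v ∈ U, ρ g v ∈ U) (hirr : IrreducibleOn ρ U)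
    (hw : ∃ v ∈ U, v ≠ 0 ∧ ∀ a, ρ (t a) v = torusChar z lam a • v)
    (hle : ∀ ω : A → ℂ, ∀ v ∈ U, v ≠ 0 → (∀ a, ρ (t a) v = ω a • v) →
      ∃ β ∈ AddSubmonoid.closure P, ∀ a, ω a * torusChar z β a = torusChar z lam a) :
    IsHighestWeightCharacter t z P lam fun g => LinearMap.trace ℂ V (ρ g ∘ₗ p) := by
  let b : U ≃ₗ[ℂ] (Fin (Module.finrank ℂ U) → ℂ) := (Module.finBasis ℂ U).equivFun
  let σ : Representation ℂ G (Fin (Module.finrank ℂ U) → ℂ) :=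
    { toFun := fun g => b.conj ((ρ g).restrict (hU g))
      map_one' := by
        have h : (ρ 1).restrict (hU 1) = LinearMap.id := by
          ext x
          simp
        rw [h, LinearEquiv.conj_id]
        rfl
      map_mul' := fun g h => by
        rw [Module.End.mul_eq_comp, ← LinearEquiv.conj_comp]
        congr 1
        ext x
        simp }
  have hσ (g w) : σ g w = b ⟨ρ g (b.symm w), hU g _ (b.symm w).2⟩ := rfl
  have hb (w) : ((b.symm w : U) : V) = 0 ↔ w = 0 := by
    rw [Submodule.coe_eq_zero, LinearEquiv.map_eq_zero_iff]
  refine ⟨_, σ, fun w => ?_, ?_, ⟨?_, fun ω hω => ?_⟩, fun g => ?_⟩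
  · have h1 : Continuous b := b.toLinearMap.continuous_of_finiteDimensional
    exact h1.comp ((hcont _).subtype_mk _)
  · have hnt : Nontrivial (Subrepresentation σ) := by
      obtain ⟨v, hvU, hv, -⟩ := hw
      refine ⟨⊥, ⊤, fun h => hv ?_⟩
      have h1 : b ⟨v, hvU⟩ ∈ (⊤ : Subrepresentation σ) := trivial
      rw [← h] at h1
      have h2 : b ⟨v, hvU⟩ = 0 := h1
      simpa using h2
    refine ⟨fun S => ?_⟩
    -- A subrepresentation of `σ`, carried back to `V`, is an invariant submodule of `U`, to which
    -- `hirr` applies.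
    let W : Submodule ℂ V := (S.toSubmodule.map b.symm.toLinearMap).map U.subtype
    have hWmem (w) : ((b.symm w : U) : V) ∈ W ↔ w ∈ S.toSubmodule := by
      simp only [W, Submodule.mem_map, Submodule.subtype_apply]
      constructor
      · rintro ⟨_, ⟨y, hy, rfl⟩, h⟩
        rwa [← b.symm.injective (Subtype.ext h)]
      · exact fun h => ⟨_, ⟨w, h, rfl⟩, rfl⟩
    by_cases hbot : W = ⊥
    · left
      refine SetLike.ext fun w => ?_
      have h1 := hWmem w
      rw [hbot, Submodule.mem_bot, hb] at h1
      exact h1.symm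
    · right
      have hUW := hirr W (Submodule.map_subtype_le _ _) hbot (by
        rintro g _ ⟨_, ⟨w, hw, rfl⟩, rfl⟩
        have h1 := (hWmem _).2 (S.apply_mem_toSubmodule g hw)
        rw [hσ, LinearEquiv.symm_apply_apply] at h1
        exact h1)
      refine SetLike.ext fun w => ?_
      have h1 := (hWmem w).1 (hUW (b.symm w).2)
      exact ⟨fun _ => trivial, fun _ => h1⟩
  · rw [weightSpace_ne_bot_iff]
    obtain ⟨v, hvU, hv, h⟩ := hw
    refine ⟨b ⟨v, hvU⟩, fun h0 => hv (by simpa using h0), fun a => ?_⟩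
    rw [hσ, ← map_smul]
    congr 1
    apply Subtype.ext
    simp [h]
  · rw [weightSpace_ne_bot_iff] at hω
    obtain ⟨w, hw, h⟩ := hω
    refine hle ω (b.symm w) (b.symm w).2 (fun h0 => hw ((hb w).1 h0)) fun a => ?_
    have h1 := congrArg (fun x => ((b.symm x : U) : V)) (h a)
    simpa [hσ] using h1
  · have h1 : LinearMap.trace ℂ _ (σ g) = LinearMap.trace ℂ U ((ρ g).restrict (hU g)) :=
      LinearMap.trace_conj' _ b
    -- By cyclicity of the trace, projecting to `U` before or after the inclusion and the action of
    -- `g` gives the same number.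
    let π : V →ₗ[ℂ] U := p.codRestrict U hp.map_mem
    have h2 : ρ g ∘ₗ p = (ρ g ∘ₗ U.subtype) ∘ₗ π := rfl
    have h3 : π ∘ₗ (ρ g ∘ₗ U.subtype) = (ρ g).restrict (hU g) := by
      ext x
      simp [π, hp.map_id _ (hU g x x.2)]
    beta_reduce
    rw [h1, h2, LinearMap.trace_comp_comm', h3]

end HighestWeightCharacters

/-! ### Tensor products realized on matrices, and their weights -/

section MatrixRepresentations

open Matrix

variable {G A ι : Type} [Group G] [Fintype ι] [DecidableEq ι] {n : ℕ}

/-- The representation on `ι → ℂ` attached to a homomorphism to matrices. -/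
def vecRep (τ : G →* Matrix ι ι ℂ) : Representation ℂ G (ι → ℂ) where
  toFun g := (τ g).mulVecLin
  map_one' := by simp; rfl
  map_mul' g h := by simp; rfl

/-- The tensor product of the representations attached to `τ₁` and `τ₂`, realized on matrices. -/
def tensorRep (τ₁ τ₂ : G →* Matrix ι ι ℂ) : Representation ℂ G (Matrix ι ι ℂ) where
  toFun g :=
    { toFun := fun M => τ₁ g * M * (τ₂ g)ᵀ
      map_add' := fun M N => by rw [Matrix.mul_add, Matrix.add_mul]
      map_smul' := fun c M => by simp }
  map_one' := by ext1 M; simp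
  map_mul' g h := by
    ext1 M
    simp [Matrix.mul_assoc]

variable {τ τ₁ τ₂ : G →* Matrix ι ι ℂ}

@[simp] theorem vecRep_apply (g : G) (v : ι → ℂ) : vecRep τ g v = τ g *ᵥ v := rfl

theorem tensorRep_apply (g : G) (M : Matrix ι ι ℂ) :
    tensorRep τ₁ τ₂ g M = τ₁ g * M * (τ₂ g)ᵀ := rfl

theorem tensorRep_vecMulVec (g : G) (u v : ι → ℂ) :
    tensorRep τ₁ τ₂ g (vecMulVec u v) = vecMulVec (τ₁ g *ᵥ u) (τ₂ g *ᵥ v) := by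
  rw [tensorRep_apply, mul_vecMulVec, vecMulVec_mul, vecMul_transpose]

theorem trace_vecRep (g : G) : LinearMap.trace ℂ _ (vecRep τ g) = (τ g).trace := by
  change LinearMap.trace ℂ _ (Matrix.toLin' (τ g)) = _
  exact Matrix.trace_toLin'_eq _

theorem trace_tensorRep (g : G) :
    LinearMap.trace ℂ _ (tensorRep τ₁ τ₂ g) = (τ₁ g).trace * (τ₂ g).trace := by
  rw [LinearMap.trace_eq_matrix_trace ℂ (Matrix.stdBasis ℂ ι ι)]
  simp only [Matrix.trace, diag_apply, LinearMap.toMatrix_apply, Fintype.sum_prod_type,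
    Finset.sum_mul_sum]
  refine Finset.sum_congr rfl fun k _ => Finset.sum_congr rfl fun l _ => ?_
  rw [Matrix.stdBasis_eq_single, tensorRep_apply]
  have h (M : Matrix ι ι ℂ) : (Matrix.stdBasis ℂ ι ι).repr M (k, l) = M k l := rfl
  rw [h, mul_apply, Finset.sum_eq_single l]
  · rw [mul_apply, Finset.sum_eq_single k] <;> simp +contextual [eq_comm]
  · intro j _ hj
    rw [mul_apply, Finset.sum_eq_zero, zero_mul]
    intro i _
    simp [hj.symm]
  · simp

theorem continuous_vecRep [TopologicalSpace G] (hτ : Continuous fun g => τ g) (v : ι → ℂ) :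
    Continuous fun g => vecRep τ g v :=
  hτ.matrix_mulVec continuous_const

theorem continuous_tensorRep [TopologicalSpace G] (h₁ : Continuous fun g => τ₁ g)
    (h₂ : Continuous fun g => τ₂ g)
    (M : Matrix ι ι ℂ) : Continuous fun g => tensorRep τ₁ τ₂ g M :=
  (h₁.matrix_mul continuous_const).matrix_mul h₂.matrix_transpose

/-- The torus `t` is diagonalized by the matrix `Φ`, with weights `wt k`. -/
structure Diagonalizes (t : A → G) (z : A → Fin n → Circle) (τ : G →* Matrix ι ι ℂ)
    (wt : ι → Fin n → ℤ) (Φ Ψ : Matrix ι ι ℂ) : Prop where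
  inv_mul : Ψ * Φ = 1
  mul_torus : ∀ a, Φ * τ (t a) = diagonal (fun k => torusChar z (wt k) a) * Φ

variable {t : A → G} {z : A → Fin n → Circle} {wt wt₁ wt₂ : ι → Fin n → ℤ}
  {Φ Ψ Φ₁ Ψ₁ Φ₂ Ψ₂ : Matrix ι ι ℂ}

theorem Diagonalizes.mul_inv (h : Diagonalizes t z τ wt Φ Ψ) : Φ * Ψ = 1 :=
  mul_eq_one_comm.1 h.inv_mul

theorem Diagonalizes.mulVec_col (h : Diagonalizes t z τ wt Φ Ψ) (a : A) (k : ι) :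
    τ (t a) *ᵥ Ψ.col k = torusChar z (wt k) a • Ψ.col k := by
  have h1 : τ (t a) * Ψ = Ψ * diagonal (fun k => torusChar z (wt k) a) := by
    calc τ (t a) * Ψ = Ψ * (Φ * τ (t a)) * Ψ := by
          rw [← Matrix.mul_assoc Ψ, h.inv_mul, Matrix.one_mul]
      _ = _ := by rw [h.mul_torus, Matrix.mul_assoc, Matrix.mul_assoc, h.mul_inv, Matrix.mul_one]
  funext x
  have h2 := congrFun (congrFun h1 x) k
  rw [mul_diagonal, mul_apply] at h2
  simpa [mulVec, dotProduct, mul_comm] using h2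

theorem Diagonalizes.col_ne_zero (h : Diagonalizes t z τ wt Φ Ψ) (k : ι) : Ψ.col k ≠ 0 := by
  intro h0
  have h1 := congrFun (congrFun h.mul_inv k) k
  rw [mul_apply, one_apply_eq, Finset.sum_eq_zero] at h1
  · exact zero_ne_one h1
  · intro j _
    have := congrFun h0 j
    rw [col_apply, Pi.zero_apply] at this
    rw [this, mul_zero]

/-- `Φ` carries the columns of `Ψ` to the standard basis, where the two rank-one matrices become
distinct matrix units. -/
theorem Diagonalizes.linearIndependent_col (h : Diagonalizes t z τ wt Φ Ψ) {k l : ι}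
    (hkl : k ≠ l) : vecMulVec (Ψ.col k) (Ψ.col l) - vecMulVec (Ψ.col l) (Ψ.col k) ≠ 0 := by
  intro h0
  have hcol (k l : ι) : Φ *ᵥ Ψ.col k = Pi.single k 1 := by
    have : Φ *ᵥ Ψ.col k = (Φ * Ψ).col k := rfl
    rw [this, h.mul_inv]
    ext x
    simp [one_apply, Pi.single_apply]
  have h1 := congrArg (fun M => Φ * M * Φᵀ) h0
  simp only [Matrix.mul_sub, Matrix.sub_mul, mul_vecMulVec, vecMulVec_mul, vecMul_transpose,
    hcol k l, hcol l k, Matrix.mul_zero, Matrix.zero_mul] at h1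
  have h2 := congrFun (congrFun h1 k) l
  simp [vecMulVec_apply, hkl] at h2

theorem Diagonalizes.exists_of_vecRep (h : Diagonalizes t z τ wt Φ Ψ) {ω : A → ℂ} {v : ι → ℂ}
    (hv : v ≠ 0) (hω : ∀ a, vecRep τ (t a) v = ω a • v) :
    ∃ k, ∀ a, ω a = torusChar z (wt k) a := by
  have h0 : Φ *ᵥ v ≠ 0 := fun h0 => hv <| by
    rw [← Matrix.one_mulVec v, ← h.inv_mul, ← mulVec_mulVec, h0, mulVec_zero]
  obtain ⟨k, hk⟩ := Function.ne_iff.1 h0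
  refine ⟨k, fun a => mul_right_cancel₀ hk ?_⟩
  have h1 : Φ *ᵥ (τ (t a) *ᵥ v) = ω a • (Φ *ᵥ v) := by
    rw [← mulVec_smul, ← hω, vecRep_apply]
  rw [mulVec_mulVec, h.mul_torus, ← mulVec_mulVec] at h1
  have h2 := congrFun h1 k
  rw [mulVec_diagonal] at h2
  exact h2.symm

/-- In the coordinates given by `Φ₁` and `Φ₂` the torus acts entrywise, so any non-zero entry
reveals the weight. The entry itself is recorded because for antisymmetric `M` it excludes `k = l`.
-/
theorem exists_of_tensorRep (h₁ : Diagonalizes t z τ₁ wt₁ Φ₁ Ψ₁)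
    (h₂ : Diagonalizes t z τ₂ wt₂ Φ₂ Ψ₂) {ω : A → ℂ} {M : Matrix ι ι ℂ} (hM : M ≠ 0)
    (hω : ∀ a, tensorRep τ₁ τ₂ (t a) M = ω a • M) :
    ∃ k l, (Φ₁ * M * Φ₂ᵀ) k l ≠ 0 ∧ ∀ a, ω a = torusChar z (wt₁ k + wt₂ l) a := by
  have h0 : Φ₁ * M * Φ₂ᵀ ≠ 0 := fun h0 => hM <| by
    calc M = Ψ₁ * Φ₁ * M * (Ψ₂ * Φ₂)ᵀ := by simp [h₁.inv_mul, h₂.inv_mul]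
      _ = Ψ₁ * (Φ₁ * M * Φ₂ᵀ) * Ψ₂ᵀ := by simp only [Matrix.mul_assoc, transpose_mul]
      _ = 0 := by simp [h0]
  obtain ⟨k, hk⟩ := Function.ne_iff.1 h0
  obtain ⟨l, hl⟩ := Function.ne_iff.1 hk
  refine ⟨k, l, hl, fun a => mul_right_cancel₀ hl ?_⟩
  have h1 : ω a • (Φ₁ * M * Φ₂ᵀ) = diagonal (fun k => torusChar z (wt₁ k) a) *
      (Φ₁ * M * Φ₂ᵀ) * diagonal (fun k => torusChar z (wt₂ k) a) := by
    calc ω a • (Φ₁ * M * Φ₂ᵀ) = Φ₁ * (ω a • M) * Φ₂ᵀ := by simp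
      _ = (Φ₁ * τ₁ (t a)) * M * (Φ₂ * τ₂ (t a))ᵀ := by
        rw [← hω, tensorRep_apply]; simp only [Matrix.mul_assoc, transpose_mul]
      _ = _ := by
        rw [h₁.mul_torus, h₂.mul_torus, transpose_mul, diagonal_transpose]
        simp only [Matrix.mul_assoc]
  have h2 := congrFun (congrFun h1 k) l
  rw [mul_diagonal, diagonal_mul, Matrix.smul_apply, smul_eq_mul] at h2
  rw [h2, torusChar_add]
  ring

end MatrixRepresentations

/-! ### The trivial character -/

section TrivialCharacter

theorem isHighestWeightCharacter_one {G A : Type} [Group G] [TopologicalSpace G] {n : ℕ} (t : A → G)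
    (z : A → Fin n → Circle) (P : Set (Fin n → ℤ)) :
    IsHighestWeightCharacter t z P 0 fun _ => 1 := by
  have h := isHighestWeightCharacter_of_isProj (t := t) (z := z) (P := P) (lam := 0)
    (Representation.trivial ℂ G ℂ) (fun v => by simpa using continuous_const) (p := LinearMap.id)
    (U := ⊤) ⟨fun x => trivial, fun x _ => rfl⟩ (fun _ _ _ => trivial)
    (fun W _ hW _ => ((eq_bot_or_eq_top W).resolve_left hW).ge)
    ⟨1, trivial, one_ne_zero, fun a => by simp [torusChar_zero]⟩ (fun ω v _ hv hω =>
      ⟨0, zero_mem _, fun a => by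
        have h1 := hω a
        rw [Representation.trivial_apply, smul_eq_mul] at h1
        rw [torusChar_zero, mul_one]
        exact (mul_right_cancel₀ hv (by rw [one_mul]; exact h1)).symm⟩)
  have h2 : (fun g : G => LinearMap.trace ℂ ℂ (Representation.trivial ℂ G ℂ g ∘ₗ LinearMap.id)) =
      fun _ => 1 := by
    funext g
    simp [Representation.trivial]
  rwa [h2] at h

end TrivialCharacter

/-! ### Splitting off the invariant line and the symmetric and antisymmetric parts -/

section TracelessMatrices

open Matrix

variable {ι : Type} [Fintype ι] {s : ℂ} {J K : Matrix ι ι ℂ}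

/-- The matrices `M` such that `Mᵀ = s M` and `tr (M K) = 0`. -/
def tracelessSub (s : ℂ) (K : Matrix ι ι ℂ) : Submodule ℂ (Matrix ι ι ℂ) where
  carrier := {M | Mᵀ = s • M ∧ (M * K).trace = 0}
  add_mem' {M N} hM hN := ⟨by rw [transpose_add, hM.1, hN.1, smul_add], by
    rw [Matrix.add_mul, trace_add, hM.2, hN.2, add_zero]⟩
  zero_mem' := by simp
  smul_mem' c M hM := ⟨by rw [transpose_smul, hM.1, smul_comm], by
    rw [Matrix.smul_mul, trace_smul, hM.2, smul_zero]⟩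

theorem mem_tracelessSub {M : Matrix ι ι ℂ} :
    M ∈ tracelessSub s K ↔ Mᵀ = s • M ∧ (M * K).trace = 0 := Iff.rfl

/-- The linear map `M ↦ (tr (M K) / tr (J K)) J`. -/
noncomputable def traceProj (J K : Matrix ι ι ℂ) : Matrix ι ι ℂ →ₗ[ℂ] Matrix ι ι ℂ where
  toFun M := ((M * K).trace / (J * K).trace) • J
  map_add' M N := by rw [Matrix.add_mul, trace_add, add_div, add_smul]
  map_smul' c M := by
    rw [Matrix.smul_mul, trace_smul, smul_eq_mul, mul_div_assoc, mul_smul, RingHom.id_apply]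

/-- The projection on the traceless matrices `M` such that `Mᵀ = s M`. -/
noncomputable def tracelessProj (s : ℂ) (J K : Matrix ι ι ℂ) :
    Matrix ι ι ℂ →ₗ[ℂ] Matrix ι ι ℂ where
  toFun M := (1 / 2 : ℂ) • (M - traceProj J K M + s • (M - traceProj J K M)ᵀ)
  map_add' M N := by
    simp only [map_add, transpose_add, transpose_sub, smul_sub, smul_add]
    abel
  map_smul' c M := by
    simp only [map_smul, transpose_smul, transpose_sub, smul_sub, smul_add, RingHom.id_apply,
      smul_comm c]

theorem traceProj_apply (J K M : Matrix ι ι ℂ) :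
    traceProj J K M = ((M * K).trace / (J * K).trace) • J := rfl

theorem tracelessProj_add (J K : Matrix ι ι ℂ) :
    tracelessProj 1 J K + tracelessProj (-1) J K + traceProj J K = LinearMap.id := by
  ext1 M
  simp only [LinearMap.add_apply, tracelessProj, LinearMap.coe_mk, AddHom.coe_mk,
      LinearMap.id_apply]
  module

theorem trace_sub_traceProj_mul (hJK : (J * K).trace ≠ 0) (M : Matrix ι ι ℂ) :
    ((M - traceProj J K M) * K).trace = 0 := by
  simp [traceProj, Matrix.sub_mul, hJK]

/-- The relation `hK` makes the condition $\operatorname{tr}(MK)=0$ stable under transposition,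
whether `K` is symmetric or antisymmetric. -/
theorem isProj_tracelessProj (hs : s * s = 1) (hJK : (J * K).trace ≠ 0) {c : ℂ}
    (hK : Kᵀ = c • K) : LinearMap.IsProj (tracelessSub s K) (tracelessProj s J K) where
  map_mem M := by
    set N := M - traceProj J K M with hN
    have h1 : (N * K).trace = 0 := trace_sub_traceProj_mul hJK M
    have h2 : (Nᵀ * K).trace = 0 := by
      rw [← trace_transpose, transpose_mul, transpose_transpose, hK, Matrix.smul_mul, trace_smul,
        trace_mul_comm, h1, smul_zero]
    have h3 : tracelessProj s J K M = (1 / 2 : ℂ) • (N + s • Nᵀ) := rfl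
    rw [mem_tracelessSub, h3]
    constructor
    · rw [transpose_smul, transpose_add, transpose_smul, transpose_transpose, smul_comm, smul_add s,
        smul_smul, hs, one_smul, add_comm]
    · rw [Matrix.smul_mul, Matrix.add_mul, Matrix.smul_mul, trace_smul, trace_add, trace_smul, h1,
        h2]
      simp
  map_id M hM := by
    have h3 : tracelessProj s J K M = (1 / 2 : ℂ) • (M - traceProj J K M +
      s • (M - traceProj J K M)ᵀ) := rfl
    have h4 : traceProj J K M = 0 := by
      rw [traceProj_apply, hM.2, zero_div, zero_smul]
    rw [h3, h4, sub_zero, hM.1, smul_smul, hs]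
    module

/-- `f ∘ₗ traceProj J K` is a rank-one operator with image spanned by the fixed vector `J`. This is
how the trivial character enters the decomposition. -/
theorem trace_comp_traceProj (hJK : (J * K).trace ≠ 0) {f : Matrix ι ι ℂ →ₗ[ℂ] Matrix ι ι ℂ}
    (hf : f J = J) : LinearMap.trace ℂ _ (f ∘ₗ traceProj J K) = 1 := by
  classical
  let φ : Matrix ι ι ℂ →ₗ[ℂ] ℂ := ((J * K).trace)⁻¹ • (traceLinearMap ι ℂ ℂ ∘ₗ
    LinearMap.mulRight ℂ K)
  have hφ (M) : φ M = ((J * K).trace)⁻¹ * (M * K).trace := rfl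
  have h1 : f ∘ₗ traceProj J K = (LinearMap.toSpanSingleton ℂ _ J) ∘ₗ φ := by
    ext1 M
    simp only [LinearMap.comp_apply, LinearMap.toSpanSingleton_apply, hφ]
    rw [traceProj_apply, map_smul, hf, div_eq_inv_mul]
  rw [h1, LinearMap.trace_comp_comm']
  have h2 : φ ∘ₗ LinearMap.toSpanSingleton ℂ _ J = LinearMap.id := by
    ext
    simp [hφ, hJK]
  rw [h2, LinearMap.trace_id]
  simp

variable {G : Type} [Group G] [DecidableEq ι] {τ₁ τ₂ : G →* Matrix ι ι ℂ}

theorem tensorRep_mem_tracelessSub {τ : G →* Matrix ι ι ℂ} (hK : ∀ g, (τ g)ᵀ * K * τ g = K) (g : G)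
    {M : Matrix ι ι ℂ} (hM : M ∈ tracelessSub s K) :
    tensorRep τ τ g M ∈ tracelessSub s K := by
  rw [mem_tracelessSub, tensorRep_apply]
  constructor
  · rw [transpose_mul, transpose_mul, transpose_transpose, hM.1]
    simp [Matrix.mul_assoc]
  · rw [Matrix.mul_assoc, Matrix.mul_assoc, trace_mul_comm, ← hM.2]
    nth_rw 2 [← hK g]
    simp only [Matrix.mul_assoc]

end TracelessMatrices

/-! ### The square of the standard character, for all groups with an invariant form -/

section SquareOfStandardCharacter

open Matrix

variable {G ι : Type} [Group G] [Fintype ι] [DecidableEq ι] {n : ℕ}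

theorem tensorRep_eigen {A : Type} {t : A → G} {z : A → Fin n → Circle} {τ₁ τ₂ : G →* Matrix ι ι ℂ}
    {u v : ι → ℂ} {μ ν : Fin n → ℤ} (hu : ∀ a, τ₁ (t a) *ᵥ u = torusChar z μ a • u)
    (hv : ∀ a, τ₂ (t a) *ᵥ v = torusChar z ν a • v) (a : A) :
    tensorRep τ₁ τ₂ (t a) (vecMulVec u v) = torusChar z (μ + ν) a • vecMulVec u v := by
  rw [tensorRep_vecMulVec, hu, hv, smul_vecMulVec, vecMulVec_smul, smul_smul, torusChar_add]

/-- The linear form $M\mapsto\operatorname{tr}(MK)$ is invariant, so it vanishes on vectors of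
non-zero weight. Candidate highest weight vectors are therefore traceless. -/
theorem trace_mul_eq_zero_of_eigen {t : (Fin n → Circle) → G} {τ : G →* Matrix ι ι ℂ}
    {K M : Matrix ι ι ℂ} (hK : ∀ g, (τ g)ᵀ * K * τ g = K) {μ : Fin n → ℤ} (hμ : μ ≠ 0)
    (hM : ∀ a, tensorRep τ τ (t a) M = torusChar (fun z => z) μ a • M) :
    (M * K).trace = 0 := by
  by_contra h0
  refine hμ (torusChar_injective fun a => ?_)
  have h1 : (tensorRep τ τ (t a) M * K).trace = (M * K).trace := by
    rw [tensorRep_apply, Matrix.mul_assoc, Matrix.mul_assoc, trace_mul_comm]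
    nth_rw 2 [← hK (t a)]
    simp only [Matrix.mul_assoc]
  rw [hM, Matrix.smul_mul, trace_smul, smul_eq_mul] at h1
  rw [torusChar_zero]
  exact mul_right_cancel₀ h0 (by rw [h1, one_mul])

/-- The common argument for $\mathrm{SO}(2n)$, $\mathrm{SO}(2n+1)$ and $\mathrm{USp}(n)$. With `k₀`
and `k₁` the two highest weights of the standard representation, the squares have top weight `wt k₀
+ wt k₀` and the antisymmetric part `wt k₀ + wt k₁`; all four small labels are thus realized, as the
uniqueness theorem requires. -/
theorem standard_character_sq [TopologicalSpace G] {τ : G →* Matrix ι ι ℂ}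
    (hτ : Continuous fun g => τ g)
    {t : (Fin n → Circle) → G} {P : Set (Fin n → ℤ)} (hn : 2 ≤ n)
    (hT : IsMaximalTorus t (fun z => z) P (stairs n))
    (hδ : IsDominantList t (fun z => z) P (smallLabels n))
    {wt : ι → Fin n → ℤ} {Φ Ψ : Matrix ι ι ℂ} (hD : Diagonalizes t (fun z => z) τ wt Φ Ψ)
    {k₀ k₁ : ι} (h01 : k₀ ≠ k₁) (hk₀ : wt k₀ = hookLabel n 1 0)
    (hk₁ : wt k₀ + wt k₁ = twoOnesLabel n)
    (hle₀ : ∀ k, wt k₀ - wt k ∈ AddSubmonoid.closure P)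
    (hle₁ : ∀ k ≠ k₀, wt k₁ - wt k ∈ AddSubmonoid.closure P)
    {J K : Matrix ι ι ℂ} (hJK : (J * K).trace ≠ 0) {c : ℂ} (hKt : Kᵀ = c • K)
    (hJ : ∀ g, τ g * J * (τ g)ᵀ = J) (hK : ∀ g, (τ g)ᵀ * K * τ g = K)
    (hreal : ∀ g, (τ g).trace.im = 0) (hirr : IrreducibleOn (vecRep τ) ⊤)
    (hirr₁ : IrreducibleOn (tensorRep τ τ) (tracelessSub 1 K))
    (hirr₂ : IrreducibleOn (tensorRep τ τ) (tracelessSub (-1) K)) :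
    (∃! χ, IsHighestWeightCharacter t (fun z => z) P (hookLabel n 1 0) χ) ∧
    (∃! χ, IsHighestWeightCharacter t (fun z => z) P (hookLabel n 2 0) χ) ∧
    (∃! χ, IsHighestWeightCharacter t (fun z => z) P (twoOnesLabel n) χ) ∧
    (∃! χ, IsHighestWeightCharacter t (fun z => z) P 0 χ) ∧
    ∀ χ₁ χ₂ χ₁₁ χ₀ : G → ℂ,
      IsHighestWeightCharacter t (fun z => z) P (hookLabel n 1 0) χ₁ →
      IsHighestWeightCharacter t (fun z => z) P (hookLabel n 2 0) χ₂ →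
      IsHighestWeightCharacter t (fun z => z) P (twoOnesLabel n) χ₁₁ →
      IsHighestWeightCharacter t (fun z => z) P 0 χ₀ →
      ∀ g, (χ₁ g).im = 0 ∧ χ₀ g = 1 ∧ χ₁ g ^ 2 = χ₂ g + χ₁₁ g + χ₀ g := by
  have hk₂ : wt k₀ + wt k₀ = hookLabel n 2 0 := by
    rw [hk₀]
    funext i
    simp only [Pi.add_apply, hookLabel]
    split_ifs <;> simp
  have hval (f : Fin n → ℤ) (h : f ⟨0, by omega⟩ ≠ 0) : f ≠ 0 := fun h0 => h (by rw [h0]; rfl)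
  have hc₁ : IsHighestWeightCharacter t (fun z => z) P (hookLabel n 1 0) fun g => (τ g).trace := by
    have h := isHighestWeightCharacter_of_isProj (t := t) (z := fun z => z) (P := P)
      (lam := hookLabel n 1 0) (vecRep τ) (continuous_vecRep hτ) (p := LinearMap.id) (U := ⊤)
      ⟨fun x => trivial, fun x _ => rfl⟩ (fun _ _ _ => trivial) hirr
      ⟨_, trivial, hD.col_ne_zero k₀, hk₀ ▸ fun a => hD.mulVec_col a k₀⟩
      (fun ω v _ hv hω => by
        obtain ⟨k, hk⟩ := hD.exists_of_vecRep hv hω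
        exact ⟨_, hle₀ k, fun a => by rw [hk, ← torusChar_add, ← hk₀, add_sub_cancel]⟩)
    simpa only [LinearMap.comp_id, trace_vecRep] using h
  have hc₂ := isHighestWeightCharacter_of_isProj (t := t) (z := fun z => z) (P := P)
    (lam := hookLabel n 2 0) (tensorRep τ τ) (continuous_tensorRep hτ hτ)
    (isProj_tracelessProj (by norm_num) hJK hKt)
    (fun g M hM => tensorRep_mem_tracelessSub hK g hM) hirr₁
    (by
      have he := tensorRep_eigen (fun a => hD.mulVec_col a k₀) (fun a => hD.mulVec_col a k₀)
      refine ⟨_, ⟨?_, trace_mul_eq_zero_of_eigen hK ?_ he⟩, ?_, hk₂ ▸ he⟩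
      · rw [transpose_vecMulVec, one_smul]
      · rw [hk₂]
        exact hval _ (by simp [hookLabel])
      · exact vecMulVec_ne_zero (hD.col_ne_zero _) (hD.col_ne_zero _))
    (fun ω M _ hM hω => by
      obtain ⟨k, l, -, h⟩ := exists_of_tensorRep hD hD hM hω
      refine ⟨_, add_mem (hle₀ k) (hle₀ l), fun a => ?_⟩
      rw [h, ← torusChar_add, ← hk₂]
      congr 1
      abel)
  have hc₁₁ := isHighestWeightCharacter_of_isProj (t := t) (z := fun z => z) (P := P)
    (lam := twoOnesLabel n) (tensorRep τ τ) (continuous_tensorRep hτ hτ)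
    (isProj_tracelessProj (by norm_num) hJK hKt)
    (fun g M hM => tensorRep_mem_tracelessSub hK g hM) hirr₂
    (by
      have he (a : Fin n → Circle) : tensorRep τ τ (t a) (vecMulVec (Ψ.col k₀) (Ψ.col k₁) -
          vecMulVec (Ψ.col k₁) (Ψ.col k₀)) = torusChar (fun z => z) (wt k₀ + wt k₁) a •
          (vecMulVec (Ψ.col k₀) (Ψ.col k₁) - vecMulVec (Ψ.col k₁) (Ψ.col k₀)) := by
        rw [map_sub, tensorRep_eigen (fun a => hD.mulVec_col a k₀) (fun a => hD.mulVec_col a k₁),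
          tensorRep_eigen (fun a => hD.mulVec_col a k₁) (fun a => hD.mulVec_col a k₀),
          add_comm (wt k₁), smul_sub]
      refine ⟨_, ⟨?_, trace_mul_eq_zero_of_eigen hK ?_ he⟩, ?_, hk₁ ▸ he⟩
      · rw [transpose_sub, transpose_vecMulVec, transpose_vecMulVec, neg_one_smul, neg_sub]
      · rw [hk₁]
        exact hval _ (by simp [twoOnesLabel])
      · exact hD.linearIndependent_col h01)
    (fun ω M hMU hM hω => by
      obtain ⟨k, l, hkl, h⟩ := exists_of_tensorRep hD hD hM hω
      -- Antisymmetry persists in the coordinates `Φ`, so the diagonal vanishes and the weight is a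
      -- sum over two distinct indices.
      have hne : k ≠ l := by
        rintro rfl
        have h1 : (Φ * M * Φᵀ)ᵀ = - (Φ * M * Φᵀ) := by
          rw [transpose_mul, transpose_mul, transpose_transpose, hMU.1]
          simp [Matrix.mul_assoc]
        have h2 := congrFun (congrFun h1 k) k
        rw [transpose_apply, Matrix.neg_apply] at h2
        exact hkl (self_eq_neg.1 h2)
      -- At least one of the two distinct indices is not `k₀`; that one is compared with `k₁` and
      -- the other with `k₀`.
      have key : ∃ β ∈ AddSubmonoid.closure P, wt k + wt l + β = wt k₀ + wt k₁ := by
        by_cases hk : k = k₀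
        · refine ⟨_, hle₁ l (fun h => hne (hk.trans h.symm)), ?_⟩
          rw [hk]
          abel
        · refine ⟨_, add_mem (hle₁ k hk) (hle₀ l), ?_⟩
          abel
      obtain ⟨β, hβ, he⟩ := key
      exact ⟨β, hβ, fun a => by rw [h, ← torusChar_add, he, hk₁]⟩)
  set f₂ := fun g => LinearMap.trace ℂ _ (tensorRep τ τ g ∘ₗ tracelessProj 1 J K) with hf₂
  set f₁₁ := fun g => LinearMap.trace ℂ _ (tensorRep τ τ g ∘ₗ tracelessProj (-1) J K) with hf₁₁
  have hsum (g : G) : (τ g).trace ^ 2 = f₂ g + f₁₁ g + 1 := by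
    rw [hf₂, hf₁₁]
    beta_reduce
    have h := congrArg (fun f => LinearMap.trace ℂ _ (tensorRep τ τ g ∘ₗ f)) (tracelessProj_add J K)
    simp only [LinearMap.comp_add, map_add, LinearMap.comp_id, trace_tensorRep,
      trace_comp_traceProj hJK (f := tensorRep τ τ g) (hJ g)] at h
    rw [h, sq]
  have hall : ∀ i, IsHighestWeightCharacter t (fun z => z) P (smallLabels n i)
      ((![fun _ => 1, fun g => (τ g).trace, f₂, f₁₁] : Fin 4 → G → ℂ) i) := by
    intro i
    fin_cases i
    exacts [isHighestWeightCharacter_one t _ P, hc₁, hc₂, hc₁₁]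
  have huniq {i : Fin 4} {χ'} (h : IsHighestWeightCharacter t (fun z => z) P (smallLabels n i)
      χ') :=
    hT.eq_of_isHighestWeightCharacter hδ (injective_weightedSum_smallLabels hn) hall h
  refine ⟨⟨_, hc₁, fun χ h => huniq (i := 1) h⟩, ⟨_, hc₂, fun χ h => huniq (i := 2) h⟩,
    ⟨_, hc₁₁, fun χ h => huniq (i := 3) h⟩,
    ⟨_, isHighestWeightCharacter_one t _ P, fun χ h => huniq (i := 0) h⟩,
    fun χ₁ χ₂ χ₁₁ χ₀ h₁ h₂ h₁₁ h₀ g => ?_⟩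
  rw [huniq (i := 1) h₁, huniq (i := 2) h₂, huniq (i := 3) h₁₁, huniq (i := 0) h₀]
  exact ⟨hreal g, rfl, hsum g⟩

end SquareOfStandardCharacter

/-! ### Positive roots as sums of simple roots -/

section PositiveRoots

variable {n : ℕ}

theorem single_sub_single_mem_closure {i j : Fin n} (hij : i ≤ j) :
    (Pi.single i 1 - Pi.single j 1 : Fin n → ℤ) ∈ AddSubmonoid.closure (simpleRootsA n) := by
  obtain ⟨i, hi⟩ := i
  obtain ⟨j, hj⟩ := j
  rw [Fin.mk_le_mk] at hij
  induction j, hij using Nat.le_induction with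
  | base => simp
  | succ j hij ih =>
    have h1 := ih (by omega)
    have h2 := AddSubmonoid.subset_closure (s := simpleRootsA n)
      (⟨⟨j, by omega⟩, ⟨j + 1, hj⟩, rfl, rfl⟩ :
        Pi.single ⟨j, by omega⟩ 1 - Pi.single ⟨j + 1, hj⟩ 1 ∈ simpleRootsA n)
    have h3 := add_mem h1 h2
    rwa [sub_add_sub_cancel] at h3

theorem single_mem_closure_simpleRootsB (i : Fin n) :
    (Pi.single i 1 : Fin n → ℤ) ∈ AddSubmonoid.closure (simpleRootsB n) := by
  have hi := i.2
  have h1 := AddSubmonoid.closure_mono (t := simpleRootsB n) (fun _ => Or.inl)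
      (single_sub_single_mem_closure
    (show i ≤ (⟨n - 1, by omega⟩ : Fin n) by rw [Fin.le_def]; simp only; omega))
  have h2 := AddSubmonoid.subset_closure (s := simpleRootsB n)
    (Or.inr ⟨⟨n - 1, by omega⟩, by simp only; omega, rfl⟩)
  have h3 := add_mem h1 h2
  rwa [sub_add_cancel] at h3

theorem single_add_single_mem_closure_simpleRootsC (i j : Fin n) :
    (Pi.single i 1 + Pi.single j 1 : Fin n → ℤ) ∈ AddSubmonoid.closure (simpleRootsC n) := by
  have key (i : Fin n) := AddSubmonoid.closure_mono (t := simpleRootsC n) (fun _ => Or.inl)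
    (single_sub_single_mem_closure
      (show i ≤ (⟨n - 1, by have := i.2; omega⟩ : Fin n) by
        rw [Fin.le_def]; have := i.2; simp only; omega))
  have h2 := AddSubmonoid.subset_closure (s := simpleRootsC n)
    (Or.inr ⟨⟨n - 1, by have := i.2; omega⟩, by have := i.2; simp only; omega, rfl⟩)
  have h3 := add_mem (add_mem (key i) (key j)) h2
  have h4 : (Pi.single ⟨n - 1, by have := i.2; omega⟩ 2 : Fin n → ℤ) =
      Pi.single ⟨n - 1, by have := i.2; omega⟩ 1 + Pi.single ⟨n - 1, by have := i.2; omega⟩ 1 := by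
    rw [← Pi.single_add]
    rfl
  rw [h4] at h3
  convert h3 using 1
  abel

theorem single_add_single_mem_closure_simpleRootsD {i j : Fin n} (hij : i < j) :
    (Pi.single i 1 + Pi.single j 1 : Fin n → ℤ) ∈ AddSubmonoid.closure (simpleRootsD n) := by
  have hj := j.2
  rw [Fin.lt_def] at hij
  have h0 := AddSubmonoid.closure_mono (t := simpleRootsD n) (fun _ => Or.inl)
      (single_sub_single_mem_closure
    (show i ≤ (⟨n - 2, by omega⟩ : Fin n) by rw [Fin.le_def]; simp only; omega))
  have h1 := AddSubmonoid.closure_mono (t := simpleRootsD n) (fun _ => Or.inl)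
      (single_sub_single_mem_closure
    (show j ≤ (⟨n - 1, by omega⟩ : Fin n) by rw [Fin.le_def]; simp only; omega))
  have h2 := AddSubmonoid.subset_closure (s := simpleRootsD n)
    (Or.inr ⟨⟨n - 2, by omega⟩, ⟨n - 1, by omega⟩, by simp only; omega, by simp only; omega, rfl⟩)
  have h3 := add_mem (add_mem h0 h1) h2
  convert h3 using 1
  abel

/-- $2e^i=(e^i-e^n)+(e^i+e^n)$, a sum of two positive roots as long as $i$ is not the last index. -/
theorem single_add_self_mem_closure_simpleRootsD {i : Fin n} (hi : (i : ℕ) + 1 < n) :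
    (Pi.single i 1 + Pi.single i 1 : Fin n → ℤ) ∈ AddSubmonoid.closure (simpleRootsD n) := by
  have hlt : i < (⟨n - 1, by omega⟩ : Fin n) := by rw [Fin.lt_def]; simp only; omega
  have h0 := AddSubmonoid.closure_mono (t := simpleRootsD n) (fun _ => Or.inl)
    (single_sub_single_mem_closure hlt.le)
  have h3 := add_mem h0 (single_add_single_mem_closure_simpleRootsD hlt)
  convert h3 using 1
  abel

end PositiveRoots

/-! ### Isolating coordinates inside an invariant subspace -/

section DiagonalStability

/-- If `W` is stable under operators `T d` that are diagonal in the coordinates `e x`, it contains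
the restriction of its elements to a set of coordinates that the operators do not distinguish. -/
theorem Submodule.mem_of_diagonal_stable {V X D : Type} [AddCommGroup V] [Module ℂ V] [Finite X]
    {e : X → V →ₗ[ℂ] ℂ} (he : ∀ v, (∀ x, e x v = 0) → v = 0) {T : D → V → V} {d : D → X → ℂ}
    (hT : ∀ i x v, e x (T i v) = d i x * e x v) {W : Submodule ℂ V}
    (hW : ∀ i, ∀ v ∈ W, T i v ∈ W) (x₀ : X) {v w : V} (hv : v ∈ W)
    (hw : ∀ x, (∀ i, d i x = d i x₀) → e x w = e x v)
    (hw' : ∀ x, (∃ i, d i x ≠ d i x₀) → e x w = 0) : w ∈ W := by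
  have := Fintype.ofFinite X
  have key (s : Finset X) : ∃ u ∈ W, (∀ x, (∀ i, d i x = d i x₀) → e x u = e x v) ∧
      ∀ x ∈ s, (∃ i, d i x ≠ d i x₀) → e x u = 0 := by
    classical
    induction s using Finset.induction_on with
    | empty => exact ⟨v, hv, fun _ _ => rfl, fun _ h => absurd h (Finset.notMem_empty _)⟩
    | insert x s hx ih =>
      obtain ⟨u, hu, h1, h2⟩ := ih
      by_cases hxc : ∃ i, d i x ≠ d i x₀
      · obtain ⟨i, hi⟩ := hxc
        -- A Lagrange interpolation factor: it kills the coordinate `x` and leaves unchanged those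
        -- that the operators do not distinguish from `x₀`.
        refine ⟨(d i x₀ - d i x)⁻¹ • (T i u - d i x • u),
          W.smul_mem _ (W.sub_mem (hW i u hu) (W.smul_mem _ hu)), fun y hy => ?_, fun y hy hyc
              => ?_⟩
        · simp only [map_smul, map_sub, hT, smul_eq_mul, hy i, ← h1 y hy]
          have : d i x₀ - d i x ≠ 0 := sub_ne_zero.2 (Ne.symm hi)
          field_simp
        · simp only [map_smul, map_sub, hT, smul_eq_mul]
          rcases Finset.mem_insert.1 hy with rfl | hy
          · simp
          · simp [h2 y hy hyc]
      · refine ⟨u, hu, h1, fun y hy hyc => ?_⟩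
        rcases Finset.mem_insert.1 hy with rfl | hy
        · exact absurd hyc hxc
        · exact h2 y hy hyc
  obtain ⟨u, hu, h1, h2⟩ := key Finset.univ
  have : w = u := sub_eq_zero.1 <| he _ fun x => by
    rw [map_sub, sub_eq_zero]
    by_cases hx : ∃ i, d i x ≠ d i x₀
    · rw [hw' x hx, h2 x (Finset.mem_univ x) hx]
    · push Not at hx
      rw [hw x hx, h1 x hx]
  rwa [this]

end DiagonalStability

/-! ### Explicit rotations and signed permutations -/

section SpecialOrthogonalMoves

open Matrix

variable {ι : Type} [Fintype ι] [DecidableEq ι]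

theorem signedPerm_map_mulVec_single (σ : Equiv.Perm ι) (ε : ι → ℤˣ) (x : ι) :
    (signedPerm σ ε).map (algebraMap ℝ ℂ) *ᵥ Pi.single (σ x) 1 =
      ((ε x : ℤ) : ℂ) • Pi.single x 1 := by
  funext y
  rw [mulVec_single_one]
  by_cases h : x = y
  · subst h
    simp [signedPerm]
  · simp [signedPerm, Ne.symm h]

theorem exists_perm_pair {ι : Type} [DecidableEq ι] {k l x y : ι} (hkl : k ≠ l) (hxy : x ≠ y) :
    ∃ σ : Equiv.Perm ι, σ x = k ∧ σ y = l := by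
  refine ⟨Equiv.swap (Equiv.swap x k y) l * Equiv.swap x k, ?_, ?_⟩
  · rw [Equiv.Perm.mul_apply, Equiv.swap_apply_left, Equiv.swap_apply_of_ne_of_ne _ hkl]
    intro h
    have h1 : Equiv.swap x k x = Equiv.swap x k y := by rw [Equiv.swap_apply_left, ← h]
    exact hxy ((Equiv.swap x k).injective h1)
  · rw [Equiv.Perm.mul_apply, Equiv.swap_apply_left]

theorem exists_specialOrthogonal_pair {k l x y : ι} (hkl : k ≠ l) (hxy : x ≠ y) :
    ∃ (g : specialOrthogonalGroup ι ℝ) (u v : ℤˣ),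
      g.1.map (algebraMap ℝ ℂ) *ᵥ Pi.single k 1 = ((u : ℤ) : ℂ) • Pi.single x 1 ∧
      g.1.map (algebraMap ℝ ℂ) *ᵥ Pi.single l 1 = ((v : ℤ) : ℂ) • Pi.single y 1 := by
  obtain ⟨σ, rfl, rfl⟩ := exists_perm_pair hkl hxy
  have : Nonempty ι := ⟨x⟩
  exact ⟨⟨signedPerm σ _, signedPerm_mem (exists_prod_units_mul_eq_one _ x)⟩, _, _,
    signedPerm_map_mulVec_single σ _ x, signedPerm_map_mulVec_single σ _ y⟩

/-- The orthogonal reflection of vector `u`. -/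
noncomputable def reflectionMatrix (u : ι → ℝ) : Matrix ι ι ℝ :=
  1 - (2 / (u ⬝ᵥ u)) • vecMulVec u u

theorem reflectionMatrix_mulVec (u v : ι → ℝ) :
    reflectionMatrix u *ᵥ v = v - (2 / (u ⬝ᵥ u) * (u ⬝ᵥ v)) • u := by
  rw [reflectionMatrix, sub_mulVec, one_mulVec, smul_mulVec, vecMulVec_mulVec, op_smul_eq_smul,
    smul_smul]

theorem transpose_reflectionMatrix (u : ι → ℝ) : (reflectionMatrix u)ᵀ = reflectionMatrix u := by
  rw [reflectionMatrix, transpose_sub, transpose_one, transpose_smul, transpose_vecMulVec]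

theorem reflectionMatrix_mul_self {u : ι → ℝ} (hu : u ⬝ᵥ u ≠ 0) :
    reflectionMatrix u * reflectionMatrix u = 1 := by
  refine ext_of_mulVec_single fun i => ?_
  rw [← mulVec_mulVec, reflectionMatrix_mulVec, reflectionMatrix_mulVec, one_mulVec,
    dotProduct_sub, dotProduct_smul, smul_eq_mul]
  have : 2 / u ⬝ᵥ u * (u ⬝ᵥ Pi.single i 1 - 2 / u ⬝ᵥ u * u ⬝ᵥ Pi.single i 1 * u ⬝ᵥ u) =
      - (2 / u ⬝ᵥ u * u ⬝ᵥ Pi.single i 1) := by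
    field_simp
    ring
  rw [this]
  module

theorem det_reflectionMatrix {u : ι → ℝ} (hu : u ⬝ᵥ u ≠ 0) : (reflectionMatrix u).det = -1 := by
  have h : reflectionMatrix u = 1 + replicateCol Unit (-(2 / (u ⬝ᵥ u)) • u) * replicateRow Unit
      u := by
    rw [reflectionMatrix, ← vecMulVec_eq, smul_vecMulVec, neg_smul, sub_eq_add_neg]
  rw [h, det_one_add_replicateCol_mul_replicateRow, dotProduct_smul, smul_eq_mul]
  field_simp
  norm_num

/-- A rational rotation that mixes two coordinate axes; the irreducibility proofs use it to pass
between diagonal and off-diagonal matrix units. -/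
theorem exists_specialOrthogonal_rotation {k l : ι} (hkl : k ≠ l) :
    ∃ g : specialOrthogonalGroup ι ℝ,
      g.1.map (algebraMap ℝ ℂ) *ᵥ Pi.single k 1 =
        (-3 / 5 : ℂ) • Pi.single k 1 + (4 / 5 : ℂ) • Pi.single l 1 ∧
      g.1.map (algebraMap ℝ ℂ) *ᵥ Pi.single l 1 =
        (-4 / 5 : ℂ) • Pi.single k 1 + (-3 / 5 : ℂ) • Pi.single l 1 := by
  -- The product of the reflections in $(1,2)$ and $(1,0)$ has determinant $1$, cosine $-3/5$ and
  -- sine $4/5$.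
  let u : ι → ℝ := Pi.single k 1 + (2 : ℝ) • Pi.single l 1
  let v : ι → ℝ := Pi.single k 1
  have hu : u ⬝ᵥ u = 5 := by
    simp [u, hkl, hkl.symm]
    norm_num
  have hv : v ⬝ᵥ v = 1 := by simp [v]
  have hu0 : u ⬝ᵥ u ≠ 0 := by rw [hu]; norm_num
  have hv0 : v ⬝ᵥ v ≠ 0 := by rw [hv]; norm_num
  have hk : (reflectionMatrix u * reflectionMatrix v) *ᵥ Pi.single k 1 =
      (-3 / 5 : ℝ) • Pi.single k 1 + (4 / 5 : ℝ) • Pi.single l 1 := by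
    have h2 : u ⬝ᵥ Pi.single k 1 = 1 := by simp [u, hkl]
    rw [← mulVec_mulVec, reflectionMatrix_mulVec v, hv, reflectionMatrix_mulVec, hu,
      dotProduct_sub, dotProduct_smul, h2]
    simp only [v, u]
    module
  have hl : (reflectionMatrix u * reflectionMatrix v) *ᵥ Pi.single l 1 =
      (-4 / 5 : ℝ) • Pi.single k 1 + (-3 / 5 : ℝ) • Pi.single l 1 := by
    have h1 : v ⬝ᵥ Pi.single l 1 = 0 := by simp [v, hkl]
    have h2 : u ⬝ᵥ Pi.single l 1 = 2 := by simp [u, hkl]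
    rw [← mulVec_mulVec, reflectionMatrix_mulVec v, hv, h1, mul_zero, zero_smul, sub_zero,
      reflectionMatrix_mulVec, hu, h2]
    simp only [u]
    module
  refine ⟨⟨reflectionMatrix u * reflectionMatrix v, specialOrthogonalGroup_iff.2 ⟨?_, ?_⟩⟩, ?_, ?_⟩
  · rw [transpose_mul, transpose_reflectionMatrix, transpose_reflectionMatrix, Matrix.mul_assoc,
      ← Matrix.mul_assoc (reflectionMatrix u), reflectionMatrix_mul_self hu0, Matrix.one_mul,
      reflectionMatrix_mul_self hv0]
  · rw [det_mul, det_reflectionMatrix hu0, det_reflectionMatrix hv0]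
    norm_num
  · have hs (x : ι) : (Pi.single x 1 : ι → ℂ) = algebraMap ℝ ℂ ∘ Pi.single x 1 := by
      funext y
      by_cases h : y = x
      · subst h; simp
      · simp [h]
    funext y
    have h3 := congrArg (algebraMap ℝ ℂ) (congrFun hk y)
    rw [hs, ← RingHom.map_mulVec, h3, hs]
    simp
  · have hs (x : ι) : (Pi.single x 1 : ι → ℂ) = algebraMap ℝ ℂ ∘ Pi.single x 1 := by
      funext y
      by_cases h : y = x
      · subst h; simp
      · simp [h]
    funext y
    have h3 := congrArg (algebraMap ℝ ℂ) (congrFun hl y)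
    rw [hs, ← RingHom.map_mulVec, h3, hs]
    simp

end SpecialOrthogonalMoves

/-! ### Generating traceless matrices by matrix units -/

section MatrixUnits

open Matrix

variable {ι : Type} [Fintype ι] [DecidableEq ι]

theorem vecMulVec_single_one_single_one {ι : Type} [DecidableEq ι] (k l : ι) :
    vecMulVec (Pi.single k 1 : ι → ℂ) (Pi.single l 1) = single k l 1 := by
  ext x y
  simp [vecMulVec_apply, single_apply, Pi.single_apply, eq_comm, ite_and]
  split_ifs <;> rfl

/-- The total coefficient of the correction `Q` is $\operatorname{tr}(MK)=0$, so it suffices to know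
each generator modulo a multiple of `Q`. -/
theorem Submodule.sum_smul_mem_of_trace_mul_eq_zero {ι : Type} [Fintype ι]
    {V : Type} [AddCommGroup V] [Module ℂ V]
    {W : Submodule ℂ V} {f : ι → ι → V} {Q : V} {K M : Matrix ι ι ℂ}
    (h : ∀ x y, f x y - K y x • Q ∈ W) (hM : (M * K).trace = 0) :
    ∑ x, ∑ y, M x y • f x y ∈ W := by
  have h1 : ∑ x, ∑ y, M x y • f x y = ∑ x, ∑ y, M x y • (f x y - K y x • Q) := by
    simp only [smul_sub, Finset.sum_sub_distrib, smul_smul, ← Finset.sum_smul]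
    simp only [Matrix.trace, diag_apply, mul_apply] at hM
    rw [hM, zero_smul, sub_zero]
  rw [h1]
  exact W.sum_mem fun x _ => W.sum_mem fun y _ => W.smul_mem _ (h x y)

theorem eq_half_smul_sum {s : ℂ} (hs : s * s = 1) {M : Matrix ι ι ℂ} (hM : Mᵀ = s • M) :
    M = (1 / 2 : ℂ) • ∑ x, ∑ y, M x y • (single x y 1 + s • single y x 1) := by
  have h1 : M = ∑ x, ∑ y, M x y • single x y (1 : ℂ) := by
    conv_lhs => rw [matrix_eq_sum_single M]
    simp
  have h2 : ∑ x, ∑ y, M x y • (s • single y x (1 : ℂ)) = M := by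
    rw [Finset.sum_comm]
    conv_rhs => rw [h1]
    refine Finset.sum_congr rfl fun x _ => Finset.sum_congr rfl fun y _ => ?_
    have h3 := congrFun (congrFun hM x) y
    rw [transpose_apply, Matrix.smul_apply, smul_eq_mul] at h3
    rw [h3, smul_smul, mul_right_comm, hs, one_mul]
  simp only [smul_add, Finset.sum_add_distrib]
  rw [← smul_add, h2, ← h1]
  module

theorem tracelessSub_le {s : ℂ} (hs : s * s = 1) {K Q : Matrix ι ι ℂ}
    {W : Submodule ℂ (Matrix ι ι ℂ)}
    (h : ∀ x y, single x y 1 + s • single y x 1 - K y x • Q ∈ W) : tracelessSub s K ≤ W := by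
  intro M hM
  rw [eq_half_smul_sum hs hM.1]
  exact W.smul_mem _ (Submodule.sum_smul_mem_of_trace_mul_eq_zero h hM.2)

/-- On a diagonal matrix the signs cancel and conjugation only exchanges two entries, so the
difference isolates a traceless diagonal generator. -/
theorem sub_signedPerm_swap_conj {M : Matrix ι ι ℂ} (hod : ∀ x y, x ≠ y → M x y = 0) {k l : ι}
    (hkl : k ≠ l) (ε : ι → ℤˣ) :
    M - (signedPerm (Equiv.swap k l) ε).map (algebraMap ℝ ℂ) * M *
        ((signedPerm (Equiv.swap k l) ε).map (algebraMap ℝ ℂ))ᵀ =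
      (M k k - M l l) • (single k k 1 - single l l 1) := by
  ext x y
  rw [Matrix.sub_apply, signedPerm_map_conj, Matrix.smul_apply, Matrix.sub_apply, single_apply,
    single_apply]
  by_cases hxy : x = y
  · subst hxy
    rw [mul_right_comm, Int.cast_units_mul_self, one_mul]
    by_cases hxk : x = k
    · subst hxk
      simp [hkl.symm]
    · by_cases hxl : x = l
      · subst hxl
        simp [hkl]
      · simp [Equiv.swap_apply_of_ne_of_ne hxk hxl, Ne.symm hxk, Ne.symm hxl]
  · rw [hod x y hxy, hod _ _ fun h => hxy ((Equiv.swap k l).injective h), if_neg, if_neg]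
    · simp
    · rintro ⟨rfl, rfl⟩
      exact hxy rfl
    · rintro ⟨rfl, rfl⟩
      exact hxy rfl

theorem exists_diag_ne_of_trace_eq_zero {ι : Type} [Fintype ι] [Nonempty ι] {M : Matrix ι ι ℂ}
    (hod : ∀ x y, x ≠ y → M x y = 0) (hM0 : M ≠ 0) (hMt : M.trace = 0) :
    ∃ k l, M k k ≠ M l l := by
  by_contra! hall
  obtain ⟨k⟩ := ‹Nonempty ι›
  rw [Matrix.trace] at hMt
  simp only [diag_apply, fun x => hall x k, Finset.sum_const, Finset.card_univ,
    nsmul_eq_mul] at hMt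
  rcases mul_eq_zero.1 hMt with h | h
  · rw [Nat.cast_eq_zero] at h
    have := Fintype.card_pos_iff.2 ⟨k⟩
    omega
  · refine hM0 (Matrix.ext fun x y => ?_)
    by_cases hxy : x = y
    · rw [hxy, hall y k, h]; rfl
    · exact hod x y hxy

variable {G : Type} [Group G] {τ₁ τ₂ : G →* Matrix ι ι ℂ}

theorem tensorRep_single (g : G) (k l : ι) :
    tensorRep τ₁ τ₂ g (single k l 1) =
      vecMulVec (τ₁ g *ᵥ Pi.single k 1) (τ₂ g *ᵥ Pi.single l 1) := by
  rw [← vecMulVec_single_one_single_one, tensorRep_vecMulVec]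

end MatrixUnits

/-! ### Irreducibility for the special orthogonal groups -/

section SpecialOrthogonalRepresentations

open Matrix

variable {ι : Type} [Fintype ι] [DecidableEq ι]

/-- The standard complex representation of the special orthogonal group, as matrices. -/
noncomputable def soHom (ι : Type) [Fintype ι] [DecidableEq ι] :
    specialOrthogonalGroup ι ℝ →* Matrix ι ι ℂ :=
  ((algebraMap ℝ ℂ).mapMatrix (m := ι)).toMonoidHom.comp (Submonoid.subtype _)

theorem soHom_apply (g : specialOrthogonalGroup ι ℝ) : soHom ι g = g.1.map (algebraMap ℝ ℂ) := rfl

theorem continuous_soHom : Continuous fun g => soHom ι g :=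
  continuous_subtype_val.matrix_map Complex.continuous_ofReal

theorem soHom_mul_transpose (g : specialOrthogonalGroup ι ℝ) : soHom ι g * (soHom ι g)ᵀ = 1 := by
  rw [soHom_apply, ← transpose_map, ← Matrix.map_mul,
    mul_eq_one_comm.1 (specialOrthogonalGroup_iff.1 g.2).1,
    Matrix.map_one _ (map_zero _) (map_one _)]

theorem exists_sign_pair (p q : ι) : ∃ ε : ι → ℤˣ, ∏ x, ε x = 1 ∧
    ∀ x, ε x = (if x = p then -1 else 1) * (if x = q then -1 else 1) := by
  refine ⟨Pi.mulSingle p (-1) * Pi.mulSingle q (-1), ?_, fun x => ?_⟩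
  · simp [Finset.prod_mul_distrib, Finset.prod_pi_mulSingle']
  · simp [Pi.mulSingle_apply]

/-- One suitable index is negated, together with an auxiliary index `q` that keeps the product equal
to $1$; leaving room for `q` beside four indices requires five coordinates. Sign matrices thus
separate an unordered pair from all other positions. -/
theorem exists_signs_ne_of_pair_ne (hι : 5 ≤ Fintype.card ι) {k l : ι} (hkl : k ≠ l) {x y : ι}
    (h₁ : ¬ (x = k ∧ y = l)) (h₂ : ¬ (x = l ∧ y = k)) :
    ∃ ε : ι → ℤˣ, ∏ x, ε x = 1 ∧ ε x * ε y ≠ ε k * ε l := by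
  have hex (s : Finset ι) (hs : s.card ≤ 4) : ∃ q, q ∉ s := by
    by_contra! h
    have : s = Finset.univ := Finset.eq_univ_iff_forall.2 h
    rw [this, Finset.card_univ] at hs
    omega
  by_cases hxy : x = y
  · obtain ⟨q, hq⟩ := hex {k, l} (Finset.card_le_two.trans (by norm_num))
    obtain ⟨ε, hε, hval⟩ := exists_sign_pair k q
    simp only [Finset.mem_insert, Finset.mem_singleton, not_or] at hq
    refine ⟨ε, hε, ?_⟩
    rw [hxy, Int.units_mul_self, hval, hval]
    simp [hkl.symm, Ne.symm hq.1, Ne.symm hq.2]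
  · obtain ⟨q, hq⟩ := hex {k, l, x, y} Finset.card_le_four
    simp only [Finset.mem_insert, Finset.mem_singleton, not_or] at hq
    obtain ⟨hqk, hql, hqx, hqy⟩ := hq
    by_cases hx : x = k ∨ x = l
    · have hy : y ≠ k ∧ y ≠ l := by
        rcases hx with rfl | rfl
        · exact ⟨Ne.symm hxy, fun h => h₁ ⟨rfl, h⟩⟩
        · exact ⟨fun h => h₂ ⟨rfl, h⟩, Ne.symm hxy⟩
      obtain ⟨ε, hε, hval⟩ := exists_sign_pair y q
      refine ⟨ε, hε, ?_⟩
      simp [hval, hxy, Ne.symm hy.1, Ne.symm hy.2, Ne.symm hqk, Ne.symm hql, Ne.symm hqx,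
        Ne.symm hqy]
    · rw [not_or] at hx
      obtain ⟨ε, hε, hval⟩ := exists_sign_pair x q
      refine ⟨ε, hε, ?_⟩
      simp [hval, Ne.symm hxy, Ne.symm hx.1, Ne.symm hx.2, Ne.symm hqk, Ne.symm hql, Ne.symm hqx,
        Ne.symm hqy]

/-- The diagonal matrix of `SO` with coefficients the signs `ε`. -/
def signSO (ε : {ε : ι → ℤˣ // ∏ x, ε x = 1}) : specialOrthogonalGroup ι ℝ :=
  ⟨signedPerm (Equiv.refl ι) ε.1, signedPerm_mem (by rw [ε.2]; simp)⟩

variable {W : Submodule ℂ (Matrix ι ι ℂ)} {s : ℂ} {M : Matrix ι ι ℂ}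

theorem smul_single_add_mem_of_mem (hι : 5 ≤ Fintype.card ι)
    (hW : ∀ g, ∀ M ∈ W, tensorRep (soHom ι) (soHom ι) g M ∈ W) (hM : M ∈ W) (hMs : Mᵀ = s • M)
    {k l : ι} (hkl : k ≠ l) : M k l • (single k l 1 + s • single l k 1) ∈ W := by
  have hlk : M l k = s * M k l := congrFun (congrFun hMs k) l
  refine Submodule.mem_of_diagonal_stable (X := ι × ι) (e := fun x => entryLinearMap ℂ ℂ x.1 x.2)
    (fun v hv => Matrix.ext fun x y => hv (x, y))
    (T := fun ε => tensorRep (soHom ι) (soHom ι) (signSO ε))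
    (d := fun ε x => ((ε.1 x.1 : ℤ) : ℂ) * ((ε.1 x.2 : ℤ) : ℂ)) (fun ε x v => ?_) (fun ε => hW _)
    (k, l) hM (fun x hx => ?_) (fun x hx => ?_)
  · simp only [entryLinearMap_apply]
    rw [tensorRep_apply, soHom_apply, signSO, signedPerm_map_conj]
    simp only [Equiv.refl_apply]
    ring
  · obtain ⟨x, y⟩ := x
    simp only [entryLinearMap_apply] at hx ⊢
    by_cases h1 : x = k ∧ y = l
    · obtain ⟨rfl, rfl⟩ := h1
      simp [hkl.symm]
    by_cases h2 : x = l ∧ y = k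
    · obtain ⟨rfl, rfl⟩ := h2
      simp [hkl.symm, hlk, mul_comm]
    obtain ⟨ε, hε, hne⟩ := exists_signs_ne_of_pair_ne hι hkl h1 h2
    refine absurd ?_ hne
    have := hx ⟨ε, hε⟩
    simp only at this
    exact_mod_cast this
  · obtain ⟨x, y⟩ := x
    obtain ⟨ε, hε⟩ := hx
    have h1 : ¬ (x = k ∧ y = l) := by
      rintro ⟨rfl, rfl⟩
      exact hε rfl
    have h2 : ¬ (x = l ∧ y = k) := by
      rintro ⟨rfl, rfl⟩
      exact hε (mul_comm _ _)
    simp only [entryLinearMap_apply]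
    rw [Matrix.smul_apply, Matrix.add_apply, Matrix.smul_apply, single_apply, single_apply,
      if_neg (fun h => h1 ⟨h.1.symm, h.2.symm⟩), if_neg (fun h => h2 ⟨h.1.symm, h.2.symm⟩)]
    simp

theorem single_add_mem_of_single_add_mem
    (hW : ∀ g, ∀ M ∈ W, tensorRep (soHom ι) (soHom ι) g M ∈ W) {k l : ι} (hkl : k ≠ l)
    (h : single k l 1 + s • single l k 1 ∈ W) {x y : ι} (hxy : x ≠ y) :
    single x y 1 + s • single y x 1 ∈ W := by
  obtain ⟨g, u, v, hk, hl⟩ := exists_specialOrthogonal_pair hkl hxy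
  have h1 := hW g _ h
  rw [map_add, map_smul, tensorRep_single, tensorRep_single, soHom_apply, hk, hl] at h1
  simp only [smul_vecMulVec, vecMulVec_smul, vecMulVec_single_one_single_one, smul_smul] at h1
  have h2 := W.smul_mem (((u : ℤ) : ℂ) * ((v : ℤ) : ℂ)) h1
  have h3 : ((u : ℤ) : ℂ) * ((v : ℤ) : ℂ) * (((u : ℤ) : ℂ) * ((v : ℤ) : ℂ)) = 1 := by
    rw [mul_mul_mul_comm, Int.cast_units_mul_self, Int.cast_units_mul_self, one_mul]
  convert h2 using 1
  linear_combination (norm := module) -h3 • (single x y 1 + s • single y x (1 : ℂ))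

theorem single_sub_mem_of_single_sub_mem
    (hW : ∀ g, ∀ M ∈ W, tensorRep (soHom ι) (soHom ι) g M ∈ W) {k l : ι} (hkl : k ≠ l)
    (h : single k k 1 - single l l 1 ∈ W) {x y : ι} (hxy : x ≠ y) :
    single x x 1 - single y y 1 ∈ W := by
  obtain ⟨g, u, v, hk, hl⟩ := exists_specialOrthogonal_pair hkl hxy
  have h1 := hW g _ h
  rw [map_sub, tensorRep_single, tensorRep_single, soHom_apply, hk, hl] at h1
  simp only [smul_vecMulVec, vecMulVec_smul, vecMulVec_single_one_single_one, smul_smul,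
    Int.cast_units_mul_self, one_smul] at h1
  exact h1

theorem irreducibleOn_so_skew (hι : 5 ≤ Fintype.card ι) :
    IrreducibleOn (tensorRep (soHom ι) (soHom ι)) (tracelessSub (-1) 1) := by
  intro W hWle hW0 hW
  obtain ⟨M, hM, hM0⟩ := W.ne_bot_iff.1 hW0
  have hMs := (hWle hM).1
  obtain ⟨k, hk⟩ := Function.ne_iff.1 hM0
  obtain ⟨l, hl⟩ := Function.ne_iff.1 hk
  have hkl : k ≠ l := by
    rintro rfl
    refine hl ?_
    have := congrFun (congrFun hMs k) k
    rw [transpose_apply, Matrix.smul_apply, neg_one_smul] at this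
    exact self_eq_neg.1 this
  have h1 := (W.smul_mem_iff hl).1 (smul_single_add_mem_of_mem hι hW hM hMs hkl)
  refine tracelessSub_le (by norm_num) (Q := 0) fun x y => ?_
  rw [smul_zero, sub_zero]
  by_cases hxy : x = y
  · subst hxy
    simp
  · exact single_add_mem_of_single_add_mem hW hkl h1 hxy

theorem irreducibleOn_so_symm (hι : 5 ≤ Fintype.card ι) :
    IrreducibleOn (tensorRep (soHom ι) (soHom ι)) (tracelessSub 1 1) := by
  intro W hWle hW0 hW
  obtain ⟨M, hM, hM0⟩ := W.ne_bot_iff.1 hW0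
  have hMs := (hWle hM).1
  have hMt := (hWle hM).2
  have hoff {k l : ι} (hkl : k ≠ l) (h : single k k 1 - single l l 1 ∈ W) :
      single k l 1 + (1 : ℂ) • single l k 1 ∈ W := by
    obtain ⟨g, hgk, hgl⟩ := exists_specialOrthogonal_rotation hkl
    have h1 := hW g _ h
    rw [map_sub, tensorRep_single, tensorRep_single, soHom_apply, hgk, hgl] at h1
    simp only [smul_vecMulVec, vecMulVec_smul, vecMulVec_add, add_vecMulVec,
      vecMulVec_single_one_single_one] at h1
    -- The double angle has cosine $-7/25$ and sine $-24/25$; the combination removes the diagonal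
    -- part.
    have h2 := W.add_mem (W.smul_mem (-25 / 24) h1) (W.smul_mem (-7 / 24) h)
    convert h2 using 1
    module
  have hdiag {k l : ι} (hkl : k ≠ l) (h : single k l 1 + (1 : ℂ) • single l k 1 ∈ W) :
      single k k 1 - single l l 1 ∈ W := by
    obtain ⟨g, hgk, hgl⟩ := exists_specialOrthogonal_rotation hkl
    have h1 := hW g _ h
    rw [map_add, map_smul, tensorRep_single, tensorRep_single, soHom_apply, hgk, hgl] at h1
    simp only [smul_vecMulVec, vecMulVec_smul, vecMulVec_add, add_vecMulVec,
      vecMulVec_single_one_single_one] at h1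
    have h2 := W.add_mem (W.smul_mem (25 / 24) h1) (W.smul_mem (7 / 24) h)
    convert h2 using 1
    module
  have hex : ∃ k l, k ≠ l ∧ single k k 1 - single l l 1 ∈ W := by
    by_cases hod : ∃ k l, k ≠ l ∧ M k l ≠ 0
    · obtain ⟨k, l, hkl, h⟩ := hod
      exact ⟨k, l, hkl, hdiag hkl
        ((W.smul_mem_iff h).1 (smul_single_add_mem_of_mem hι hW hM hMs hkl))⟩
    -- A non-zero diagonal matrix of trace zero has two different entries; subtracting its conjugate
    -- by the transposition leaves a multiple of $E_{kk}-E_{ll}$.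
    · push Not at hod
      have : Nonempty ι := Fintype.card_pos_iff.1 (by omega)
      obtain ⟨k, l, hne⟩ := exists_diag_ne_of_trace_eq_zero hod hM0 (by rwa [Matrix.mul_one] at hMt)
      have hkl : k ≠ l := fun h => hne (by rw [h])
      refine ⟨k, l, hkl, (W.smul_mem_iff (sub_ne_zero.2 hne)).1 ?_⟩
      rw [← sub_signedPerm_swap_conj hod hkl]
      exact W.sub_mem hM (hW ⟨signedPerm (Equiv.swap k l) _,
        signedPerm_mem (exists_prod_units_mul_eq_one _ k)⟩ M hM)
  obtain ⟨k, l, hkl, h⟩ := hex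
  -- The generator at a diagonal position is $2E_{xx}$, which belongs to `W` only after subtracting
  -- the fixed reference $2E_{kk}$.
  refine tracelessSub_le (by norm_num) (Q := (2 : ℂ) • single k k 1) fun x y => ?_
  by_cases hxy : x = y
  · subst hxy
    by_cases hxk : x = k
    · subst hxk
      rw [one_apply_eq]
      convert W.zero_mem using 1
      module
    · convert W.smul_mem 2 (single_sub_mem_of_single_sub_mem hW hkl h hxk) using 1
      rw [one_apply_eq]
      module
  · rw [one_apply_ne (Ne.symm hxy), zero_smul, sub_zero]
    exact hoff hxy (single_sub_mem_of_single_sub_mem hW hkl h hxy)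

theorem irreducibleOn_so_standard (hι : 3 ≤ Fintype.card ι) :
    IrreducibleOn (vecRep (soHom ι)) ⊤ := by
  intro W _ hW0 hW
  obtain ⟨v, hv, hv0⟩ := W.ne_bot_iff.1 hW0
  obtain ⟨k, hk⟩ := Function.ne_iff.1 hv0
  have hsingle : v k • (Pi.single k 1 : ι → ℂ) ∈ W := by
    refine Submodule.mem_of_diagonal_stable (X := ι) (e := fun x => LinearMap.proj x)
      (fun v hv => funext hv) (T := fun ε => vecRep (soHom ι) (signSO ε))
      (d := fun ε x => ((ε.1 x : ℤ) : ℂ)) (fun ε x v => ?_) (fun ε => hW _)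
      k hv (fun x hx => ?_) (fun x hx => ?_)
    · rw [vecRep_apply, soHom_apply, LinearMap.proj_apply, mulVec, dotProduct,
        Finset.sum_eq_single x]
      · simp [signSO, signedPerm]
      · intro y _ hy
        simp [signSO, signedPerm, Ne.symm hy]
      · simp
    · by_cases hxk : x = k
      · subst hxk
        simp
      have : ∃ q, q ∉ ({k, x} : Finset ι) := by
        by_contra! h
        have h1 := Finset.card_le_two (a := k) (b := x)
        rw [Finset.eq_univ_iff_forall.2 h, Finset.card_univ] at h1
        omega
      obtain ⟨q, hq⟩ := this
      simp only [Finset.mem_insert, Finset.mem_singleton, not_or] at hq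
      obtain ⟨ε, hε, hval⟩ := exists_sign_pair x q
      have h1 := hx ⟨ε, hε⟩
      simp [hval, Ne.symm hq.1, Ne.symm hq.2, Ne.symm hxk] at h1
      norm_num at h1
    · obtain ⟨ε, hε⟩ := hx
      have : x ≠ k := by
        rintro rfl
        exact hε rfl
      simp [this]
  have hk1 := (W.smul_mem_iff hk).1 hsingle
  have hall (x : ι) : (Pi.single x 1 : ι → ℂ) ∈ W := by
    have : Nonempty ι := ⟨x⟩
    have h1 := hW ⟨signedPerm (Equiv.swap x k) _,
        signedPerm_mem (exists_prod_units_mul_eq_one _ k)⟩ _ hk1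
    have h2 := signedPerm_map_mulVec_single (Equiv.swap x k)
      (Function.update 1 k (Equiv.Perm.sign (Equiv.swap x k))) x
    rw [Equiv.swap_apply_left] at h2
    rw [vecRep_apply, soHom_apply, h2] at h1
    refine (W.smul_mem_iff ?_).1 h1
    simp
  intro v _
  rw [pi_eq_sum_univ' v]
  exact W.sum_mem fun x _ => W.smul_mem _ (hall x)

end SpecialOrthogonalRepresentations

/-! ### The weights of the standard representations -/

section SignedWeights

variable {n : ℕ}

/-- The weights `±e_i`. -/
def pmWeight (x : Fin 2 × Fin n) : Fin n → ℤ := Pi.single x.2 ((![1, -1] : Fin 2 → ℤ) x.1)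

theorem torusChar_pmWeight (x : Fin 2 × Fin n) (z : Fin n → Circle) :
    torusChar (fun z => z) (pmWeight x) z =
      (![(z x.2 : ℂ), ((z x.2)⁻¹ : Circle)] : Fin 2 → ℂ) x.1 := by
  obtain ⟨a, i⟩ := x
  rw [pmWeight, torusChar_single]
  fin_cases a <;> simp

theorem pmWeight_zero_sub_mem {S : AddSubmonoid (Fin n → ℤ)} {i : Fin n}
    (hA : ∀ j, i ≤ j → (Pi.single i 1 - Pi.single j 1 : Fin n → ℤ) ∈ S)
    (hp : ∀ j, (Pi.single i 1 + Pi.single j 1 : Fin n → ℤ) ∈ S) {x : Fin 2 × Fin n}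
    (hx : x.1 = 0 → i ≤ x.2) : pmWeight (0, i) - pmWeight x ∈ S := by
  obtain ⟨a, j⟩ := x
  fin_cases a
  · exact hA j (hx rfl)
  · have h : pmWeight (0, i) - pmWeight (1, j) = (Pi.single i 1 + Pi.single j 1 : Fin n → ℤ) := by
      simp [pmWeight, Pi.single_neg]
    exact h ▸ hp j

theorem pmWeight_zero_eq (hn : 0 < n) : pmWeight (0, ⟨0, hn⟩) = hookLabel n 1 0 := by
  funext i
  simp [pmWeight, hookLabel, Pi.single_apply, Fin.ext_iff]

theorem pmWeight_zero_add_eq (hn : 2 ≤ n) :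
    pmWeight (0, ⟨0, by omega⟩) + pmWeight (0, ⟨1, hn⟩) = twoOnesLabel n := by
  funext i
  simp only [pmWeight, twoOnesLabel, Pi.single_apply, Fin.ext_iff, Pi.add_apply,
    Matrix.cons_val_zero]
  split_ifs <;> omega

theorem le_of_ne_zero_pair (hn : 2 ≤ n) {x : Fin 2 × Fin n} (hx : x ≠ (0, ⟨0, by omega⟩))
    (h : x.1 = 0) : (⟨1, hn⟩ : Fin n) ≤ x.2 := by
  rw [Fin.le_def]
  by_contra hlt
  refine hx (Prod.ext h (Fin.ext ?_))
  simp only at hlt ⊢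
  omega

end SignedWeights

/-! ### The theorem for the special orthogonal groups -/

section OrthogonalSquare

open Matrix

variable {n : ℕ}

/-- The matrix whose rows are left eigenvectors of the plane rotations. -/
noncomputable def rotEigen : Matrix (Fin 2) (Fin 2) ℂ := !![1, Complex.I; 1, -Complex.I]

/-- The inverse matrix of `rotEigen`. -/
noncomputable def rotEigenInv : Matrix (Fin 2) (Fin 2) ℂ :=
  !![1 / 2, 1 / 2; -Complex.I / 2, Complex.I / 2]

theorem rotEigenInv_mul : rotEigenInv * rotEigen = 1 := by
  ext a b
  fin_cases a <;> fin_cases b <;> simp [rotEigen, rotEigenInv, mul_apply] <;>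
    ring_nf <;> simp

theorem rotEigen_mul_rot (z : Circle) :
    rotEigen * (rot z).map (algebraMap ℝ ℂ) =
      diagonal (![(z : ℂ), (z⁻¹ : Circle)] : Fin 2 → ℂ) * rotEigen := by
  ext a b
  rw [diagonal_mul]
  fin_cases a <;> fin_cases b <;>
    simp [rotEigen, rot, mul_apply, Circle.coe_inv_eq_conj, -Circle.coe_inv] <;>
    apply Complex.ext <;> simp

theorem blockDiagonal_rotEigen_mul (z : Fin n → Circle) :
    blockDiagonal (fun _ : Fin n => rotEigen) *
        (blockDiagonal fun i => rot (z i)).map (algebraMap ℝ ℂ) =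
      diagonal (fun x => torusChar (fun z => z) (pmWeight x) z) *
        blockDiagonal (fun _ : Fin n => rotEigen) := by
  have h : diagonal (fun x => torusChar (fun z => z) (pmWeight x) z) =
      blockDiagonal fun i => diagonal (![(z i : ℂ), ((z i)⁻¹ : Circle)] : Fin 2 → ℂ) := by
    rw [blockDiagonal_diagonal]
    congr 1
    funext x
    rw [torusChar_pmWeight]
  rw [h, blockDiagonal_map _ _ (map_zero _), ← blockDiagonal_mul, ← blockDiagonal_mul]
  simp only [rotEigen_mul_rot]

theorem diagonalizes_SOEven : Diagonalizes torusSOEven (fun z : Fin n → Circle => z)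
    (soHom (Fin 2 × Fin n)) pmWeight (blockDiagonal fun _ => rotEigen)
    (blockDiagonal fun _ => rotEigenInv) where
  inv_mul := by
    rw [← blockDiagonal_mul]
    simp only [rotEigenInv_mul]
    exact blockDiagonal_one
  mul_torus := blockDiagonal_rotEigen_mul

theorem diagonalizes_SOOdd : Diagonalizes torusSOOdd (fun z : Fin n → Circle => z)
    (soHom ((Fin 2 × Fin n) ⊕ Unit)) (Sum.elim pmWeight fun _ => 0)
    (fromBlocks (blockDiagonal fun _ => rotEigen) 0 0 1)
    (fromBlocks (blockDiagonal fun _ => rotEigenInv) 0 0 1) where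
  inv_mul := by
    rw [fromBlocks_multiply, ← blockDiagonal_mul]
    simp only [rotEigenInv_mul, Matrix.mul_zero, Matrix.zero_mul, add_zero, zero_add,
      Matrix.mul_one]
    rw [← fromBlocks_one]
    congr 1
    exact blockDiagonal_one
  mul_torus z := by
    have h : diagonal (fun k => torusChar (fun z => z)
        ((Sum.elim pmWeight fun _ => 0 : (Fin 2 × Fin n) ⊕ Unit → Fin n → ℤ) k) z) =
        fromBlocks (diagonal fun x => torusChar (fun z => z) (pmWeight x) z) 0 0 1 := by
      rw [← diagonal_one, fromBlocks_diagonal]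
      congr 1
      funext x
      rcases x with x | x
      · rfl
      · exact torusChar_zero _ _
    rw [h, soHom_apply, torusSOOdd_coe, fromBlocks_map, fromBlocks_multiply, fromBlocks_multiply]
    simp only [Matrix.map_zero _ (map_zero (algebraMap ℝ ℂ)),
      Matrix.map_one _ (map_zero (algebraMap ℝ ℂ)) (map_one _), Matrix.mul_zero, Matrix.zero_mul,
      add_zero, zero_add, Matrix.mul_one, blockDiagonal_rotEigen_mul]

theorem trace_soHom_im {ι : Type} [Fintype ι] [DecidableEq ι] (g : specialOrthogonalGroup ι ℝ) :
    (soHom ι g).trace.im = 0 := by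
  rw [soHom_apply, Matrix.trace, Complex.im_sum]
  exact Finset.sum_eq_zero fun x _ => Complex.ofReal_im _

theorem transpose_mul_soHom {ι : Type} [Fintype ι] [DecidableEq ι]
    (g : specialOrthogonalGroup ι ℝ) : (soHom ι g)ᵀ * 1 * soHom ι g = 1 := by
  rw [Matrix.mul_one, mul_eq_one_comm.1 (soHom_mul_transpose g)]

theorem standard_character_sq_SOEven (hn : 3 ≤ n) :
    (∃! χ, IsCharSOEven n (hookLabel n 1 0) χ) ∧ (∃! χ, IsCharSOEven n (hookLabel n 2 0) χ) ∧
      (∃! χ, IsCharSOEven n (twoOnesLabel n) χ) ∧ (∃! χ, IsCharSOEven n 0 χ) ∧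
      ∀ χ₁ χ₂ χ₁₁ χ₀ : SOEven n → ℂ,
        IsCharSOEven n (hookLabel n 1 0) χ₁ → IsCharSOEven n (hookLabel n 2 0) χ₂ →
        IsCharSOEven n (twoOnesLabel n) χ₁₁ → IsCharSOEven n 0 χ₀ →
        ∀ g, (χ₁ g).im = 0 ∧ χ₀ g = 1 ∧ χ₁ g ^ 2 = χ₂ g + χ₁₁ g + χ₀ g := by
  have hcard : 5 ≤ Fintype.card (Fin 2 × Fin n) := by
    rw [Fintype.card_prod, Fintype.card_fin, Fintype.card_fin]
    omega
  have hA (i j : Fin n) (hij : i ≤ j) : (Pi.single i 1 - Pi.single j 1 : Fin n → ℤ) ∈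
      AddSubmonoid.closure (simpleRootsD n) :=
    AddSubmonoid.closure_mono (fun _ => Or.inl) (single_sub_single_mem_closure hij)
  -- Only the first two indices are needed; since $n\ge3$, neither is the last one, and $2e^i$ is a
  -- sum of simple roots of type $D$.
  have hp (i : Fin n) (hi : (i : ℕ) < 2) (j : Fin n) :
      (Pi.single i 1 + Pi.single j 1 : Fin n → ℤ) ∈ AddSubmonoid.closure (simpleRootsD n) := by
    rcases lt_trichotomy i j with h | rfl | h
    · exact single_add_single_mem_closure_simpleRootsD h
    · exact single_add_self_mem_closure_simpleRootsD (by omega)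
    · rw [add_comm]
      exact single_add_single_mem_closure_simpleRootsD h
  refine standard_character_sq continuous_soHom (by omega) (isMaximalTorus_SOEven (by omega))
    (isDominantList_of_flip_even hn SOEven.exists_swap SOEven.exists_flip)
    diagonalizes_SOEven (k₀ := (0, ⟨0, by omega⟩)) (k₁ := (0, ⟨1, by omega⟩)) (by simp)
    (pmWeight_zero_eq _) (pmWeight_zero_add_eq (by omega))
    (fun k => pmWeight_zero_sub_mem (hA _) (hp _ (by simp)) fun _ => Fin.le_def.2 (Nat.zero_le _))
    (fun k hk => pmWeight_zero_sub_mem (hA _) (hp _ (by simp))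
      fun h => le_of_ne_zero_pair (by omega) hk h) (J := 1) (K := 1) ?_ (c := 1) (by simp)
    (fun g => by rw [Matrix.mul_one, soHom_mul_transpose]) transpose_mul_soHom
    trace_soHom_im (irreducibleOn_so_standard (by omega)) (irreducibleOn_so_symm hcard)
    (irreducibleOn_so_skew hcard)
  rw [Matrix.mul_one, trace_one]
  exact Nat.cast_ne_zero.2 (by omega)

theorem standard_character_sq_SOOdd (hn : 2 ≤ n) :
    (∃! χ, IsCharSOOdd n (hookLabel n 1 0) χ) ∧ (∃! χ, IsCharSOOdd n (hookLabel n 2 0) χ) ∧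
      (∃! χ, IsCharSOOdd n (twoOnesLabel n) χ) ∧ (∃! χ, IsCharSOOdd n 0 χ) ∧
      ∀ χ₁ χ₂ χ₁₁ χ₀ : SOOdd n → ℂ,
        IsCharSOOdd n (hookLabel n 1 0) χ₁ → IsCharSOOdd n (hookLabel n 2 0) χ₂ →
        IsCharSOOdd n (twoOnesLabel n) χ₁₁ → IsCharSOOdd n 0 χ₀ →
        ∀ g, (χ₁ g).im = 0 ∧ χ₀ g = 1 ∧ χ₁ g ^ 2 = χ₂ g + χ₁₁ g + χ₀ g := by
  have hcard : 5 ≤ Fintype.card ((Fin 2 × Fin n) ⊕ Unit) := by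
    rw [Fintype.card_sum, Fintype.card_prod, Fintype.card_fin, Fintype.card_fin, Fintype.card_unit]
    omega
  have hA (i j : Fin n) (hij : i ≤ j) : (Pi.single i 1 - Pi.single j 1 : Fin n → ℤ) ∈
      AddSubmonoid.closure (simpleRootsB n) :=
    AddSubmonoid.closure_mono (fun _ => Or.inl) (single_sub_single_mem_closure hij)
  have hp (i j : Fin n) :
      (Pi.single i 1 + Pi.single j 1 : Fin n → ℤ) ∈ AddSubmonoid.closure (simpleRootsB n) :=
    add_mem (single_mem_closure_simpleRootsB i) (single_mem_closure_simpleRootsB j)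
  have h0 (i : Fin n) : pmWeight (0, i) - 0 ∈ AddSubmonoid.closure (simpleRootsB n) := by
    rw [sub_zero]
    exact single_mem_closure_simpleRootsB i
  refine standard_character_sq continuous_soHom hn isMaximalTorus_SOOdd
    (isDominantList_of_flip hn (weightedSum_simpleRootsB (fun i j hij => by
      simp only [stairs]; omega) (fun i => by simp only [stairs]; omega))
      (weightedSum_simpleRootsB (fun _ _ _ => le_rfl) (fun _ => zero_le_one))
      SOOdd.exists_swap SOOdd.exists_flip)
    diagonalizes_SOOdd (k₀ := Sum.inl (0, ⟨0, by omega⟩)) (k₁ := Sum.inl (0, ⟨1, by omega⟩))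
    (by simp) (pmWeight_zero_eq _) (pmWeight_zero_add_eq hn) (fun k => ?_) (fun k hk => ?_)
    (J := 1) (K := 1) ?_ (c := 1) (by simp)
    (fun g => by rw [Matrix.mul_one, soHom_mul_transpose]) transpose_mul_soHom
    trace_soHom_im (irreducibleOn_so_standard (by omega)) (irreducibleOn_so_symm hcard)
    (irreducibleOn_so_skew hcard)
  · rcases k with k | k
    · exact pmWeight_zero_sub_mem (hA _) (hp _) fun _ => Fin.le_def.2 (Nat.zero_le _)
    · exact h0 _
  · rcases k with k | k
    · exact pmWeight_zero_sub_mem (hA _) (hp _) fun h =>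
        le_of_ne_zero_pair hn (fun h => hk (congrArg _ h)) h
    · exact h0 _
  · rw [Matrix.mul_one, trace_one]
    exact Nat.cast_ne_zero.2 (by omega)

end OrthogonalSquare

/-! ### Quaternionic matrices as complex matrices -/

section Complexification

open Matrix Quaternion

variable {n : ℕ}

/-- The complex `2 × 2` matrix of a quaternion. -/
def quatMatrix (q : ℍ[ℝ]) : Matrix (Fin 2) (Fin 2) ℂ :=
  !![⟨q.re, q.imI⟩, ⟨q.imJ, q.imK⟩; ⟨-q.imJ, q.imK⟩, ⟨q.re, -q.imI⟩]

theorem quatMatrix_mul (p q : ℍ[ℝ]) : quatMatrix (p * q) = quatMatrix p * quatMatrix q := by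
  ext a b
  fin_cases a <;> fin_cases b <;> simp [quatMatrix, mul_apply] <;> apply Complex.ext <;>
    simp <;> ring

theorem quatMatrix_one : quatMatrix 1 = 1 := by
  ext a b
  fin_cases a <;> fin_cases b <;> simp [quatMatrix] <;> apply Complex.ext <;> simp

theorem quatMatrix_zero : quatMatrix 0 = 0 := by
  ext a b
  fin_cases a <;> fin_cases b <;> simp [quatMatrix] <;> apply Complex.ext <;> simp

theorem quatMatrix_add (p q : ℍ[ℝ]) : quatMatrix (p + q) = quatMatrix p + quatMatrix q := by
  ext a b
  fin_cases a <;> fin_cases b <;> simp [quatMatrix] <;> apply Complex.ext <;> simp <;> ring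

/-- The ring homomorphism `quatMatrix`. -/
def quatMatrixHom : ℍ[ℝ] →+* Matrix (Fin 2) (Fin 2) ℂ where
  toFun := quatMatrix
  map_one' := quatMatrix_one
  map_mul' := quatMatrix_mul
  map_zero' := quatMatrix_zero
  map_add' := quatMatrix_add

theorem quatMatrix_sum {κ : Type} (s : Finset κ) (f : κ → ℍ[ℝ]) :
    quatMatrix (∑ k ∈ s, f k) = ∑ k ∈ s, quatMatrix (f k) :=
  map_sum quatMatrixHom f s

/-- The complex matrix of a quaternionic matrix. -/
def complexify : Matrix (Fin n) (Fin n) ℍ[ℝ] →* Matrix (Fin 2 × Fin n) (Fin 2 × Fin n) ℂ where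
  toFun S := Matrix.of fun x y => quatMatrix (S x.2 y.2) x.1 y.1
  map_one' := by
    ext ⟨a, i⟩ ⟨b, k⟩
    by_cases hik : i = k
    · subst hik
      simp [quatMatrix_one, one_apply]
    · simp [quatMatrix_zero, hik]
  map_mul' S T := by
    ext ⟨a, i⟩ ⟨b, k⟩
    simp only [of_apply, mul_apply, quatMatrix_sum, quatMatrix_mul, Matrix.sum_apply,
      Fintype.sum_prod_type_right]

theorem complexify_apply (S : Matrix (Fin n) (Fin n) ℍ[ℝ]) (a b : Fin 2) (i k : Fin n) :
    complexify S (a, i) (b, k) = quatMatrix (S i k) a b := rfl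

/-- The standard complex representation of `USp(n)`, as matrices. -/
noncomputable def uspHom (n : ℕ) : USp n →* Matrix (Fin 2 × Fin n) (Fin 2 × Fin n) ℂ :=
  complexify.comp (Submonoid.subtype _)

theorem uspHom_apply (g : USp n) : uspHom n g = complexify g.1 := rfl

theorem continuous_quatMatrix : Continuous quatMatrix := by
  refine continuous_matrix fun a b => ?_
  have h (f g : ℍ[ℝ] → ℝ) (hf : Continuous f) (hg : Continuous g) :
      Continuous fun q => (⟨f q, g q⟩ : ℂ) :=
    Complex.equivRealProdCLM.symm.continuous.comp (hf.prodMk hg)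
  fin_cases a <;> fin_cases b
  · exact h _ _ Quaternion.continuous_re Quaternion.continuous_imI
  · exact h _ _ Quaternion.continuous_imJ Quaternion.continuous_imK
  · exact h _ _ Quaternion.continuous_imJ.neg Quaternion.continuous_imK
  · exact h _ _ Quaternion.continuous_re Quaternion.continuous_imI.neg

theorem continuous_uspHom : Continuous fun g => uspHom n g :=
  continuous_matrix fun x y => (continuous_quatMatrix.comp
    (continuous_subtype_val.matrix_elem x.2 y.2)).matrix_elem x.1 y.1

/-- The matrix of the invariant symplectic form. -/
def symplecticForm (n : ℕ) : Matrix (Fin 2 × Fin n) (Fin 2 × Fin n) ℂ :=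
  blockDiagonal fun _ => !![0, 1; -1, 0]

theorem blockDiagonal_mul_apply {κ : Type} [Fintype κ] [DecidableEq κ] {X : Type}
    (N : κ → Matrix (Fin 2) (Fin 2) ℂ) (M : Matrix (Fin 2 × κ) X ℂ) (a : Fin 2) (i : κ) (y : X) :
    (blockDiagonal N * M) (a, i) y = ∑ b, N i a b * M (b, i) y := by
  rw [mul_apply, Fintype.sum_prod_type]
  refine Finset.sum_congr rfl fun b _ => ?_
  rw [Finset.sum_eq_single i]
  · simp [blockDiagonal_apply]
  · intro k _ hk
    simp [blockDiagonal_apply, hk.symm]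
  · simp

theorem mul_blockDiagonal_apply {κ : Type} [Fintype κ] [DecidableEq κ] {X : Type}
    (N : κ → Matrix (Fin 2) (Fin 2) ℂ) (M : Matrix X (Fin 2 × κ) ℂ) (x : X) (a : Fin 2) (i : κ) :
    (M * blockDiagonal N) x (a, i) = ∑ b, M x (b, i) * N i b a := by
  rw [mul_apply, Fintype.sum_prod_type]
  refine Finset.sum_congr rfl fun b _ => ?_
  rw [Finset.sum_eq_single i]
  · simp [blockDiagonal_apply]
  · intro k _ hk
    simp [blockDiagonal_apply, hk]
  · simp

/-- For the $2\times2$ matrix of one quaternion, conjugation by the symplectic block turns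
transposition into quaternionic conjugation. Quaternionic unitarity therefore implies invariance of
the symplectic form. -/
theorem symplecticForm_mul_transpose (S : Matrix (Fin n) (Fin n) ℍ[ℝ]) :
    symplecticForm n * (complexify S)ᵀ = complexify (star S) * symplecticForm n := by
  ext ⟨a, i⟩ ⟨b, k⟩
  rw [symplecticForm, blockDiagonal_mul_apply, mul_blockDiagonal_apply]
  simp only [transpose_apply, complexify_apply, star_apply, Fin.sum_univ_two]
  fin_cases a <;> fin_cases b <;> simp [quatMatrix] <;> apply Complex.ext <;> simp

theorem symplecticForm_mul_self : symplecticForm n * symplecticForm n = -1 := by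
  rw [symplecticForm, ← blockDiagonal_mul, ← blockDiagonal_one, ← blockDiagonal_neg]
  congr 1
  funext i
  ext a b
  fin_cases a <;> fin_cases b <;> simp [mul_apply]

theorem transpose_symplecticForm : (symplecticForm n)ᵀ = (-1 : ℂ) • symplecticForm n := by
  rw [symplecticForm, blockDiagonal_transpose, ← blockDiagonal_smul]
  congr 1
  funext i
  ext a b
  fin_cases a <;> fin_cases b <;> simp

theorem uspHom_symplecticForm (g : USp n) :
    uspHom n g * symplecticForm n * (uspHom n g)ᵀ = symplecticForm n := by
  rw [Matrix.mul_assoc, uspHom_apply, symplecticForm_mul_transpose, ← Matrix.mul_assoc, ← map_mul,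
    (Unitary.mem_iff.1 g.2).2, map_one, Matrix.one_mul]

theorem transpose_uspHom_symplecticForm (g : USp n) :
    (uspHom n g)ᵀ * symplecticForm n * uspHom n g = symplecticForm n := by
  have h : symplecticForm n * ((uspHom n g)ᵀ * symplecticForm n * uspHom n g) = -1 := by
    rw [← Matrix.mul_assoc, ← Matrix.mul_assoc, uspHom_apply, symplecticForm_mul_transpose,
      Matrix.mul_assoc (complexify _) (symplecticForm n) (symplecticForm n),
          symplecticForm_mul_self, Matrix.mul_neg, Matrix.mul_one,
      Matrix.neg_mul, ← map_mul, (Unitary.mem_iff.1 g.2).1, map_one]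
  have h2 : -(symplecticForm n * (symplecticForm n * ((uspHom n g)ᵀ * symplecticForm n *
      uspHom n g))) = -(symplecticForm n * -1) := by rw [h]
  rw [← Matrix.mul_assoc (symplecticForm n) (symplecticForm n), symplecticForm_mul_self] at h2
  simpa using h2

/-- The two diagonal entries of the matrix of a quaternion are complex conjugate. -/
theorem trace_uspHom_im (g : USp n) : (uspHom n g).trace.im = 0 := by
  rw [uspHom_apply, Matrix.trace, Fintype.sum_prod_type_right]
  simp [complexify_apply, quatMatrix]

theorem trace_symplecticForm_mul_self (hn : 0 < n) :
    (symplecticForm n * symplecticForm n).trace ≠ 0 := by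
  rw [symplecticForm_mul_self, trace_neg, trace_one, neg_ne_zero, Fintype.card_prod,
    Fintype.card_fin, Fintype.card_fin]
  exact Nat.cast_ne_zero.2 (by omega)

theorem complexify_diagonal (q : Fin n → ℍ[ℝ]) :
    complexify (diagonal q) = blockDiagonal fun i => quatMatrix (q i) := by
  ext ⟨a, i⟩ ⟨b, k⟩
  rw [complexify_apply, blockDiagonal_apply]
  by_cases hik : i = k
  · subst hik
    simp
  · simp [hik, quatMatrix_zero]

theorem uspHom_torusUSp (z : Fin n → Circle) :
    uspHom n (torusUSp z) = diagonal fun x => torusChar (fun z => z) (pmWeight x) z := by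
  rw [uspHom_apply, torusUSp_coe, complexify_diagonal]
  have h (i) : quatMatrix (Quaternion.coeComplex (z i : ℂ)) =
      diagonal (![(z i : ℂ), ((z i)⁻¹ : Circle)] : Fin 2 → ℂ) := by
    ext a b
    fin_cases a <;> fin_cases b <;>
      simp [quatMatrix, Circle.coe_inv_eq_conj, -Circle.coe_inv] <;> apply Complex.ext <;> simp
  simp only [h]
  rw [blockDiagonal_diagonal]
  congr 1
  funext x
  rw [torusChar_pmWeight]

theorem diagonalizes_USp :
    Diagonalizes torusUSp (fun z : Fin n → Circle => z) (uspHom n) pmWeight 1 1 where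
  inv_mul := Matrix.mul_one _
  mul_torus z := by rw [Matrix.one_mul, Matrix.mul_one, uspHom_torusUSp]

end Complexification

/-! ### Explicit elements of the compact symplectic group -/

section SymplecticMoves

open Matrix Quaternion

variable {n : ℕ}

theorem quatMatrix_algebraMap (r : ℝ) (b c : Fin 2) :
    quatMatrix (algebraMap ℝ ℍ[ℝ] r) b c = if b = c then (r : ℂ) else 0 := by
  fin_cases b <;> fin_cases c <;> simp [quatMatrix] <;> apply Complex.ext <;> simp

theorem uspHom_ofOrthogonal_apply {P : Matrix (Fin n) (Fin n) ℝ} (hP : Pᵀ * P = 1) (a b : Fin 2)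
    (i k : Fin n) : uspHom n (USp.ofOrthogonal P hP) (a, i) (b, k) =
      if a = b then (P i k : ℂ) else 0 :=
  quatMatrix_algebraMap _ _ _

theorem uspHom_ofOrthogonal_mulVec {P : Matrix (Fin n) (Fin n) ℝ} (hP : Pᵀ * P = 1) (a : Fin 2)
    (v : Fin n → ℂ) :
    uspHom n (USp.ofOrthogonal P hP) *ᵥ (fun x => if x.1 = a then v x.2 else 0) =
      fun x => if x.1 = a then (P.map (algebraMap ℝ ℂ) *ᵥ v) x.2 else 0 := by
  funext ⟨b, i⟩
  simp only [mulVec, dotProduct, Fintype.sum_prod_type, uspHom_ofOrthogonal_apply, map_apply]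
  rw [Finset.sum_eq_single a]
  · by_cases hba : b = a <;> simp [hba]
  · intro c _ hc
    simp [hc]
  · simp

theorem single_prod_eq (a : Fin 2) (i : Fin n) (c : ℂ) :
    (Pi.single (a, i) c : Fin 2 × Fin n → ℂ) =
      fun x => if x.1 = a then (Pi.single i c : Fin n → ℂ) x.2 else 0 := by
  funext ⟨b, k⟩
  by_cases h : b = a <;> by_cases h' : k = i <;> simp [h, h']

theorem uspHom_ofOrthogonal_single {P : Matrix (Fin n) (Fin n) ℝ} (hP : Pᵀ * P = 1) (a : Fin 2)
    {k i j : Fin n} {c s : ℂ}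
    (h : P.map (algebraMap ℝ ℂ) *ᵥ Pi.single k 1 = c • Pi.single i 1 + s • Pi.single j 1) :
    uspHom n (USp.ofOrthogonal P hP) *ᵥ Pi.single (a, k) 1 =
      c • Pi.single (a, i) 1 + s • Pi.single (a, j) 1 := by
  rw [single_prod_eq, uspHom_ofOrthogonal_mulVec, h, single_prod_eq, single_prod_eq]
  funext ⟨b, l⟩
  by_cases hb : b = a <;> simp [hb]

theorem exists_usp_rotation {k l : Fin n} (hkl : k ≠ l) : ∃ g : USp n, ∀ a : Fin 2,
    uspHom n g *ᵥ Pi.single (a, k) 1 =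
      (-3 / 5 : ℂ) • Pi.single (a, k) 1 + (4 / 5 : ℂ) • Pi.single (a, l) 1 ∧
    uspHom n g *ᵥ Pi.single (a, l) 1 =
      (-4 / 5 : ℂ) • Pi.single (a, k) 1 + (-3 / 5 : ℂ) • Pi.single (a, l) 1 := by
  obtain ⟨g, hk, hl⟩ := exists_specialOrthogonal_rotation hkl
  exact ⟨USp.ofOrthogonal g.1 (specialOrthogonalGroup_iff.1 g.2).1, fun a =>
    ⟨uspHom_ofOrthogonal_single _ a hk, uspHom_ofOrthogonal_single _ a hl⟩⟩

/-- The element of `USp(n)` equal to `c + s j` at the coordinate `i`. -/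
noncomputable def uspTwist (i : Fin n) {c s : ℝ} (h : c ^ 2 + s ^ 2 = 1) : USp n :=
  USp.diag (Function.update 1 i ⟨Quaternion.reJ c s, Quaternion.reJ_mem_unitary h⟩)

theorem uspHom_uspTwist (i : Fin n) {c s : ℝ} (h : c ^ 2 + s ^ 2 = 1) :
    uspHom n (uspTwist i h) =
      blockDiagonal (Function.update 1 i !![(c : ℂ), (s : ℂ); -(s : ℂ), (c : ℂ)]) := by
  rw [uspHom_apply, uspTwist, USp.diag, complexify_diagonal]
  congr 1
  funext k
  by_cases hk : k = i
  · subst hk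
    ext a b
    fin_cases a <;> fin_cases b <;> simp [quatMatrix] <;> apply Complex.ext <;> simp
  · simp [hk, quatMatrix_one]

theorem blockDiagonal_mulVec_single (N : Fin n → Matrix (Fin 2) (Fin 2) ℂ) (a : Fin 2)
    (i : Fin n) : blockDiagonal N *ᵥ Pi.single (a, i) 1 =
      N i 0 a • Pi.single (0, i) 1 + N i 1 a • Pi.single (1, i) 1 := by
  funext ⟨b, k⟩
  rw [mulVec_single_one, col_apply, blockDiagonal_apply]
  by_cases hk : k = i
  · subst hk
    fin_cases b <;> simp
  · simp [hk]

/-- The quaternion $\mathrm j$ at the place `i` exchanges the two basis vectors over `i` up to sign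
and fixes those over the other places. -/
theorem exists_usp_flip (a b : Fin 2) (i : Fin n) : ∃ (g : USp n) (u : ℂ), u * u = 1 ∧
    uspHom n g *ᵥ Pi.single (a, i) 1 = u • Pi.single (b, i) 1 ∧
    ∀ c, ∀ k ≠ i, uspHom n g *ᵥ Pi.single (c, k) 1 = Pi.single (c, k) 1 := by
  by_cases hab : a = b
  · subst hab
    exact ⟨1, 1, one_mul 1, by rw [map_one, Matrix.one_mulVec, one_smul],
      fun _ _ _ => by rw [map_one, Matrix.one_mulVec]⟩
  have hfix (c : Fin 2) (k : Fin n) (hk : k ≠ i) :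
      uspHom n (uspTwist i (c := 0) (s := 1) (by norm_num)) *ᵥ Pi.single (c, k) 1 =
        Pi.single (c, k) 1 := by
    rw [uspHom_uspTwist, blockDiagonal_mulVec_single, Function.update_of_ne hk, Pi.one_apply]
    obtain rfl | rfl : c = 0 ∨ c = 1 := by omega
    all_goals simp
  refine ⟨uspTwist i (c := 0) (s := 1) (by norm_num),
    (![-1, 1] : Fin 2 → ℂ) a, ?_, ?_, hfix⟩
  · fin_cases a <;> simp
  · rw [uspHom_uspTwist, blockDiagonal_mulVec_single, Function.update_self]
    fin_cases a <;> fin_cases b <;> simp at hab ⊢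

/-- A real signed permutation moves the places, then flips adjust the halves. The places must
differ: two vectors over one place pair non-trivially under the invariant form, while vectors over
different places do not. -/
theorem exists_usp_pair {x y x' y' : Fin 2 × Fin n} (hxy : x.2 ≠ y.2) (hxy' : x'.2 ≠ y'.2) :
    ∃ (g : USp n) (u v : ℂ), u * u = 1 ∧ v * v = 1 ∧
      uspHom n g *ᵥ Pi.single x 1 = u • Pi.single x' 1 ∧
      uspHom n g *ᵥ Pi.single y 1 = v • Pi.single y' 1 := by
  obtain ⟨a, i⟩ := x
  obtain ⟨b, k⟩ := y
  obtain ⟨a', i'⟩ := x'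
  obtain ⟨b', k'⟩ := y'
  simp only at hxy hxy'
  obtain ⟨g, u, v, hg1, hg2⟩ := exists_specialOrthogonal_pair hxy hxy'
  have hP := (specialOrthogonalGroup_iff.1 g.2).1
  have h1 (a : Fin 2) := uspHom_ofOrthogonal_single hP a (j := i') (s := 0)
    (c := ((u : ℤ) : ℂ)) (by rw [hg1, zero_smul, add_zero])
  have h2 (a : Fin 2) := uspHom_ofOrthogonal_single hP a (j := k') (s := 0)
    (c := ((v : ℤ) : ℂ)) (by rw [hg2, zero_smul, add_zero])
  simp only [zero_smul, add_zero] at h1 h2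
  obtain ⟨f, w, hw, hf1, hf2⟩ := exists_usp_flip a a' i'
  obtain ⟨f', w', hw', hf1', hf2'⟩ := exists_usp_flip b b' k'
  refine ⟨f' * f * USp.ofOrthogonal g.1 hP, u * w, v * w', ?_, ?_, ?_, ?_⟩
  · rw [mul_mul_mul_comm, hw, Int.cast_units_mul_self, one_mul]
  · rw [mul_mul_mul_comm, hw', Int.cast_units_mul_self, one_mul]
  · rw [map_mul, map_mul, ← mulVec_mulVec, ← mulVec_mulVec, h1, mulVec_smul, hf1, mulVec_smul,
      mulVec_smul, hf2' _ _ hxy', smul_smul]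
  · rw [map_mul, map_mul, ← mulVec_mulVec, ← mulVec_mulVec, h2, mulVec_smul, hf2 _ _ hxy'.symm,
      mulVec_smul, hf1', smul_smul]

end SymplecticMoves

/-! ### Irreducibility for the compact symplectic groups -/

section SymplecticRepresentations

open Matrix

variable {n : ℕ}

theorem pmWeight_apply (x : Fin 2 × Fin n) (l : Fin n) :
    pmWeight x l = if l = x.2 then (![1, -1] : Fin 2 → ℤ) x.1 else 0 := by
  rw [pmWeight, Pi.single_apply]

theorem sign_eq_or (a : Fin 2) : (a = 0 ∧ (![1, -1] : Fin 2 → ℤ) a = 1) ∨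
    (a = 1 ∧ (![1, -1] : Fin 2 → ℤ) a = -1) := by
  fin_cases a <;> simp

theorem pmWeight_injective : Function.Injective (pmWeight : Fin 2 × Fin n → Fin n → ℤ) := by
  rintro ⟨a, i⟩ ⟨b, k⟩ h
  have h1 := congrFun h i
  simp only [pmWeight_apply, if_true] at h1
  rcases sign_eq_or a with ⟨rfl, ha⟩ | ⟨rfl, ha⟩ <;> rcases sign_eq_or b with ⟨rfl, hb⟩ | ⟨rfl,
      hb⟩ <;>
    simp only [ha, hb] at h1 <;> split_ifs at h1 with hik <;> simp_all

/-- Weight zero has to be excluded, since every pair of opposite weights has sum zero; for other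
weights the torus isolates a single unordered pair of positions. -/
theorem pmWeight_add_eq {x y x' y' : Fin 2 × Fin n} (h0 : pmWeight x + pmWeight y ≠ 0)
    (h : pmWeight x' + pmWeight y' = pmWeight x + pmWeight y) :
    (x' = x ∧ y' = y) ∨ (x' = y ∧ y' = x) := by
  obtain ⟨a, i⟩ := x
  obtain ⟨b, k⟩ := y
  obtain ⟨a', i'⟩ := x'
  obtain ⟨b', k'⟩ := y'
  have h1 := congrFun h i
  have h2 := congrFun h k
  simp only [Pi.add_apply, pmWeight_apply, if_true] at h1 h2
  have h3 : ¬ (i = k ∧ (![1, -1] : Fin 2 → ℤ) a + (![1, -1] : Fin 2 → ℤ) b = 0) := by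
    rintro ⟨rfl, h3⟩
    refine h0 (funext fun l => ?_)
    simp only [Pi.add_apply, pmWeight_apply, Pi.zero_apply]
    split_ifs
    · exact h3
    · rfl
  simp only [Prod.mk.injEq]
  rcases sign_eq_or a with ⟨rfl, ha⟩ | ⟨rfl, ha⟩ <;>
    rcases sign_eq_or b with ⟨rfl, hb⟩ | ⟨rfl, hb⟩ <;>
    rcases sign_eq_or a' with ⟨rfl, ha'⟩ | ⟨rfl, ha'⟩ <;>
    rcases sign_eq_or b' with ⟨rfl, hb'⟩ | ⟨rfl, hb'⟩ <;>
    simp only [ha, hb, ha', hb'] at h1 h2 h3 <;> clear ha hb ha' hb' h h0 <;> grind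

variable {W : Submodule ℂ (Matrix (Fin 2 × Fin n) (Fin 2 × Fin n) ℂ)} {s : ℂ}
  {M : Matrix (Fin 2 × Fin n) (Fin 2 × Fin n) ℂ}

theorem mem_of_eq_on_weight (hW : ∀ g, ∀ M ∈ W, tensorRep (uspHom n) (uspHom n) g M ∈ W)
    (hM : M ∈ W) {x y : Fin 2 × Fin n} (hxy : pmWeight x + pmWeight y ≠ 0)
    {N : Matrix (Fin 2 × Fin n) (Fin 2 × Fin n) ℂ} (h₁ : N x y = M x y) (h₂ : N y x = M y x)
    (h₃ : ∀ x' y', ¬ (x' = x ∧ y' = y) → ¬ (x' = y ∧ y' = x) → N x' y' = 0) : N ∈ W := by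
  refine Submodule.mem_of_diagonal_stable (X := (Fin 2 × Fin n) × (Fin 2 × Fin n))
    (e := fun x => entryLinearMap ℂ ℂ x.1 x.2) (fun v hv => Matrix.ext fun x y => hv (x, y))
    (T := fun z => tensorRep (uspHom n) (uspHom n) (torusUSp z))
    (d := fun z x => torusChar (fun z => z) (pmWeight x.1 + pmWeight x.2) z) (fun z x v => ?_)
    (fun z => hW _) (x, y) hM (fun x' hx' => ?_) (fun x' hx' => ?_)
  · simp only [entryLinearMap_apply]
    rw [tensorRep_apply, uspHom_torusUSp, diagonal_transpose, mul_diagonal, diagonal_mul,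
      torusChar_add]
    ring
  · obtain ⟨x', y'⟩ := x'
    rcases pmWeight_add_eq hxy (torusChar_injective hx') with ⟨rfl, rfl⟩ | ⟨rfl, rfl⟩
    · exact h₁
    · exact h₂
  · obtain ⟨x', y'⟩ := x'
    obtain ⟨z, hz⟩ := hx'
    refine h₃ x' y' ?_ ?_
    · rintro ⟨rfl, rfl⟩
      exact hz rfl
    · rintro ⟨rfl, rfl⟩
      exact hz (by rw [add_comm])

theorem usp_smul_single_add_mem (hW : ∀ g, ∀ M ∈ W, tensorRep (uspHom n) (uspHom n) g M ∈ W)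
    (hM : M ∈ W) (hMs : Mᵀ = s • M) {x y : Fin 2 × Fin n} (hxy : pmWeight x + pmWeight y ≠ 0)
    (hne : x ≠ y) : M x y • (single x y 1 + s • single y x 1) ∈ W := by
  have hyx : M y x = s * M x y := congrFun (congrFun hMs x) y
  refine mem_of_eq_on_weight hW hM hxy ?_ ?_ fun x' y' h1 h2 => ?_
  · simp [hne.symm]
  · simp [hne.symm, hyx, mul_comm]
  · rw [Matrix.smul_apply, Matrix.add_apply, Matrix.smul_apply, single_apply, single_apply,
      if_neg (fun h => h1 ⟨h.1.symm, h.2.symm⟩), if_neg (fun h => h2 ⟨h.1.symm, h.2.symm⟩)]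
    simp

theorem pmWeight_add_self_ne_zero (x : Fin 2 × Fin n) : pmWeight x + pmWeight x ≠ 0 := by
  intro h
  have h1 := congrFun h x.2
  simp only [Pi.add_apply, pmWeight_apply, if_true, Pi.zero_apply] at h1
  rcases sign_eq_or x.1 with ⟨_, ha⟩ | ⟨_, ha⟩ <;> rw [ha] at h1 <;> omega

theorem pmWeight_add_ne_zero {x y : Fin 2 × Fin n} (hxy : x.2 ≠ y.2) :
    pmWeight x + pmWeight y ≠ 0 := by
  intro h
  have h1 := congrFun h x.2
  simp only [Pi.add_apply, pmWeight_apply, if_true, Pi.zero_apply, if_neg hxy] at h1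
  rcases sign_eq_or x.1 with ⟨_, ha⟩ | ⟨_, ha⟩ <;> rw [ha] at h1 <;> omega

theorem usp_smul_single_mem (hW : ∀ g, ∀ M ∈ W, tensorRep (uspHom n) (uspHom n) g M ∈ W)
    (hM : M ∈ W) (x : Fin 2 × Fin n) : M x x • single x x 1 ∈ W := by
  refine mem_of_eq_on_weight hW hM (pmWeight_add_self_ne_zero x) ?_ ?_ fun x' y' h1 _ => ?_
  · simp
  · simp
  · rw [Matrix.smul_apply, single_apply, if_neg (fun h => h1 ⟨h.1.symm, h.2.symm⟩), smul_zero]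

theorem usp_single_add_mem (hW : ∀ g, ∀ M ∈ W, tensorRep (uspHom n) (uspHom n) g M ∈ W)
    {x y : Fin 2 × Fin n} (hxy : x.2 ≠ y.2) (h : single x y 1 + s • single y x 1 ∈ W)
    {x' y' : Fin 2 × Fin n} (hxy' : x'.2 ≠ y'.2) : single x' y' 1 + s • single y' x' 1 ∈ W := by
  obtain ⟨g, u, v, hu, hv, hk, hl⟩ := exists_usp_pair hxy hxy'
  have h1 := hW g _ h
  rw [map_add, map_smul, tensorRep_single, tensorRep_single, hk, hl] at h1
  simp only [smul_vecMulVec, vecMulVec_smul, vecMulVec_single_one_single_one, smul_smul] at h1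
  have h2 := W.smul_mem (u * v) h1
  have h3 : u * v * (u * v) = 1 := by rw [mul_mul_mul_comm, hu, hv, one_mul]
  convert h2 using 1
  linear_combination (norm := module) -h3 • (single x' y' 1 + s • single y' x' (1 : ℂ))

theorem exists_snd_ne (hn : 2 ≤ n) (x : Fin 2 × Fin n) : ∃ y : Fin 2 × Fin n, x.2 ≠ y.2 := by
  have : Nontrivial (Fin n) := Fin.nontrivial_iff_two_le.2 hn
  obtain ⟨k, hk⟩ := exists_ne x.2
  exact ⟨(0, k), hk.symm⟩

theorem usp_single_self_mem (hn : 2 ≤ n)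
    (hW : ∀ g, ∀ M ∈ W, tensorRep (uspHom n) (uspHom n) g M ∈ W) {x : Fin 2 × Fin n}
    (h : single x x 1 ∈ W) (x' : Fin 2 × Fin n) : single x' x' 1 ∈ W := by
  obtain ⟨y, hy⟩ := exists_snd_ne hn x
  obtain ⟨y', hy'⟩ := exists_snd_ne hn x'
  obtain ⟨g, u, v, hu, hv, hk, hl⟩ := exists_usp_pair hy hy'
  have h1 := hW g _ h
  rw [tensorRep_single, hk] at h1
  simpa only [smul_vecMulVec, vecMulVec_smul, vecMulVec_single_one_single_one, smul_smul, hu,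
    one_smul] using h1

theorem irreducibleOn_usp_standard (hn : 2 ≤ n) : IrreducibleOn (vecRep (uspHom n)) ⊤ := by
  intro W _ hW0 hW
  obtain ⟨v, hv, hv0⟩ := W.ne_bot_iff.1 hW0
  obtain ⟨k, hk⟩ := Function.ne_iff.1 hv0
  have hsingle : v k • (Pi.single k 1 : Fin 2 × Fin n → ℂ) ∈ W := by
    refine Submodule.mem_of_diagonal_stable (X := Fin 2 × Fin n) (e := fun x => LinearMap.proj x)
      (fun v hv => funext hv) (T := fun z => vecRep (uspHom n) (torusUSp z))
      (d := fun z x => torusChar (fun z => z) (pmWeight x) z) (fun z x v => ?_) (fun z => hW _)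
      k hv (fun x hx => ?_) (fun x hx => ?_)
    · rw [vecRep_apply, uspHom_torusUSp, LinearMap.proj_apply, mulVec_diagonal]
      rfl
    · rw [pmWeight_injective (torusChar_injective hx)]
      simp
    · obtain ⟨z, hz⟩ := hx
      have : x ≠ k := by
        rintro rfl
        exact hz rfl
      simp [this]
  have hk1 := (W.smul_mem_iff hk).1 hsingle
  intro v _
  rw [pi_eq_sum_univ' v]
  refine W.sum_mem fun x _ => W.smul_mem _ ?_
  obtain ⟨y, hy⟩ := exists_snd_ne hn k
  obtain ⟨y', hy'⟩ := exists_snd_ne hn x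
  obtain ⟨g, u, -, hu, -, hgk, -⟩ := exists_usp_pair hy hy'
  have h1 := W.smul_mem u (hW g _ hk1)
  rwa [vecRep_apply, hgk, smul_smul, hu, one_smul] at h1

theorem irreducibleOn_usp_symm (hn : 2 ≤ n) :
    IrreducibleOn (tensorRep (uspHom n) (uspHom n)) (tracelessSub 1 (symplecticForm n)) := by
  intro W hWle hW0 hW
  obtain ⟨M, hM, hM0⟩ := W.ne_bot_iff.1 hW0
  have hMs := (hWle hM).1
  have hex : ∃ x, single x x 1 ∈ W := by
    by_cases hdiag : ∃ N ∈ W, ∃ x, N x x ≠ 0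
    · obtain ⟨N, hN, x, hx⟩ := hdiag
      exact ⟨x, (W.smul_mem_iff hx).1 (usp_smul_single_mem hW hN x)⟩
    -- If every element of `W` had zero diagonal, then applying a rotation or a twist and reading a
    -- diagonal entry would make the off-diagonal entries of `M` vanish too.
    push Not at hdiag
    exfalso
    have hoff {x y : Fin 2 × Fin n} (hxy : x.2 ≠ y.2) : M x y = 0 := by
      by_contra hne
      have h1 := (W.smul_mem_iff hne).1 (usp_smul_single_add_mem hW hM hMs
        (pmWeight_add_ne_zero hxy) (fun h => hxy (congrArg Prod.snd h)))
      have h2 := usp_single_add_mem hW hxy h1 (x' := (0, x.2)) (y' := (0, y.2)) hxy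
      obtain ⟨g, hg⟩ := exists_usp_rotation hxy
      have h3 := hdiag _ (hW g _ h2) (0, x.2)
      rw [map_add, map_smul, tensorRep_single, tensorRep_single, (hg 0).1, (hg 0).2] at h3
      simp [vecMulVec_apply, hxy] at h3
      norm_num at h3
    refine hM0 (Matrix.ext fun ⟨a, i⟩ ⟨b, k⟩ => ?_)
    by_cases hik : i = k
    · subst hik
      have h1 := hdiag _ (hW (uspTwist i (c := 3 / 5) (s := 4 / 5) (by norm_num)) _ hM) (0, i)
      rw [tensorRep_apply, uspHom_uspTwist, Matrix.mul_assoc, blockDiagonal_mul_apply,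
        blockDiagonal_transpose] at h1
      simp only [mul_blockDiagonal_apply, Fin.sum_univ_two, Function.update_self] at h1
      have h01 : M (1, i) (0, i) = M (0, i) (1, i) := by
        simpa using congrFun (congrFun hMs (0, i)) (1, i)
      -- With $c=3/5$ and $s=4/5$ the new diagonal entry is $2cs=24/25$ times this one.
      have h2 : M (0, i) (1, i) = 0 := by
        simp [hdiag M hM, h01] at h1
        linear_combination (25 / 24) * h1
      obtain rfl | rfl : a = 0 ∨ a = 1 := by omega
      all_goals obtain rfl | rfl : b = 0 ∨ b = 1 := by omega
      · exact hdiag M hM _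
      · exact h2
      · exact h01.trans h2
      · exact hdiag M hM _
    · exact hoff hik
  obtain ⟨x, hx⟩ := hex
  have hall := usp_single_self_mem hn hW hx
  have hpair {x y : Fin 2 × Fin n} (hxy : x.2 ≠ y.2) :
      single x y 1 + (1 : ℂ) • single y x 1 ∈ W := by
    refine usp_single_add_mem hW (x := (0, x.2)) (y := (0, y.2)) hxy ?_ hxy
    obtain ⟨g, hg⟩ := exists_usp_rotation hxy
    have h1 := hW g _ (hall (0, x.2))
    rw [tensorRep_single, (hg 0).1] at h1
    simp only [smul_vecMulVec, vecMulVec_smul, vecMulVec_add, add_vecMulVec,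
      vecMulVec_single_one_single_one] at h1
    have h2 := W.add_mem (W.smul_mem (-25 / 12) h1) (W.add_mem
      (W.smul_mem (9 / 12) (hall (0, x.2))) (W.smul_mem (16 / 12) (hall (0, y.2))))
    convert h2 using 1
    module
  have hopp (i : Fin n) : single (0, i) (1, i) 1 + (1 : ℂ) • single (1, i) (0, i) 1 ∈ W := by
    have h1 := hW (uspTwist i (c := 3 / 5) (s := 4 / 5) (by norm_num)) _ (hall (0, i))
    rw [tensorRep_single, uspHom_uspTwist, blockDiagonal_mulVec_single, Function.update_self] at h1
    simp only [smul_vecMulVec, vecMulVec_smul, vecMulVec_add, add_vecMulVec,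
      vecMulVec_single_one_single_one, of_apply, cons_val', cons_val_zero, cons_val_one] at h1
    push_cast at h1
    have h2 := W.add_mem (W.smul_mem (-25 / 12) h1) (W.add_mem
      (W.smul_mem (9 / 12) (hall (0, i))) (W.smul_mem (16 / 12) (hall (1, i))))
    convert h2 using 1
    module
  refine tracelessSub_le (by norm_num) (Q := 0) fun x y => ?_
  rw [smul_zero, sub_zero]
  obtain ⟨a, i⟩ := x
  obtain ⟨b, k⟩ := y
  by_cases hik : i = k
  · subst hik
    obtain rfl | rfl : a = 0 ∨ a = 1 := by omega
    all_goals obtain rfl | rfl : b = 0 ∨ b = 1 := by omega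
    · exact W.add_mem (hall _) (W.smul_mem _ (hall _))
    · exact hopp i
    · have := hopp i
      rwa [one_smul, add_comm, ← one_smul ℂ (single (0, i) (1, i) (1 : ℂ))] at this
    · exact W.add_mem (hall _) (W.smul_mem _ (hall _))
  · exact hpair hik

theorem exists_usp_swap (i k : Fin n) : ∃ g : USp n, ∀ M a b l m,
    tensorRep (uspHom n) (uspHom n) g M (a, l) (b, m) =
      M (a, Equiv.swap i k l) (b, Equiv.swap i k m) := by
  have hP : (signedPerm (Equiv.swap i k) 1)ᵀ * signedPerm (Equiv.swap i k) 1 = 1 :=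
    mul_eq_one_comm.1 (signedPerm_mul_transpose _ 1)
  refine ⟨USp.ofOrthogonal _ hP, fun M a b l m => ?_⟩
  have h : uspHom n (USp.ofOrthogonal _ hP) =
      (signedPerm (Equiv.prodCongr (Equiv.refl (Fin 2)) (Equiv.swap i k)) 1).map
        (algebraMap ℝ ℂ) := by
    ext ⟨a, l⟩ ⟨b, m⟩
    rw [uspHom_ofOrthogonal_apply, map_apply]
    by_cases hab : a = b <;> by_cases hlm : Equiv.swap i k l = m <;> simp [signedPerm, hab, hlm]
  rw [tensorRep_apply, h, signedPerm_map_conj]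
  simp

theorem irreducibleOn_usp_skew (hn : 2 ≤ n) :
    IrreducibleOn (tensorRep (uspHom n) (uspHom n)) (tracelessSub (-1) (symplecticForm n)) := by
  intro W hWle hW0 hW
  obtain ⟨M, hM, hM0⟩ := W.ne_bot_iff.1 hW0
  have hMs := (hWle hM).1
  have hMt := (hWle hM).2
  have hskew (x y) : M y x = - M x y := by simpa using congrFun (congrFun hMs x) y
  have hself (x) : M x x = 0 := self_eq_neg.1 (hskew x x)
  have hex : ∃ N ∈ W, ∃ x y : Fin 2 × Fin n, x.2 ≠ y.2 ∧ N x y ≠ 0 := by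
    by_cases hod : ∃ x y : Fin 2 × Fin n, x.2 ≠ y.2 ∧ M x y ≠ 0
    · exact ⟨M, hM, hod⟩
    push Not at hod
    -- What remains is a multiple of the symplectic block over each place; were these multiples
    -- equal, the trace condition would make them zero.
    have hne : ∃ i k, M (0, i) (1, i) ≠ M (0, k) (1, k) := by
      by_contra! hall
      have h1 : (M * symplecticForm n).trace = -2 * ∑ i, M (0, i) (1, i) := by
        rw [Matrix.trace, Fintype.sum_prod_type_right, Finset.mul_sum]
        refine Finset.sum_congr rfl fun i _ => ?_
        rw [Fin.sum_univ_two, diag_apply, diag_apply, symplecticForm, mul_blockDiagonal_apply,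
          mul_blockDiagonal_apply, Fin.sum_univ_two, Fin.sum_univ_two, hskew (0, i) (1, i)]
        simp
        ring
      rw [hMt] at h1
      have h2 (i) : M (0, i) (1, i) = 0 := by
        simp only [fun x => hall x i, Finset.sum_const, Finset.card_univ, Fintype.card_fin,
          nsmul_eq_mul] at h1
        have hn0 : (n : ℂ) ≠ 0 := Nat.cast_ne_zero.2 (by omega)
        have := h1.symm
        simpa [hn0] using this
      refine hM0 (Matrix.ext fun ⟨a, i⟩ ⟨b, k⟩ => ?_)
      by_cases hik : i = k
      · subst hik
        obtain rfl | rfl : a = 0 ∨ a = 1 := by omega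
        all_goals obtain rfl | rfl : b = 0 ∨ b = 1 := by omega
        · exact hself _
        · exact h2 i
        · rw [hskew (0, i) (1, i), h2]
          simp
        · exact hself _
      · exact hod _ _ hik
    obtain ⟨i, k, hne⟩ := hne
    have hik : i ≠ k := fun h => hne (by rw [h])
    obtain ⟨g, hg⟩ := exists_usp_swap i k
    have h1 := W.sub_mem hM (hW g _ hM)
    -- Exchanging two places isolates the difference of two symplectic blocks; a rotation then
    -- creates an entry between different places.
    have h2 : M - tensorRep (uspHom n) (uspHom n) g M = (M (0, i) (1, i) - M (0, k) (1, k)) •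
        ((single (0, i) (1, i) 1 - single (1, i) (0, i) 1) -
          (single (0, k) (1, k) 1 - single (1, k) (0, k) (1 : ℂ))) := by
      ext ⟨a, l⟩ ⟨b, m⟩
      rw [Matrix.sub_apply, hg]
      by_cases hlm : l = m
      · subst hlm
        by_cases hab : a = b
        · subst hab
          rw [hself, hself]
          obtain rfl | rfl : a = 0 ∨ a = 1 := by omega
          all_goals simp
        by_cases hli : l = i
        · subst hli
          obtain rfl | rfl : a = 0 ∨ a = 1 := by omega
          all_goals obtain rfl | rfl : b = 0 ∨ b = 1 := by omega
          all_goals first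
            | exact absurd rfl hab
            | simp [hik.symm, hskew (0, l) (1, l), hskew (0, k) (1, k)]
          all_goals ring
        by_cases hlk : l = k
        · subst hlk
          obtain rfl | rfl : a = 0 ∨ a = 1 := by omega
          all_goals obtain rfl | rfl : b = 0 ∨ b = 1 := by omega
          all_goals first
            | exact absurd rfl hab
            | simp [hik, hskew (0, i) (1, i), hskew (0, l) (1, l)]
          all_goals ring
        · rw [Equiv.swap_apply_of_ne_of_ne hli hlk]
          simp [Ne.symm hli, Ne.symm hlk]
      · rw [hod (a, l) (b, m) hlm, hod _ _ fun h => hlm ((Equiv.swap i k).injective h)]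
        have h3 (c d e f : Fin 2) (j : Fin n) : single (c, j) (d, j) (1 : ℂ) (e, l) (f, m) = 0 := by
          rw [single_apply, if_neg]
          rintro ⟨h, h'⟩
          exact hlm ((congrArg Prod.snd h).symm.trans (congrArg Prod.snd h'))
        simp [h3]
    rw [h2] at h1
    have h3 := (W.smul_mem_iff (sub_ne_zero.2 hne)).1 h1
    obtain ⟨g, hg⟩ := exists_usp_rotation hik
    refine ⟨_, hW g _ h3, (0, i), (1, k), hik, ?_⟩
    simp only [map_sub, tensorRep_single, (hg _).1, (hg _).2]
    simp [vecMulVec_apply, hik, hik.symm]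
    norm_num
  obtain ⟨N, hN, x, y, hxy, hne⟩ := hex
  have h1 := (W.smul_mem_iff hne).1 (usp_smul_single_add_mem hW hN (hWle hN).1
    (pmWeight_add_ne_zero hxy) (fun h => hxy (congrArg Prod.snd h)))
  have hpair {x' y' : Fin 2 × Fin n} (hxy' : x'.2 ≠ y'.2) := usp_single_add_mem hW hxy h1 hxy'
  have hdiff (i k : Fin n) : (single (0, i) (1, i) 1 - single (1, i) (0, i) 1) -
      (single (0, k) (1, k) 1 - single (1, k) (0, k) (1 : ℂ)) ∈ W := by
    by_cases hik : i = k
    · subst hik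
      rw [sub_self]
      exact W.zero_mem
    obtain ⟨g, hg⟩ := exists_usp_rotation hik
    have h2 := hpair (x' := (0, i)) (y' := (1, k)) hik
    have h2' := hpair (x' := (0, k)) (y' := (1, i)) (Ne.symm hik)
    have h3 := hW g _ h2
    simp only [map_add, map_smul, tensorRep_single, (hg _).1, (hg _).2, smul_vecMulVec,
      vecMulVec_smul, vecMulVec_add, add_vecMulVec, vecMulVec_single_one_single_one] at h3
    -- Rotating a generator between the places `i` and `k` yields the difference of the two blocks
    -- with coefficient $12/25$; the other two terms are removed.
    have h4 := W.add_mem (W.smul_mem (25 / 12) h3) (W.add_mem (W.smul_mem (-9 / 12) h2)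
      (W.smul_mem (16 / 12) h2'))
    convert h4 using 1
    module
  -- The symplectic block over the first place is the reference: a block lies in `W` only modulo it.
  refine tracelessSub_le (by norm_num)
    (Q := -(single (0, ⟨0, by omega⟩) (1, ⟨0, by omega⟩) 1 -
      single (1, ⟨0, by omega⟩) (0, ⟨0, by omega⟩) (1 : ℂ))) fun x y => ?_
  obtain ⟨a, i⟩ := x
  obtain ⟨b, k⟩ := y
  by_cases hik : i = k
  · subst hik
    have h2 := hdiff i ⟨0, by omega⟩
    rw [symplecticForm, blockDiagonal_apply, if_pos rfl]
    obtain rfl | rfl : a = 0 ∨ a = 1 := by omega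
    all_goals obtain rfl | rfl : b = 0 ∨ b = 1 := by omega
    · convert W.zero_mem using 1
      simp
    · convert h2 using 1
      simp
      module
    · convert W.neg_mem h2 using 1
      simp
      module
    · convert W.zero_mem using 1
      simp
  · rw [symplecticForm, blockDiagonal_apply, if_neg (Ne.symm hik), zero_smul, sub_zero]
    exact hpair hik

end SymplecticRepresentations

/-! ### The theorem for the compact symplectic groups -/

section SymplecticSquare

variable {n : ℕ}

theorem standard_character_sq_USp (hn : 2 ≤ n) :
    (∃! χ, IsCharUSp n (hookLabel n 1 0) χ) ∧ (∃! χ, IsCharUSp n (hookLabel n 2 0) χ) ∧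
      (∃! χ, IsCharUSp n (twoOnesLabel n) χ) ∧ (∃! χ, IsCharUSp n 0 χ) ∧
      ∀ χ₁ χ₂ χ₁₁ χ₀ : USp n → ℂ,
        IsCharUSp n (hookLabel n 1 0) χ₁ → IsCharUSp n (hookLabel n 2 0) χ₂ →
        IsCharUSp n (twoOnesLabel n) χ₁₁ → IsCharUSp n 0 χ₀ →
        ∀ g, (χ₁ g).im = 0 ∧ χ₀ g = 1 ∧ χ₁ g ^ 2 = χ₂ g + χ₁₁ g + χ₀ g := by
  have hA (i j : Fin n) (hij : i ≤ j) : (Pi.single i 1 - Pi.single j 1 : Fin n → ℤ) ∈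
      AddSubmonoid.closure (simpleRootsC n) :=
    AddSubmonoid.closure_mono (fun _ => Or.inl) (single_sub_single_mem_closure hij)
  exact standard_character_sq continuous_uspHom hn isMaximalTorus_USp
    (isDominantList_of_flip hn (weightedSum_simpleRootsC (fun i j hij => by
      simp only [stairs]; omega) (fun i => by simp only [stairs]; omega))
      (weightedSum_simpleRootsC (fun _ _ _ => le_rfl) (fun _ => zero_le_one))
      USp.exists_swap USp.exists_flip)
    diagonalizes_USp (k₀ := (0, ⟨0, by omega⟩)) (k₁ := (0, ⟨1, by omega⟩)) (by simp)
    (pmWeight_zero_eq _) (pmWeight_zero_add_eq hn)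
    (fun k => pmWeight_zero_sub_mem (hA _) (single_add_single_mem_closure_simpleRootsC _)
      fun _ => Fin.le_def.2 (Nat.zero_le _))
    (fun k hk => pmWeight_zero_sub_mem (hA _) (single_add_single_mem_closure_simpleRootsC _)
      fun h => le_of_ne_zero_pair hn hk h)
    (trace_symplecticForm_mul_self (by omega)) transpose_symplecticForm uspHom_symplecticForm
    transpose_uspHom_symplecticForm trace_uspHom_im (irreducibleOn_usp_standard hn)
    (irreducibleOn_usp_symm hn) (irreducibleOn_usp_skew hn)

end SymplecticSquare

/-! ### The theorem for the special unitary groups -/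

section SpecialUnitary

open Matrix

variable {n : ℕ}

/-- The standard representation of `SU(n)`, as matrices. -/
def suHom (n : ℕ) : SUn n →* Matrix (Fin n) (Fin n) ℂ := Submonoid.subtype _

/-- The complex conjugate of the standard representation of `SU(n)`, as matrices. -/
noncomputable def suConj (n : ℕ) : SUn n →* Matrix (Fin n) (Fin n) ℂ :=
  ((starRingEnd ℂ).mapMatrix (m := Fin n)).toMonoidHom.comp (suHom n)

theorem suHom_apply (g : SUn n) : suHom n g = g.1 := rfl

theorem suConj_apply (g : SUn n) : suConj n g = g.1.map (starRingEnd ℂ) := rfl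

theorem continuous_suHom : Continuous fun g => suHom n g := continuous_subtype_val

theorem continuous_suConj : Continuous fun g => suConj n g :=
  continuous_subtype_val.matrix_map Complex.continuous_conj

theorem suHom_ofSO (P : specialOrthogonalGroup (Fin n) ℝ) :
    suHom n (SUn.ofSO P) = P.1.map (algebraMap ℝ ℂ) := rfl

theorem suConj_ofSO (P : specialOrthogonalGroup (Fin n) ℝ) :
    suConj n (SUn.ofSO P) = P.1.map (algebraMap ℝ ℂ) := by
  ext i j
  exact Complex.conj_ofReal _

theorem suHom_mul_suConj_transpose (g : SUn n) : suHom n g * (suConj n g)ᵀ = 1 :=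
  mem_unitaryGroup_iff.1 (mem_specialUnitaryGroup_iff.1 g.2).1

theorem trace_suConj (g : SUn n) : (suConj n g).trace = starRingEnd ℂ (suHom n g).trace := by
  rw [Matrix.trace, Matrix.trace, map_sum]
  rfl

theorem diagonalizes_suHom : Diagonalizes torusSU (fun z : SUTorus n => z.1) (suHom n)
    (fun k => Pi.single k 1) 1 1 where
  inv_mul := one_mul 1
  mul_torus a := by
    rw [Matrix.one_mul, Matrix.mul_one, suHom_apply, torusSU_coe]
    simp only [torusChar_single, zpow_one]

theorem diagonalizes_suConj : Diagonalizes torusSU (fun z : SUTorus n => z.1) (suConj n)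
    (fun k => Pi.single k (-1)) 1 1 where
  inv_mul := one_mul 1
  mul_torus a := by
    rw [Matrix.one_mul, Matrix.mul_one, suConj_apply, torusSU_coe, diagonal_map (map_zero _)]
    simp only [torusChar_single, _root_.zpow_neg, zpow_one, ← Circle.coe_inv,
      Circle.coe_inv_eq_conj]

theorem SUTorus.eq_of_torusChar_eq {x y : Fin n → ℤ} (hxy : ∑ i, x i = ∑ i, y i)
    (h : ∀ a : SUTorus n, torusChar (fun z : SUTorus n => z.1) x a =
      torusChar (fun z : SUTorus n => z.1) y a) : x = y :=
  sub_eq_zero.1 <| SUTorus.eq_zero_of_torusChar_eq_one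
    (by simp [Finset.sum_sub_distrib, hxy]) fun a => by
      rw [torusChar_sub, h, div_self (torusChar_ne_zero _ _ _)]

/-- The standard representation and its conjugate are the cases `ε = 1` and `ε = -1`; they agree on
the real matrices that move the basis vectors. -/
theorem irreducibleOn_su_vecRep (hn : 2 ≤ n) {τ : SUn n →* Matrix (Fin n) (Fin n) ℂ}
    (hτ : ∀ P, τ (SUn.ofSO P) = P.1.map (algebraMap ℝ ℂ)) {ε : ℤ} (hε : ε ≠ 0)
    (hD : Diagonalizes torusSU (fun z : SUTorus n => z.1) τ (fun k => Pi.single k ε) 1 1) :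
    IrreducibleOn (vecRep τ) ⊤ := by
  intro W _ hW0 hW
  obtain ⟨v, hv, hv0⟩ := W.ne_bot_iff.1 hW0
  obtain ⟨k, hk⟩ := Function.ne_iff.1 hv0
  have hsingle : v k • (Pi.single k 1 : Fin n → ℂ) ∈ W := by
    refine Submodule.mem_of_diagonal_stable (X := Fin n) (e := fun x => LinearMap.proj x)
      (fun v hv => funext hv) (T := fun a => vecRep τ (torusSU a))
      (d := fun a x => torusChar (fun z : SUTorus n => z.1) (Pi.single x ε) a)
      (fun a x v => ?_) (fun a => hW _) k hv (fun x hx => ?_) (fun x hx => ?_)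
    · have h := hD.mul_torus a
      rw [Matrix.one_mul, Matrix.mul_one] at h
      rw [vecRep_apply, h, LinearMap.proj_apply, LinearMap.proj_apply, mulVec_diagonal]
    · have h := congrFun (SUTorus.eq_of_torusChar_eq (by simp) hx) k
      have hxk : x = k := by
        by_contra hxk
        rw [Pi.single_eq_same, Pi.single_eq_of_ne (Ne.symm hxk)] at h
        exact hε h.symm
      simp [hxk]
    · obtain ⟨a, ha⟩ := hx
      have : x ≠ k := by
        rintro rfl
        exact ha rfl
      simp [this]
  have hk1 := (W.smul_mem_iff hk).1 hsingle
  have : Nontrivial (Fin n) := Fin.nontrivial_iff_two_le.2 hn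
  obtain ⟨l, hl⟩ := exists_ne k
  have hall (x : Fin n) : (Pi.single x 1 : Fin n → ℂ) ∈ W := by
    obtain ⟨y, hy⟩ := exists_ne x
    obtain ⟨g, u, _, hu, -⟩ := exists_specialOrthogonal_pair hl.symm hy.symm
    have h1 := hW (SUn.ofSO g) _ hk1
    rw [vecRep_apply, hτ, hu] at h1
    refine (W.smul_mem_iff ?_).1 h1
    simp
  intro v _
  rw [pi_eq_sum_univ' v]
  exact W.sum_mem fun x _ => W.smul_mem _ (hall x)

/-- The adjoint representation of `SU(n)`, extended to all matrices. -/
noncomputable abbrev suAd (n : ℕ) : Representation ℂ (SUn n) (Matrix (Fin n) (Fin n) ℂ) :=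
  tensorRep (suHom n) (suConj n)

theorem suAd_torus_apply (a : SUTorus n) (M : Matrix (Fin n) (Fin n) ℂ) (x y : Fin n) :
    suAd n (torusSU a) M x y =
      torusChar (fun z : SUTorus n => z.1) (Pi.single x 1 + Pi.single y (-1)) a * M x y := by
  have h₁ := diagonalizes_suHom.mul_torus a
  have h₂ := diagonalizes_suConj.mul_torus a
  rw [Matrix.one_mul, Matrix.mul_one] at h₁ h₂
  rw [tensorRep_apply, h₁, h₂, diagonal_transpose, mul_diagonal, diagonal_mul, torusChar_add]
  ring

theorem suAd_ofSO_single (P : specialOrthogonalGroup (Fin n) ℝ) (k l : Fin n) :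
    suAd n (SUn.ofSO P) (single k l 1) = vecMulVec (P.1.map (algebraMap ℝ ℂ) *ᵥ Pi.single k 1)
      (P.1.map (algebraMap ℝ ℂ) *ᵥ Pi.single l 1) := by
  rw [tensorRep_single, suHom_ofSO, suConj_ofSO]

variable {W : Submodule ℂ (Matrix (Fin n) (Fin n) ℂ)}

/-- The weights $e^k-e^l$ with $k\ne l$ are pairwise distinct and non-zero, so the torus isolates
one off-diagonal matrix unit. -/
theorem single_mem_of_suAd_invariant (hW : ∀ g, ∀ M ∈ W, suAd n g M ∈ W)
    {M : Matrix (Fin n) (Fin n) ℂ} (hM : M ∈ W) {k l : Fin n} (hkl : k ≠ l) (h0 : M k l ≠ 0) :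
    single k l 1 ∈ W := by
  refine (W.smul_mem_iff h0).1 ?_
  refine Submodule.mem_of_diagonal_stable (X := Fin n × Fin n)
    (e := fun x => entryLinearMap ℂ ℂ x.1 x.2) (fun v hv => Matrix.ext fun x y => hv (x, y))
    (T := fun a => suAd n (torusSU a))
    (d := fun a x => torusChar (fun z : SUTorus n => z.1) (Pi.single x.1 1 + Pi.single x.2 (-1)) a)
    (fun a x v => ?_) (fun a => hW _) (k, l) hM (fun x hx => ?_) (fun x hx => ?_)
  · simp only [entryLinearMap_apply]
    exact suAd_torus_apply a v x.1 x.2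
  · obtain ⟨x, y⟩ := x
    have h := SUTorus.eq_of_torusChar_eq (by simp [Finset.sum_add_distrib]) hx
    have hk := congrFun h k
    have hl := congrFun h l
    simp only [Pi.add_apply, Pi.single_apply, if_true, if_neg hkl, if_neg hkl.symm] at hk hl
    have hxy : k = x ∧ l = y := by
      constructor
      · by_contra hx
        rw [if_neg hx] at hk
        split_ifs at hk <;> omega
      · by_contra hy
        rw [if_neg hy] at hl
        split_ifs at hl <;> omega
    obtain ⟨rfl, rfl⟩ := hxy
    simp
  · obtain ⟨x, y⟩ := x
    obtain ⟨a, ha⟩ := hx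
    simp only [entryLinearMap_apply]
    rw [Matrix.smul_apply, single_apply, if_neg, smul_zero]
    rintro ⟨rfl, rfl⟩
    exact ha rfl

theorem irreducibleOn_suAd (hn : 2 ≤ n) :
    IrreducibleOn (suAd n) (LinearMap.ker (traceLinearMap (Fin n) ℂ ℂ)) := by
  intro W hWle hW0 hW
  obtain ⟨M, hM, hM0⟩ := W.ne_bot_iff.1 hW0
  have hMt : M.trace = 0 := hWle hM
  have hex : ∃ k l : Fin n, k ≠ l ∧ single k l 1 ∈ W := by
    by_cases hod : ∃ k l, k ≠ l ∧ M k l ≠ 0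
    · obtain ⟨k, l, hkl, h⟩ := hod
      exact ⟨k, l, hkl, single_mem_of_suAd_invariant hW hM hkl h⟩
    · push Not at hod
      have : Nonempty (Fin n) := ⟨⟨0, by omega⟩⟩
      obtain ⟨k, l, hne⟩ := exists_diag_ne_of_trace_eq_zero hod hM0 hMt
      have hkl : k ≠ l := fun h => hne (by rw [h])
      obtain ⟨ε, hε⟩ := exists_signedPerm_mem (Equiv.swap k l)
      have h1 : single k k 1 - single l l 1 ∈ W := by
        refine (W.smul_mem_iff (sub_ne_zero.2 hne)).1 ?_
        rw [← sub_signedPerm_swap_conj hod hkl ε]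
        have h := hW (SUn.ofSO ⟨_, hε⟩) M hM
        rw [tensorRep_apply, suHom_ofSO, suConj_ofSO] at h
        exact W.sub_mem hM h
      obtain ⟨g, hgk, hgl⟩ := exists_specialOrthogonal_rotation hkl
      have h2 := hW (SUn.ofSO g) _ h1
      rw [map_sub, suAd_ofSO_single, suAd_ofSO_single, hgk, hgl] at h2
      refine ⟨k, l, hkl, single_mem_of_suAd_invariant hW h2 hkl ?_⟩
      simp [vecMulVec_apply, hkl, hkl.symm]
      norm_num
  obtain ⟨k, l, hkl, h⟩ := hex
  have hoff {x y : Fin n} (hxy : x ≠ y) : single x y 1 ∈ W := by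
    obtain ⟨g, u, v, hk, hl⟩ := exists_specialOrthogonal_pair hkl hxy
    have h1 := hW (SUn.ofSO g) _ h
    rw [suAd_ofSO_single, hk, hl] at h1
    simp only [smul_vecMulVec, vecMulVec_smul, vecMulVec_single_one_single_one] at h1
    refine (W.smul_mem_iff ?_).1 ((W.smul_mem_iff ?_).1 h1) <;> simp
  have hdiag {x y : Fin n} (hxy : x ≠ y) : single x x 1 - single y y 1 ∈ W := by
    obtain ⟨g, hgk, hgl⟩ := exists_specialOrthogonal_rotation hxy
    have h1 := hW (SUn.ofSO g) _ (hoff hxy)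
    rw [suAd_ofSO_single, hgk, hgl] at h1
    simp only [smul_vecMulVec, vecMulVec_smul, vecMulVec_add, add_vecMulVec,
      vecMulVec_single_one_single_one] at h1
    -- Rotating $E_{xy}$ gives $\frac{12}{25}(E_{xx}-E_{yy})$ plus multiples of $E_{xy}$ and
    -- $E_{yx}$, which are removed.
    have h2 := W.add_mem (W.add_mem (W.smul_mem (25 / 12) h1)
      (W.smul_mem (-3 / 4) (hoff hxy))) (W.smul_mem (4 / 3) (hoff hxy.symm))
    convert h2 using 1
    module
  intro N hN
  have hN' : (N * 1).trace = 0 := by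
    rw [Matrix.mul_one]
    exact hN
  have hsum : N = ∑ x, ∑ y, N x y • single x y (1 : ℂ) := by
    conv_lhs => rw [matrix_eq_sum_single N]
    simp
  rw [hsum]
  refine Submodule.sum_smul_mem_of_trace_mul_eq_zero (Q := single k k 1) (fun x y => ?_) hN'
  by_cases hxy : x = y
  · subst hxy
    rw [one_apply_eq, one_smul]
    by_cases hxk : x = k
    · rw [hxk, sub_self]
      exact W.zero_mem
    · exact hdiag hxk
  · rw [one_apply_ne (Ne.symm hxy), zero_smul, sub_zero]
    exact hoff hxy

theorem suAd_one (g : SUn n) : suAd n g 1 = 1 := by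
  rw [tensorRep_apply, Matrix.mul_one, suHom_mul_suConj_transpose]

theorem trace_suAd_apply (g : SUn n) (M : Matrix (Fin n) (Fin n) ℂ) :
    (suAd n g M).trace = M.trace := by
  rw [tensorRep_apply, Matrix.mul_assoc, trace_mul_comm, Matrix.mul_assoc,
    mul_eq_one_comm.1 (suHom_mul_suConj_transpose g), Matrix.mul_one]

theorem isProj_ker_trace (hn : n ≠ 0) : LinearMap.IsProj
    (LinearMap.ker (traceLinearMap (Fin n) ℂ ℂ)) (LinearMap.id - traceProj 1 1) where
  map_mem M := by
    have h := trace_sub_traceProj_mul (J := (1 : Matrix (Fin n) (Fin n) ℂ)) (K := 1)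
      (by simpa using hn) M
    rwa [Matrix.mul_one] at h
  map_id M hM := by
    have h : M.trace = 0 := hM
    simp [traceProj_apply, h]

theorem isCharSU_standard (hn : 2 ≤ n) :
    IsCharSU n (hookLabel (n - 1) 1 0) fun g => (suHom n g).trace := by
  obtain ⟨m, rfl⟩ := Nat.exists_eq_add_of_le' hn
  have h := isHighestWeightCharacter_of_isProj (t := torusSU)
    (z := fun z : SUTorus (m + 2) => z.1) (P := simpleRootsA (m + 2))
    (lam := padZero (hookLabel (m + 2 - 1) 1 0)) (vecRep (suHom (m + 2)))
    (continuous_vecRep continuous_suHom) (p := LinearMap.id) (U := ⊤)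
    ⟨fun x => trivial, fun x _ => rfl⟩ (fun _ _ _ => trivial)
    (irreducibleOn_su_vecRep hn suHom_ofSO one_ne_zero diagonalizes_suHom)
    ⟨_, trivial, diagonalizes_suHom.col_ne_zero 0, fun a => by
      rw [padZero_hookLabel_one_zero]
      exact diagonalizes_suHom.mulVec_col a 0⟩
    (fun ω v _ hv hω => by
      obtain ⟨k, hk⟩ := diagonalizes_suHom.exists_of_vecRep hv hω
      refine ⟨_, single_sub_single_mem_closure (Fin.zero_le k), fun a => ?_⟩
      rw [hk, ← torusChar_add, padZero_hookLabel_one_zero, add_sub_cancel])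
  simp only [LinearMap.comp_id, trace_vecRep] at h
  exact h

theorem isCharSU_dual (hn : 2 ≤ n) : IsCharSU n (fun _ => 1) fun g => (suConj n g).trace := by
  obtain ⟨m, rfl⟩ := Nat.exists_eq_add_of_le' hn
  -- Modulo $(1,\dots,1)$ the label $(1,\dots,1,0)$ is $-e^n$, the highest weight of the conjugate
  -- representation.
  have hlam (a : SUTorus (m + 2)) : torusChar (fun z : SUTorus (m + 2) => z.1)
      (padZero fun _ : Fin (m + 2 - 1) => 1) a =
      torusChar (fun z : SUTorus (m + 2) => z.1) (Pi.single (Fin.last _) (-1)) a := by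
    rw [padZero_one, torusChar_sub, SUTorus.torusChar_one, Pi.single_neg, torusChar_neg, one_div]
  have h := isHighestWeightCharacter_of_isProj (t := torusSU)
    (z := fun z : SUTorus (m + 2) => z.1) (P := simpleRootsA (m + 2))
    (lam := padZero fun _ : Fin (m + 2 - 1) => 1) (vecRep (suConj (m + 2)))
    (continuous_vecRep continuous_suConj) (p := LinearMap.id) (U := ⊤)
    ⟨fun x => trivial, fun x _ => rfl⟩ (fun _ _ _ => trivial)
    (irreducibleOn_su_vecRep hn suConj_ofSO (by norm_num) diagonalizes_suConj)
    ⟨_, trivial, diagonalizes_suConj.col_ne_zero (Fin.last _), fun a => by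
      rw [hlam]
      exact diagonalizes_suConj.mulVec_col a _⟩
    (fun ω v _ hv hω => by
      obtain ⟨k, hk⟩ := diagonalizes_suConj.exists_of_vecRep hv hω
      refine ⟨_, single_sub_single_mem_closure (Fin.le_last k), fun a => ?_⟩
      rw [hk, ← torusChar_add, hlam, Pi.single_neg, Pi.single_neg]
      congr 1
      abel)
  simp only [LinearMap.comp_id, trace_vecRep] at h
  exact h

theorem isCharSU_adjoint (hn : 2 ≤ n) : IsCharSU n (hookLabel (n - 1) 2 1) fun g =>
    LinearMap.trace ℂ _ (suAd n g ∘ₗ (LinearMap.id - traceProj 1 1)) := by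
  obtain ⟨m, rfl⟩ := Nat.exists_eq_add_of_le' hn
  -- Modulo $(1,\dots,1)$ the label $(2,1,\dots,1,0)$ is the highest root $e^1-e^n$.
  have hlam (a : SUTorus (m + 2)) : torusChar (fun z : SUTorus (m + 2) => z.1)
      (padZero (hookLabel (m + 2 - 1) 2 1)) a =
      torusChar (fun z : SUTorus (m + 2) => z.1)
        (Pi.single 0 1 + Pi.single (Fin.last _) (-1)) a := by
    rw [padZero_hookLabel_two_one, add_sub_assoc, torusChar_add, SUTorus.torusChar_one, one_mul,
      Pi.single_neg, sub_eq_add_neg]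
  refine isHighestWeightCharacter_of_isProj (t := torusSU)
    (z := fun z : SUTorus (m + 2) => z.1) (P := simpleRootsA (m + 2)) (suAd (m + 2))
    (continuous_tensorRep continuous_suHom continuous_suConj) (isProj_ker_trace (by omega))
    (fun g M hM => (trace_suAd_apply g M).trans hM) (irreducibleOn_suAd hn)
    ⟨single 0 (Fin.last _) 1,
      trace_single_eq_of_ne (0 : Fin (m + 2)) (Fin.last (m + 1)) (1 : ℂ) (by simp [Fin.ext_iff]),
      fun h => ?_, fun a => ?_⟩ (fun ω M _ hM hω => ?_)
  · have := congrFun (congrFun h 0) (Fin.last _)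
    simp at this
  · ext x y
    rw [suAd_torus_apply, hlam, Matrix.smul_apply, smul_eq_mul, single_apply]
    split_ifs with hxy
    · rw [← hxy.1, ← hxy.2]
    · simp
  · obtain ⟨k, l, -, h⟩ := exists_of_tensorRep diagonalizes_suHom diagonalizes_suConj hM hω
    refine ⟨_, add_mem (single_sub_single_mem_closure (Fin.zero_le k))
      (single_sub_single_mem_closure (Fin.le_last l)), fun a => ?_⟩
    rw [h, ← torusChar_add, hlam, Pi.single_neg, Pi.single_neg]
    congr 1
    abel

/-- The scalar matrices form the invariant line of the conjugation action and account for the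
summand $1$. -/
theorem trace_suHom_mul_trace_suConj (hn : n ≠ 0) (g : SUn n) :
    (suHom n g).trace * (suConj n g).trace =
      LinearMap.trace ℂ _ (suAd n g ∘ₗ (LinearMap.id - traceProj 1 1)) + 1 := by
  have h := trace_comp_traceProj (J := (1 : Matrix (Fin n) (Fin n) ℂ)) (K := 1)
    (by simpa using hn) (f := suAd n g) (suAd_one g)
  rw [LinearMap.comp_sub, map_sub, LinearMap.comp_id, trace_tensorRep, h, sub_add_cancel]

theorem standard_character_normSq_SU (hn : 2 ≤ n) :
    (∃! χ, IsCharSU n (hookLabel (n - 1) 1 0) χ) ∧ (∃! χ, IsCharSU n (fun _ => 1) χ) ∧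
      (∃! χ, IsCharSU n (hookLabel (n - 1) 2 1) χ) ∧ (∃! χ, IsCharSU n 0 χ) ∧
      ∀ χ₁ χ₁' χ₂₁ χ₀ : SUn n → ℂ,
        IsCharSU n (hookLabel (n - 1) 1 0) χ₁ → IsCharSU n (fun _ => 1) χ₁' →
        IsCharSU n (hookLabel (n - 1) 2 1) χ₂₁ → IsCharSU n 0 χ₀ →
        ∀ g, χ₀ g = 1 ∧ ((‖χ₁ g‖ ^ 2 : ℝ) : ℂ) = χ₁ g * χ₁' g ∧
          χ₁ g * χ₁' g = χ₂₁ g + χ₀ g := by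
  have hc₀ : IsCharSU n 0 fun _ => 1 := by
    rw [IsCharSU, padZero_zero]
    exact isHighestWeightCharacter_one _ _ _
  have hu₁ {χ} (h : IsCharSU n (hookLabel (n - 1) 1 0) χ) : χ = fun g => (suHom n g).trace :=
    isMaximalTorus_SU.eq_of_isHighestWeightCharacter
      (isDominantList_SU_standard hn SUn.exists_swap) (Function.injective_of_subsingleton _)
      (χ := fun _ g => (suHom n g).trace) (fun _ => isCharSU_standard hn) (i := ()) h
  have hu₁' {χ} (h : IsCharSU n (fun _ => 1) χ) : χ = fun g => (suConj n g).trace :=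
    isMaximalTorus_SU.eq_of_isHighestWeightCharacter
      (isDominantList_SU_dual hn SUn.exists_swap) (Function.injective_of_subsingleton _)
      (χ := fun _ g => (suConj n g).trace) (fun _ => isCharSU_dual hn) (i := ()) h
  set f := fun g => LinearMap.trace ℂ _ (suAd n g ∘ₗ (LinearMap.id - traceProj 1 1)) with hf
  have hall : ∀ i, IsHighestWeightCharacter torusSU (fun z : SUTorus n => z.1) (simpleRootsA n)
      ((![padZero 0, padZero (hookLabel (n - 1) 2 1)] : Fin 2 → Fin n → ℤ) i)
      ((![fun _ => 1, f] : Fin 2 → SUn n → ℂ) i) := by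
    intro i
    fin_cases i
    exacts [hc₀, isCharSU_adjoint hn]
  have huniq {i : Fin 2} {χ'} (h : IsHighestWeightCharacter torusSU (fun z : SUTorus n => z.1)
      (simpleRootsA n)
      ((![padZero 0, padZero (hookLabel (n - 1) 2 1)] : Fin 2 → Fin n → ℤ) i) χ') :=
    isMaximalTorus_SU.eq_of_isHighestWeightCharacter
      (isDominantList_SU_adjoint hn SUn.exists_swap) (injective_weightedSum_padZero hn) hall h
  refine ⟨⟨_, isCharSU_standard hn, fun χ h => hu₁ h⟩, ⟨_, isCharSU_dual hn, fun χ h => hu₁' h⟩,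
    ⟨_, isCharSU_adjoint hn, fun χ h => huniq (i := 1) h⟩, ⟨_, hc₀, fun χ h => huniq (i := 0) h⟩,
    fun χ₁ χ₁' χ₂₁ χ₀ h₁ h₁' h₂₁ h₀ g => ?_⟩
  rw [hu₁ h₁, hu₁' h₁', huniq (i := 1) h₂₁, huniq (i := 0) h₀]
  refine ⟨rfl, ?_, trace_suHom_mul_trace_suConj (by omega) g⟩
  beta_reduce
  rw [trace_suConj, Complex.mul_conj']
  push_cast
  rfl

end SpecialUnitary

theorem lemma4p1 :
    -- The groups `SO(2n)`.
    (∀ n : ℕ, 3 ≤ n →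
      (∃! χ, IsCharSOEven n (hookLabel n 1 0) χ) ∧ (∃! χ, IsCharSOEven n (hookLabel n 2 0) χ) ∧
      (∃! χ, IsCharSOEven n (twoOnesLabel n) χ) ∧ (∃! χ, IsCharSOEven n 0 χ) ∧
      ∀ χ₁ χ₂ χ₁₁ χ₀ : SOEven n → ℂ,
        IsCharSOEven n (hookLabel n 1 0) χ₁ → IsCharSOEven n (hookLabel n 2 0) χ₂ →
        IsCharSOEven n (twoOnesLabel n) χ₁₁ → IsCharSOEven n 0 χ₀ →
        ∀ g, (χ₁ g).im = 0 ∧ χ₀ g = 1 ∧ χ₁ g ^ 2 = χ₂ g + χ₁₁ g + χ₀ g) ∧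
    -- The groups `SO(2n+1)`.
    (∀ n : ℕ, 2 ≤ n →
      (∃! χ, IsCharSOOdd n (hookLabel n 1 0) χ) ∧ (∃! χ, IsCharSOOdd n (hookLabel n 2 0) χ) ∧
      (∃! χ, IsCharSOOdd n (twoOnesLabel n) χ) ∧ (∃! χ, IsCharSOOdd n 0 χ) ∧
      ∀ χ₁ χ₂ χ₁₁ χ₀ : SOOdd n → ℂ,
        IsCharSOOdd n (hookLabel n 1 0) χ₁ → IsCharSOOdd n (hookLabel n 2 0) χ₂ →
        IsCharSOOdd n (twoOnesLabel n) χ₁₁ → IsCharSOOdd n 0 χ₀ →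
        ∀ g, (χ₁ g).im = 0 ∧ χ₀ g = 1 ∧ χ₁ g ^ 2 = χ₂ g + χ₁₁ g + χ₀ g) ∧
    -- The groups `USp(n)`.
    (∀ n : ℕ, 2 ≤ n →
      (∃! χ, IsCharUSp n (hookLabel n 1 0) χ) ∧ (∃! χ, IsCharUSp n (hookLabel n 2 0) χ) ∧
      (∃! χ, IsCharUSp n (twoOnesLabel n) χ) ∧ (∃! χ, IsCharUSp n 0 χ) ∧
      ∀ χ₁ χ₂ χ₁₁ χ₀ : USp n → ℂ,
        IsCharUSp n (hookLabel n 1 0) χ₁ → IsCharUSp n (hookLabel n 2 0) χ₂ →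
        IsCharUSp n (twoOnesLabel n) χ₁₁ → IsCharUSp n 0 χ₀ →
        ∀ g, (χ₁ g).im = 0 ∧ χ₀ g = 1 ∧ χ₁ g ^ 2 = χ₂ g + χ₁₁ g + χ₀ g) ∧
    -- The groups `SU(n)`.
    (∀ n : ℕ, 2 ≤ n →
      (∃! χ, IsCharSU n (hookLabel (n - 1) 1 0) χ) ∧ (∃! χ, IsCharSU n (fun _ => 1) χ) ∧
      (∃! χ, IsCharSU n (hookLabel (n - 1) 2 1) χ) ∧ (∃! χ, IsCharSU n 0 χ) ∧
      ∀ χ₁ χ₁' χ₂₁ χ₀ : SUn n → ℂ,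
        IsCharSU n (hookLabel (n - 1) 1 0) χ₁ → IsCharSU n (fun _ => 1) χ₁' →
        IsCharSU n (hookLabel (n - 1) 2 1) χ₂₁ → IsCharSU n 0 χ₀ →
        ∀ g, χ₀ g = 1 ∧ ((‖χ₁ g‖ ^ 2 : ℝ) : ℂ) = χ₁ g * χ₁' g ∧
          χ₁ g * χ₁' g = χ₂₁ g + χ₀ g) :=
  ⟨fun _ hn => standard_character_sq_SOEven hn, fun _ hn => standard_character_sq_SOOdd hn,
    fun _ hn => standard_character_sq_USp hn, fun _ hn => standard_character_normSq_SU hn⟩
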